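/- **Lemma 4.1 (criterion).** Let $p$ be an odd prime and write $H^*(-)=H^*(-;\mathbb{Z}/p)$ for singular cohomology. Let $X$ be a simply connected space with base point such that $$H^*(X)=\mathbb{Z}/p[x_1,\ldots,x_n],\qquad |x_1|<\cdots<|x_n|,$$ where each $x_s$ is homogeneous of degree $|x_s|$. Let $A$ and $B$ be pointed CW complexes (with a vertex as base point), and let $\bar\alpha\colon\Sigma A\to X$ and $\bar\beta\colon\Sigma B\to X$ be pointed maps from the reduced suspensions. Let $1\le i,j,k\le n$, and let $\theta\colon H^{|x_k|}(-)\to H^{l}(-)$ be a cohomology operation (a natural transformation of set-valued functors on spaces). Suppose that: 1. $\bar\alpha^*(x_i)\neq 0$ and $\bar\beta^*(x_j)\neq 0$; 2. $\dim A=|x_i|-1$ and $\dim B=|x_j|-1$; 3. $\theta x_k$ is decomposable (a sum of products of elements of positive degree), and the monomial $x_ix_j$ occurs in the polynomial $\theta x_k$ with a coefficient $c\neq 0$; 4. for every map $\mu\colon\Sigma A\times\Sigma B\to X$ extending $\bar\alpha\vee\bar\beta\colon\Sigma A\vee\Sigma B\to X$, one has $\theta\mu^*(x_k)=0$. Let $\alpha\colon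 A\to\Omega X$ and $\beta\colon B\to\Omega X$ be the adjoints of $\bar\alpha$ and $\bar\beta$. Then the Samelson product $$\langle\alpha,\beta\rangle\colon A\wedge B\to\Omega X$$ is non-trivial. Here $\langle\alpha,\beta\rangle$ is represented by any pointed map whose composite with $A\times B\to A\wedge B$ is pointed homotopic to $(a,b)\mapsto\alpha(a)\beta(b)\alpha(a)^{-1}\beta(b)^{-1}$; the claim is that such a map exists and that none is pointed null-homotopic. -/

import Mathlib

universe u

noncomputable section

/-! ### Cohomology of simplicial sets, with cup product -/

namespace SSetCohomology

open CategoryTheory Simplicial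

/-- The front face `[0, …, m] ⊆ [0, …, N]`. -/
def front {m N : ℕ} (h : m ≤ N) : ⦋m⦌ ⟶ ⦋N⦌ :=
  SimplexCategory.mkHom
    ⟨fun i => ⟨i.val, by omega⟩, fun i j hij => by
      simpa only [Fin.le_def] using hij⟩

/-- The back face `[N - n, …, N] ⊆ [0, …, N]`. -/
def back {n N : ℕ} (h : n ≤ N) : ⦋n⦌ ⟶ ⦋N⦌ :=
  SimplexCategory.mkHom
    ⟨fun i => ⟨N - n + i.val, by omega⟩, fun i j hij => by
      simpa only [Fin.le_def, add_le_add_iff_left] using hij⟩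

/-- The `R`-valued `n`-cochains of a simplicial set: functions on the set of `n`-simplices. -/
abbrev Cochain (R : Type) (K : SSet.{u}) (n : ℕ) : Type u := K _⦋n⦌ → R

variable {R : Type} [CommRing R]

/-- The coboundary `(d f)(σ) = ∑ᵢ (-1)ⁱ f(∂ᵢ σ)`. -/
def d (R : Type) [CommRing R] (K : SSet.{u}) (n : ℕ) :
    Cochain R K n →ₗ[R] Cochain R K (n + 1) where
  toFun f := fun σ => ∑ i : Fin (n + 2), (-1 : R) ^ (i : ℕ) * f (K.δ i σ)
  map_add' f g := by
    funext σ
    simp [mul_add, Finset.sum_add_distrib]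
  map_smul' r f := by
    funext σ
    simp only [Pi.smul_apply, smul_eq_mul, RingHom.id_apply, Finset.mul_sum]
    exact Finset.sum_congr rfl fun i _ => by ring

/-- The cup product of cochains, `(f ∪ g)(σ) = f(front face of σ) g(back face of σ)`. -/
def cup {K : SSet.{u}} {m n N : ℕ} (h : m + n = N) (f : Cochain R K m) (g : Cochain R K n) :
    Cochain R K N :=
  fun σ => f (K.map (front (by omega : m ≤ N)).op σ) * g (K.map (back (by omega : n ≤ N)).op σ)

lemma hom_ext_val {m N : ℕ} {f g : ⦋m⦌ ⟶ ⦋N⦌}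
    (h : ∀ k : Fin (m + 1), (f.toOrderHom k).val = (g.toOrderHom k).val) : f = g := by
  apply SimplexCategory.Hom.ext
  apply OrderHom.ext
  funext k
  exact Fin.ext (h k)

lemma front_val {m N : ℕ} (h : m ≤ N) (k : Fin (m + 1)) :
    ((front h).toOrderHom k).val = k.val := rfl

lemma back_val {n N : ℕ} (h : n ≤ N) (k : Fin (n + 1)) :
    ((back h).toOrderHom k).val = N - n + k.val := rfl

lemma delta_val {n : ℕ} (i : Fin (n + 2)) (k : Fin (n + 1)) :
    ((SimplexCategory.δ i).toOrderHom k).val = if k.val < i.val then k.val else k.val + 1 := by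
  change (i.succAbove k).val = _
  simp only [Fin.succAbove, Fin.lt_def, Fin.val_castSucc]
  split_ifs <;> simp

lemma comp_val {a b c : ℕ} (f : ⦋a⦌ ⟶ ⦋b⦌) (g : ⦋b⦌ ⟶ ⦋c⦌) (k : Fin (a + 1)) :
    ((f ≫ g).toOrderHom k).val = (g.toOrderHom (f.toOrderHom k)).val := rfl

lemma front_delta_le {m N : ℕ} (h : m ≤ N) (i : Fin (N + 2)) (j : Fin (m + 2))
    (hij : i.val = j.val) :
    front h ≫ SimplexCategory.δ i = SimplexCategory.δ j ≫ front (Nat.succ_le_succ h) := by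
  refine hom_ext_val fun k => ?_
  rw [comp_val, comp_val, delta_val, front_val, front_val, delta_val, hij]

lemma front_delta_gt {m N : ℕ} (h : m ≤ N) (i : Fin (N + 2)) (hi : m < i.val) :
    front h ≫ SimplexCategory.δ i = front (Nat.le_succ_of_le h) := by
  refine hom_ext_val fun k => ?_
  rw [comp_val, delta_val, front_val, front_val, if_pos (by omega)]

lemma back_delta_le {n N : ℕ} (h : n ≤ N) (i : Fin (N + 2)) (hi : i.val ≤ N - n) :
    back h ≫ SimplexCategory.δ i = back (Nat.le_succ_of_le h) := by
  refine hom_ext_val fun k => ?_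
  rw [comp_val, delta_val, back_val, back_val, if_neg (by omega)]
  omega

lemma back_delta_ge {n N : ℕ} (h : n ≤ N) (i : Fin (N + 2)) (j : Fin (n + 2))
    (hij : i.val = N - n + j.val) :
    back h ≫ SimplexCategory.δ i = SimplexCategory.δ j ≫ back (Nat.succ_le_succ h) := by
  refine hom_ext_val fun k => ?_
  rw [comp_val, comp_val, delta_val, back_val, back_val, delta_val, hij]
  split_ifs <;> omega

lemma map_comp_apply {K : SSet.{u}} {a b c : ℕ} (f : ⦋a⦌ ⟶ ⦋b⦌) (g : ⦋b⦌ ⟶ ⦋c⦌) (σ : K _⦋c⦌) :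
    K.map f.op (K.map g.op σ) = K.map (f ≫ g).op σ := by
  rw [op_comp, K.map_comp]
  rfl

lemma d_apply {K : SSet.{u}} {n : ℕ} (f : Cochain R K n) (σ : K _⦋n + 1⦌) :
    d R K n f σ = ∑ i : Fin (n + 2), (-1 : R) ^ (i : ℕ) * f (K.map (SimplexCategory.δ i).op σ) :=
  rfl

/-- The Leibniz rule. -/
lemma d_cup {K : SSet.{u}} {m n N : ℕ} (h : m + n = N) (f : Cochain R K m) (g : Cochain R K n) :
    d R K N (cup h f g) =
      cup (by omega : m + 1 + n = N + 1) (d R K m f) g +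
        (-1 : R) ^ m • cup (by omega : m + (n + 1) = N + 1) f (d R K n g) := by
  subst h
  funext σ
  have e : m + 1 + (n + 1) = m + n + 2 := by omega
  rw [d_apply, ← (finCongr e).sum_comp, Fin.sum_univ_add]
  simp only [Pi.add_apply, Pi.smul_apply, smul_eq_mul, cup, d_apply, map_comp_apply]
  rw [Fin.sum_univ_castSucc (n := m + 1), Fin.sum_univ_succ (n := n + 1)]
  have A : ∀ i : Fin (m + 1),
      front (by omega : m ≤ m + n) ≫ SimplexCategory.δ (Fin.cast e (Fin.castAdd (n + 1) i)) =
        SimplexCategory.δ i.castSucc ≫ front (by omega : m + 1 ≤ m + n + 1) := fun i =>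
    front_delta_le _ _ _ (by simp)
  have B : ∀ i : Fin (m + 1),
      back (by omega : n ≤ m + n) ≫ SimplexCategory.δ (Fin.cast e (Fin.castAdd (n + 1) i)) =
        back (by omega : n ≤ m + n + 1) := fun i =>
    back_delta_le _ _ (by simp; omega)
  have C : ∀ i : Fin (n + 1),
      front (by omega : m ≤ m + n) ≫ SimplexCategory.δ (Fin.cast e (Fin.natAdd (m + 1) i)) =
        front (by omega : m ≤ m + n + 1) := fun i =>
    front_delta_gt _ _ (by simp; omega)
  have D : ∀ i : Fin (n + 1),
      back (by omega : n ≤ m + n) ≫ SimplexCategory.δ (Fin.cast e (Fin.natAdd (m + 1) i)) =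
        SimplexCategory.δ i.succ ≫ back (by omega : n + 1 ≤ m + n + 1) := fun i =>
    back_delta_ge _ _ _ (by simp; omega)
  have E : SimplexCategory.δ (Fin.last (m + 1)) ≫ front (by omega : m + 1 ≤ m + n + 1) =
      front (by omega : m ≤ m + n + 1) := by
    refine hom_ext_val fun k => ?_
    rw [comp_val, front_val, front_val, delta_val, if_pos (by simp; omega)]
  have F : SimplexCategory.δ (0 : Fin (n + 2)) ≫ back (by omega : n + 1 ≤ m + n + 1) =
      back (by omega : n ≤ m + n + 1) := by
    refine hom_ext_val fun k => ?_
    rw [comp_val, back_val, back_val, delta_val, if_neg (by simp)]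
    omega
  simp only [finCongr_apply, A, B, C, D, E, F, Fin.val_cast, Fin.val_castAdd, Fin.val_natAdd,
    Fin.val_castSucc, Fin.val_last, Fin.val_succ, Fin.val_zero, pow_zero, one_mul]
  simp only [add_mul, mul_add, Finset.sum_mul, Finset.mul_sum]
  have S : ∀ i : Fin (n + 1), ∀ x y : R, (-1 : R) ^ (m + 1 + i.val) * (x * y) =
      (-1 : R) ^ m * (x * ((-1 : R) ^ (i.val + 1) * y)) := fun i x y => by ring
  simp only [S, ← mul_assoc]
  ring

/-- Cocycles. -/
abbrev cocycles (R : Type) [CommRing R] (K : SSet.{u}) (n : ℕ) : Submodule R (Cochain R K n) :=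
  LinearMap.ker (d R K n)

/-- Coboundaries; there are no nonzero ones in degree `0`. -/
def coboundaries (R : Type) [CommRing R] (K : SSet.{u}) (n : ℕ) : Submodule R (Cochain R K n) :=
  match n with
  | 0 => ⊥
  | n + 1 => LinearMap.range (d R K n)

/-- The cohomology `Hⁿ(K; R)`: cocycles modulo coboundaries. -/
def Cohomology (R : Type) [CommRing R] (K : SSet.{u}) (n : ℕ) : Type u :=
  cocycles R K n ⧸ (coboundaries R K n).submoduleOf (cocycles R K n)

instance instAddCommGroup (R : Type) [CommRing R] (K : SSet.{u}) (n : ℕ) :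
    AddCommGroup (Cohomology R K n) :=
  inferInstanceAs (AddCommGroup
    (cocycles R K n ⧸ (coboundaries R K n).submoduleOf (cocycles R K n)))

instance instModule (R : Type) [CommRing R] (K : SSet.{u}) (n : ℕ) :
    Module R (Cohomology R K n) :=
  inferInstanceAs (Module R
    (cocycles R K n ⧸ (coboundaries R K n).submoduleOf (cocycles R K n)))

/-- The cohomology class of a cocycle. -/
def cls {K : SSet.{u}} {n : ℕ} : cocycles R K n →ₗ[R] Cohomology R K n :=
  Submodule.mkQ _

lemma cls_ind {K : SSet.{u}} {n : ℕ} {P : Cohomology R K n → Prop} (h : ∀ f, P (cls f))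
    (x : Cohomology R K n) : P x :=
  Submodule.Quotient.induction_on _ x h

lemma cup_mem_cocycles {K : SSet.{u}} {m n N : ℕ} (h : m + n = N) {f : Cochain R K m}
    {g : Cochain R K n} (hf : f ∈ cocycles R K m) (hg : g ∈ cocycles R K n) :
    cup h f g ∈ cocycles R K N := by
  rw [LinearMap.mem_ker] at *
  rw [d_cup, hf, hg]
  funext σ
  simp [cup]

/-- The cup product of cochains as a bilinear map. -/
def cupₗ (R : Type) [CommRing R] (K : SSet.{u}) {m n N : ℕ} (h : m + n = N) :
    Cochain R K m →ₗ[R] Cochain R K n →ₗ[R] Cochain R K N :=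
  LinearMap.mk₂ R (cup h)
    (fun f f' g => funext fun σ => by simp [cup, add_mul])
    (fun c f g => funext fun σ => by simp [cup, mul_assoc])
    (fun f g g' => funext fun σ => by simp [cup, mul_add])
    (fun c f g => funext fun σ => by simp [cup]; ring)

lemma cup_left_coboundary {K : SSet.{u}} {m n N : ℕ} (h : m + n = N) {f : Cochain R K m}
    {g : Cochain R K n} (hf : f ∈ coboundaries R K m) (hg : g ∈ cocycles R K n) :
    cup h f g ∈ coboundaries R K N := by
  cases m with
  | zero =>
    have : f = 0 := hf
    subst this
    have : cup h 0 g = 0 := funext fun σ => by simp [cup]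
    rw [this]
    exact Submodule.zero_mem _
  | succ m =>
    obtain ⟨f, rfl⟩ := hf
    obtain ⟨M, rfl⟩ : ∃ M, N = M + 1 := ⟨m + n, by omega⟩
    refine ⟨cup (by omega) f g, ?_⟩
    rw [d_cup, LinearMap.mem_ker.1 hg]
    funext σ
    simp [cup]

lemma cup_right_coboundary {K : SSet.{u}} {m n N : ℕ} (h : m + n = N) {f : Cochain R K m}
    {g : Cochain R K n} (hf : f ∈ cocycles R K m) (hg : g ∈ coboundaries R K n) :
    cup h f g ∈ coboundaries R K N := by
  cases n with
  | zero =>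
    have : g = 0 := hg
    subst this
    have : cup h f 0 = 0 := funext fun σ => by simp [cup]
    rw [this]
    exact Submodule.zero_mem _
  | succ n =>
    obtain ⟨g, rfl⟩ := hg
    obtain ⟨M, rfl⟩ : ∃ M, N = M + 1 := ⟨m + n, by omega⟩
    refine ⟨(-1 : R) ^ m • cup (by omega) f g, ?_⟩
    rw [map_smul, d_cup, LinearMap.mem_ker.1 hf, smul_add, smul_smul, ← mul_pow]
    funext σ
    simp [cup]

lemma cls_eq_zero {K : SSet.{u}} {n : ℕ} {f : cocycles R K n}
    (hf : f.1 ∈ coboundaries R K n) : cls f = 0 :=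
  (Submodule.Quotient.mk_eq_zero _).2 hf

/-- The class of the cup product of two cocycles. -/
def cupCls (R : Type) [CommRing R] (K : SSet.{u}) {m n N : ℕ} (h : m + n = N) :
    cocycles R K m →ₗ[R] cocycles R K n →ₗ[R] Cohomology R K N :=
  LinearMap.mk₂ R (fun f g => cls ⟨cup h f.1 g.1, cup_mem_cocycles h f.2 g.2⟩)
    (fun f f' g => congrArg (cls (R := R) (K := K)) (Subtype.ext (funext fun σ => by simp [cup, add_mul])))
    (fun c f g => congrArg (cls (R := R) (K := K)) (Subtype.ext (funext fun σ => by simp [cup, mul_assoc])))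
    (fun f g g' => congrArg (cls (R := R) (K := K)) (Subtype.ext (funext fun σ => by simp [cup, mul_add])))
    (fun c f g => congrArg (cls (R := R) (K := K)) (Subtype.ext (funext fun σ => by simp [cup]; ring)))

/-- The cup product `Hᵐ(K; R) × Hⁿ(K; R) → Hᴺ(K; R)`, `N = m + n`, as a bilinear map. -/
def cupH (R : Type) [CommRing R] (K : SSet.{u}) {m n N : ℕ} (h : m + n = N) :
    Cohomology R K m →ₗ[R] Cohomology R K n →ₗ[R] Cohomology R K N :=
  LinearMap.flip <| Submodule.liftQ _
    (LinearMap.flip <| Submodule.liftQ _ (cupCls R K h) fun f hf => by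
      refine LinearMap.mem_ker.2 (LinearMap.ext fun g => cls_eq_zero ?_)
      exact cup_left_coboundary h hf g.2) fun g hg => by
    refine LinearMap.mem_ker.2 (LinearMap.ext fun f => ?_)
    induction f using cls_ind with
    | h f => exact cls_eq_zero (cup_right_coboundary h f.2 hg)

lemma cupH_cls {K : SSet.{u}} {m n N : ℕ} (h : m + n = N) (f : cocycles R K m)
    (g : cocycles R K n) :
    cupH R K h (cls f) (cls g) = cls ⟨cup h f.1 g.1, cup_mem_cocycles h f.2 g.2⟩ :=
  rfl

/-- The unit cocycle, constant with value `1`. -/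
def oneCocycle (R : Type) [CommRing R] (K : SSet.{u}) : cocycles R K 0 :=
  ⟨fun _ => 1, by
    rw [LinearMap.mem_ker]
    funext σ
    simp [d, Fin.sum_univ_two]⟩

lemma gradedMk_eq {K : SSet.{u}} {m n : ℕ} (h : m = n) (f : cocycles R K m) (g : cocycles R K n)
    (hfg : ∀ σ : K _⦋n⦌, f.1 (K.map (SimplexCategory.mkHom
      ⟨Fin.cast (by rw [h]), fun _ _ hij => hij⟩ : ⦋m⦌ ⟶ ⦋n⦌).op σ) = g.1 σ) :
    GradedMonoid.mk m (cls f) = GradedMonoid.mk n (cls g) := by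
  subst h
  congr 2
  apply Subtype.ext
  funext σ
  rw [← hfg σ]
  have e : (SimplexCategory.mkHom ⟨Fin.cast rfl, fun _ _ hij => hij⟩ : ⦋m⦌ ⟶ ⦋m⦌) = 𝟙 _ :=
    hom_ext_val fun k => rfl
  rw [e, op_id, K.map_id]
  rfl

instance instGOne (R : Type) [CommRing R] (K : SSet.{u}) :
    GradedMonoid.GOne (Cohomology R K) where
  one := cls (oneCocycle R K)

instance instGMul (R : Type) [CommRing R] (K : SSet.{u}) :
    GradedMonoid.GMul (Cohomology R K) where
  mul {m n} x y := cupH R K (rfl : m + n = m + n) x y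

instance instGMonoid (R : Type) [CommRing R] (K : SSet.{u}) :
    GradedMonoid.GMonoid (Cohomology R K) where
  one_mul := by
    rintro ⟨n, x⟩
    induction x using cls_ind with
    | h f =>
      refine gradedMk_eq (zero_add n) _ _ fun σ => ?_
      simp only [cup, oneCocycle, one_mul, map_comp_apply]
      have e : (back (by omega : n ≤ 0 + n) : ⦋n⦌ ⟶ ⦋0 + n⦌) ≫ (SimplexCategory.mkHom
          ⟨Fin.cast (by rw [zero_add]), fun _ _ hij => hij⟩ : ⦋0 + n⦌ ⟶ ⦋n⦌) = 𝟙 ⦋n⦌ :=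
        hom_ext_val fun k => by
          change 0 + n - n + k.val = k.val
          omega
      rw [e, op_id, K.map_id]
      rfl
  mul_one := by
    rintro ⟨n, x⟩
    induction x using cls_ind with
    | h f =>
      refine gradedMk_eq (add_zero n) _ _ fun σ => ?_
      simp only [cup, oneCocycle, mul_one, map_comp_apply]
      have e : (front (by omega : n ≤ n + 0) : ⦋n⦌ ⟶ ⦋n + 0⦌) ≫ (SimplexCategory.mkHom
          ⟨Fin.cast (by rw [add_zero]), fun _ _ hij => hij⟩ : ⦋n + 0⦌ ⟶ ⦋n⦌) = 𝟙 ⦋n⦌ :=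
        hom_ext_val fun k => rfl
      rw [e, op_id, K.map_id]
      rfl
  mul_assoc := by
    rintro ⟨m, x⟩ ⟨n, y⟩ ⟨k, z⟩
    induction x using cls_ind with
    | h f =>
    induction y using cls_ind with
    | h g =>
    induction z using cls_ind with
    | h h =>
      refine gradedMk_eq (add_assoc m n k) _ _ fun σ => ?_
      simp only [cup, map_comp_apply, mul_assoc]
      have key : ∀ {a : ℕ} (c : cocycles R K a) {φ ψ : ⦋a⦌ ⟶ ⦋m + (n + k)⦌}, φ = ψ →
          c.1 (K.map φ.op σ) = c.1 (K.map ψ.op σ) := fun c _ _ e => by rw [e]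
      refine congrArg₂ _ (key f (hom_ext_val fun i => rfl))
        (congrArg₂ _ (key g (hom_ext_val fun i => ?_)) (key h (hom_ext_val fun i => ?_)))
      · change m + n - n + i.val = m + (n + k) - (n + k) + i.val
        omega
      · change m + n + k - k + i.val = m + (n + k) - (n + k) + (n + k - k + i.val)
        omega

instance instGRing (R : Type) [CommRing R] (K : SSet.{u}) :
    DirectSum.GRing (Cohomology R K) where
  mul_zero _ := map_zero _
  zero_mul _ := LinearMap.map_zero₂ _ _
  mul_add _ _ _ := map_add _ _ _
  add_mul _ _ _ := LinearMap.map_add₂ _ _ _ _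
  one_mul := GradedMonoid.GMonoid.one_mul
  mul_one := GradedMonoid.GMonoid.mul_one
  mul_assoc := GradedMonoid.GMonoid.mul_assoc
  natCast n := (n : R) • cls (oneCocycle R K)
  natCast_zero := by simp
  natCast_succ n := by
    rw [Nat.cast_succ, add_smul, one_smul]
    rfl
  intCast n := (n : R) • cls (oneCocycle R K)
  intCast_ofNat n := by simp
  intCast_negSucc_ofNat n := by
    rw [Int.cast_negSucc, neg_smul]

/-- The map induced on cochains by a map of simplicial sets. -/
def cochainMap (R : Type) [CommRing R] {K L : SSet.{u}} (φ : K ⟶ L) (n : ℕ) :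
    Cochain R L n →ₗ[R] Cochain R K n where
  toFun f := fun σ => f (φ.app _ σ)
  map_add' _ _ := rfl
  map_smul' _ _ := rfl

lemma d_cochainMap {K L : SSet.{u}} (φ : K ⟶ L) (n : ℕ) (f : Cochain R L n) :
    d R K n (cochainMap R φ n f) = cochainMap R φ (n + 1) (d R L n f) := by
  funext σ
  simp only [d_apply, cochainMap, LinearMap.coe_mk, AddHom.coe_mk]
  refine Finset.sum_congr rfl fun i _ => ?_
  rw [NatTrans.naturality_apply]

lemma cochainMap_mem_cocycles {K L : SSet.{u}} (φ : K ⟶ L) {n : ℕ} {f : Cochain R L n}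
    (hf : f ∈ cocycles R L n) : cochainMap R φ n f ∈ cocycles R K n := by
  rw [LinearMap.mem_ker] at *
  rw [d_cochainMap, hf, map_zero]

lemma cochainMap_mem_coboundaries {K L : SSet.{u}} (φ : K ⟶ L) {n : ℕ} {f : Cochain R L n}
    (hf : f ∈ coboundaries R L n) : cochainMap R φ n f ∈ coboundaries R K n := by
  cases n with
  | zero =>
    have : f = 0 := hf
    subst this
    exact Submodule.zero_mem _
  | succ n =>
    obtain ⟨g, rfl⟩ := hf
    exact ⟨cochainMap R φ n g, d_cochainMap φ n g⟩

/-- The map induced on cohomology by a map of simplicial sets. -/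
def map (R : Type) [CommRing R] {K L : SSet.{u}} (φ : K ⟶ L) (n : ℕ) :
    Cohomology R L n →ₗ[R] Cohomology R K n :=
  Submodule.mapQ _ _
    ((cochainMap R φ n).restrict fun _ hf => cochainMap_mem_cocycles φ hf)
    fun _ hf => cochainMap_mem_coboundaries φ hf

end SSetCohomology

namespace Samelson

/-! ### Singular cohomology of spaces and cohomology operations -/

open Topology

/-- Singular cohomology `Hⁿ(Y; ℤ/p)`. -/
abbrev ModCohomology (p : ℕ) (Y : Type u) [TopologicalSpace Y] : ℕ → Type u :=
  SSetCohomology.Cohomology (ZMod p) (TopCat.toSSet.obj (TopCat.of Y))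

/-- The cohomology ring `H^*(Y; ℤ/p) = ⨁ₙ Hⁿ(Y; ℤ/p)`; the product is the cup product. -/
abbrev CohomologyRing (p : ℕ) (Y : Type u) [TopologicalSpace Y] : Type u :=
  DirectSum ℕ (ModCohomology p Y)

/-- The induced map `f^* : Hⁿ(Z; ℤ/p) → Hⁿ(Y; ℤ/p)`. -/
def pullback (p : ℕ) {Y Z : Type u} [TopologicalSpace Y] [TopologicalSpace Z] (f : C(Y, Z))
    (n : ℕ) : ModCohomology p Z n →ₗ[ZMod p] ModCohomology p Y n :=
  SSetCohomology.map (ZMod p) (TopCat.toSSet.map (TopCat.ofHom f)) n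

/-- A cohomology operation of type `(ℤ/p, m; ℤ/p, l)`: a natural transformation of set-valued
functors `Hᵐ(-; ℤ/p) → Hˡ(-; ℤ/p)` on topological spaces. -/
structure CohomologyOperation (p m l : ℕ) where
  /-- The component at a space. -/
  app : ∀ (Y : Type u) [TopologicalSpace Y], ModCohomology p Y m → ModCohomology p Y l
  naturality : ∀ (Y Z : Type u) [TopologicalSpace Y] [TopologicalSpace Z] (f : C(Y, Z))
    (x : ModCohomology p Z m), app Y (pullback p f m x) = pullback p f l (app Z x)

/-- A class is decomposable if it is a sum of products of two classes of positive degree, where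
`u : H^*(Y; ℤ/p)` is of positive degree if its component in degree `0` vanishes. -/
def IsDecomposable {p : ℕ} {Y : Type u} [TopologicalSpace Y] (z : CohomologyRing p Y) : Prop :=
  z ∈ AddSubgroup.closure {w : CohomologyRing p Y | ∃ u v : CohomologyRing p Y, u 0 = 0 ∧ v 0 = 0 ∧ w = u * v}

/-! ### Pointed spaces: suspension, smash product, loops -/

/-- The relation collapsing the subset `S` to a point. -/
def collapseSetoid {Y : Type u} (S : Set Y) : Setoid Y where
  r y z := y = z ∨ (y ∈ S ∧ z ∈ S)
  iseqv :=
    { refl := fun _ => Or.inl rfl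
      symm := fun h => h.elim (fun e => Or.inl e.symm) (fun e => Or.inr ⟨e.2, e.1⟩)
      trans := by
        rintro a b c (rfl | ⟨ha, hb⟩) (rfl | ⟨hb', hc⟩)
        · exact Or.inl rfl
        · exact Or.inr ⟨hb', hc⟩
        · exact Or.inr ⟨ha, hb⟩
        · exact Or.inr ⟨ha, hc⟩ }

/-- The quotient space `Y / S`, with the quotient topology. -/
abbrev Collapse {Y : Type u} (S : Set Y) : Type u := Quotient (collapseSetoid S)

/-- The reduced suspension `ΣA = A × [0,1] / (A × {0,1} ∪ {a₀} × [0,1])`. -/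
abbrev Susp {A : Type u} [TopologicalSpace A] (a₀ : A) : Type u :=
  Collapse {q : A × unitInterval | q.1 = a₀ ∨ q.2 = 0 ∨ q.2 = 1}

namespace Susp

variable {A : Type u} [TopologicalSpace A] {a₀ : A}

/-- The point `[a, t]` of the suspension. -/
def mk (a₀ : A) (a : A) (t : unitInterval) : Susp a₀ := Quotient.mk _ (a, t)

/-- The base point of the suspension. -/
def base (a₀ : A) : Susp a₀ := mk a₀ a₀ 0

lemma mk_eq_base {a : A} {t : unitInterval} (h : a = a₀ ∨ t = 0 ∨ t = 1) :
    mk a₀ a t = base a₀ :=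
  Quotient.sound (Or.inr ⟨h, Or.inl rfl⟩)

lemma continuous_mk (a₀ : A) : Continuous fun q : A × unitInterval => mk a₀ q.1 q.2 :=
  continuous_quot_mk

end Susp

/-- The smash product `A ∧ B = A × B / (A × {b₀} ∪ {a₀} × B)`. -/
abbrev Smash {A B : Type u} [TopologicalSpace A] [TopologicalSpace B] (a₀ : A) (b₀ : B) : Type u :=
  Collapse {q : A × B | q.1 = a₀ ∨ q.2 = b₀}

namespace Smash

variable {A B : Type u} [TopologicalSpace A] [TopologicalSpace B]

/-- The projection `A × B → A ∧ B`. -/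
def proj (a₀ : A) (b₀ : B) : C(A × B, Smash a₀ b₀) := ⟨Quotient.mk _, continuous_quot_mk⟩

/-- The base point of the smash product. -/
def base (a₀ : A) (b₀ : B) : Smash a₀ b₀ := proj a₀ b₀ (a₀, b₀)

end Smash

/-- The loop space `ΩX` at `x₀`. -/
abbrev Loops {X : Type u} [TopologicalSpace X] (x₀ : X) : Type u := Path x₀ x₀

/-- The adjoint `A → ΩX`, `a ↦ (t ↦ f [a, t])`, of a pointed map `f : ΣA → X`. -/
def adjoint {A X : Type u} [TopologicalSpace A] [TopologicalSpace X] {a₀ : A} {x₀ : X}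
    (f : C(Susp a₀, X)) (hf : f (Susp.base a₀) = x₀) : C(A, Loops x₀) where
  toFun a :=
    { toFun := fun t => f (Susp.mk a₀ a t)
      continuous_toFun := f.continuous.comp
        ((Susp.continuous_mk a₀).comp (Continuous.prodMk_right a))
      source' := by rw [Susp.mk_eq_base (Or.inr (Or.inl rfl)), hf]
      target' := by rw [Susp.mk_eq_base (Or.inr (Or.inr rfl)), hf] }
  continuous_toFun :=
    Path.continuous_uncurry_iff.1 (f.continuous.comp (Susp.continuous_mk a₀))

/-- The commutator map `A × B → ΩX`, `(a, b) ↦ α(a) β(b) α(a)⁻¹ β(b)⁻¹`, for concatenation and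
reversal of loops. -/
def commutatorMap {A B X : Type u} [TopologicalSpace A] [TopologicalSpace B] [TopologicalSpace X]
    {x₀ : X} (α : C(A, Loops x₀)) (β : C(B, Loops x₀)) : C(A × B, Loops x₀) where
  toFun q := (((α q.1).trans (β q.2)).trans (α q.1).symm).trans (β q.2).symm
  continuous_toFun := by
    have h1 : Continuous fun q : A × B => α q.1 := by fun_prop
    have h2 : Continuous fun q : A × B => β q.2 := by fun_prop
    exact ((h1.path_trans h2).path_trans (Path.continuous_symm.comp h1)).path_trans
      (Path.continuous_symm.comp h2)

/-- `γ : A ∧ B → ΩX` represents the Samelson product `⟨α, β⟩ ∈ [A ∧ B, ΩX]`: it is a pointed map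
whose composite with `A × B → A ∧ B` is pointed homotopic to the commutator map. (With loops as
inverses only up to homotopy, the commutator map itself is constant on `A ∨ B` only up to
homotopy.) -/
def IsSamelsonProduct {A B X : Type u} [TopologicalSpace A] [TopologicalSpace B]
    [TopologicalSpace X] {a₀ : A} {b₀ : B} {x₀ : X} (α : C(A, Loops x₀)) (β : C(B, Loops x₀))
    (γ : C(Smash a₀ b₀, Loops x₀)) : Prop :=
  γ (Smash.base a₀ b₀) = Path.refl x₀ ∧
    (γ.comp (Smash.proj a₀ b₀)).HomotopicRel (commutatorMap α β) {(a₀, b₀)}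

/-- The CW complex `A` has dimension `n`. -/
def HasCWDimension (A : Type u) [TopologicalSpace A] [CWComplex (Set.univ : Set A)] (n : ℕ) :
    Prop :=
  Nonempty (RelCWComplex.cell (Set.univ : Set A) n) ∧
    ∀ m, n < m → IsEmpty (RelCWComplex.cell (Set.univ : Set A) m)

/-- `a` is a vertex (`0`-cell) of the CW complex `A`. -/
def IsVertex {A : Type u} [TopologicalSpace A] [CWComplex (Set.univ : Set A)] (a : A) : Prop :=
  ∃ e : RelCWComplex.cell (Set.univ : Set A) 0, a ∈ RelCWComplex.openCell 0 e

end Samelson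

end

/-! Suppose that some representative of the Samelson product is null-homotopic. Then the commutator
of `α ∘ pr₁` and `β ∘ pr₂` is null-homotopic, so `αβ` and `βα` are homotopic maps `A × B → ΩX`
(`mul_comm_of_isSamelsonProduct`). Such a homotopy is a family of maps of a square with `α` on two
opposite edges and `β` on the other two, and from it one obtains `μ : ΣA × ΣB → X` that restricts
exactly to the two given maps on the axes (`exists_extension`). The hypothesis on extensions and the
naturality of `θ` give `μ^*(θ x_k) = 0`, which contradicts `pullback_ne_zero`.

The reason for `pullback_ne_zero` is that a suspension of a well-pointed space is covered by two
open sets contractible in it (`twoCover_susp`), so products of positive-degree classes of one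
suspension vanish. Split `μ^* x` into a part from the first factor, a part from the second, and a
mixed remainder, which vanishes over the members of both covers. In a product of two pulled back
classes only the cross terms survive, and products of three vanish (`cup_pullback`). Hence only the
quadratic monomials of the decomposable polynomial `θ x_k` matter. A functional given by the
Eilenberg–Zilber product of two cycles detects the cross product of the classes of `x_i` and `x_j`
(`exists_functional`). As the generators have distinct degrees, it annihilates all other quadratic
monomials. On `x_i x_j` its value is `κ ≠ 0`, or `2κ` if `i = j`, because all degrees are even
(`even_deg`); both are nonzero for odd `p`.

The facts needed about singular cohomology are homotopy invariance, graded commutativity, vanishing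
of cup products subordinate to an open cover, and the Künneth pairing. They are derived from a
calculus of formal combinations of lists of points in standard simplices. A chain operator
compatible with affine maps is homotopic to the identity by a cone construction (`opCochain_sub`);
this is applied to barycentric subdivision and to reversal of the vertices. The facts needed about
`A` and `B` follow from a neighbourhood deformation structure at the base point, built cell by cell
(`exists_ndr`). -/

noncomputable section

/-! ### Chains on lists of vertices -/

namespace ListChain

open Finsupp

variable {R : Type} [CommRing R] {E P Q : Type*}

/-- Formal linear combinations of lists; a list of length `n + 1` is an ordered `n`-simplex, and
the empty list the generator of the augmentation. -/
abbrev Chain (R : Type) [CommRing R] (E : Type*) := List E →₀ R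

/-- The linear extension of a function on lists. -/
abbrev ext {M : Type*} [AddCommGroup M] [Module R M] (f : List E → M) : Chain R E →ₗ[R] M :=
  Finsupp.linearCombination R f

lemma ext_single {M : Type*} [AddCommGroup M] [Module R M] (f : List E → M) (L : List E) :
    ext f (single L (1 : R)) = f L := by
  simp [ext]

lemma hom_ext {M : Type*} [AddCommGroup M] [Module R M] {f g : Chain R E →ₗ[R] M}
    (h : ∀ L, f (single L 1) = g (single L 1)) : f = g :=
  Finsupp.lhom_ext' fun L => LinearMap.ext_ring (h L)

/-- Prepending a vertex. -/
def cone (x : E) : Chain R E →ₗ[R] Chain R E := ext fun L => single (x :: L) 1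

@[simp] lemma cone_single (x : E) (L : List E) :
    cone x (single L (1 : R)) = single (x :: L) 1 := ext_single _ _

/-- The augmented boundary of a list. -/
def bdList (R : Type) [CommRing R] : List E → Chain R E
  | [] => 0
  | x :: l => single l 1 - cone x (bdList R l)

/-- The augmented boundary operator. -/
def bd : Chain R E →ₗ[R] Chain R E := ext (bdList R)

@[simp] lemma bd_single (L : List E) : bd (single L (1 : R)) = bdList R L := ext_single _ _

@[simp] lemma bdList_nil : bdList R ([] : List E) = 0 := rfl

@[simp] lemma bdList_cons (x : E) (l : List E) :
    bdList R (x :: l) = single l 1 - cone x (bdList R l) := rfl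

/-- Coning is a contracting homotopy of the augmented complex. Since the empty list is a generator,
the formula has no exceptional case in low degree, and a cycle is the boundary of its cone. -/
lemma bd_cone (x : E) (c : Chain R E) : bd (cone x c) = c - cone x (bd c) := by
  have : bd ∘ₗ cone x = LinearMap.id - cone x ∘ₗ (bd (R := R)) := hom_ext fun L => by simp
  exact congrArg (fun φ => φ c) this

lemma bd_bdList (L : List E) : bd (bdList R L) = 0 := by
  induction L with
  | nil => simp
  | cons x l ih => rw [bdList_cons, map_sub, bd_cone, ih, bd_single]; simp

lemma bdList_eq_sum (L : List E) :
    bdList R L = ∑ i ∈ Finset.range L.length, (-1 : R) ^ i • single (L.eraseIdx i) 1 := by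
  induction L with
  | nil => simp
  | cons x l ih =>
    rw [bdList_cons, ih, List.length_cons, Finset.sum_range_succ', map_sum, sub_eq_add_neg,
      ← Finset.sum_neg_distrib, add_comm]
    congr 1
    · refine Finset.sum_congr rfl fun i _ => ?_
      rw [map_smul, cone_single, List.eraseIdx_cons_succ, pow_succ]
      simp
    · simp

/-- The degree involution. -/
def sgn : Chain R E →ₗ[R] Chain R E := ext fun L => (-1 : R) ^ L.length • single L 1

@[simp] lemma sgn_single (L : List E) :
    sgn (single L (1 : R)) = (-1 : R) ^ L.length • single L 1 := ext_single _ _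

lemma sgn_cone (x : E) (c : Chain R E) : sgn (cone x c) = - cone x (sgn c) := by
  have : sgn ∘ₗ cone x = - (cone x ∘ₗ sgn (R := R)) := hom_ext fun L => by
    simp [pow_succ, -Finsupp.smul_single]
  exact congrArg (fun φ => φ c) this

lemma sgn_bdList (L : List E) : sgn (bdList R L) = - (-1 : R) ^ L.length • bdList R L := by
  induction L with
  | nil => simp
  | cons x l ih =>
    rw [bdList_cons, map_sub, sgn_cone, ih, sgn_single, List.length_cons, pow_succ, smul_sub,
      neg_smul, map_neg, map_smul]
    module

/-! ### The staircase product -/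

/-- The sum of the staircases in the grid `L × M`, with signs: the Eilenberg–Zilber shuffle
product. -/
def stair (R : Type) [CommRing R] : List P → List Q → Chain R (P × Q)
  | [], _ => 0
  -- The asymmetric conventions for empty lists make each staircase end exactly once: at the last
  -- corner the first branch gives zero and the second gives the empty list. Staircases that exhaust
  -- `M` before `L` are discarded.
  | _ :: l, [] => if l = [] then single [] 1 else 0
  | x :: l, y :: m =>
    cone (x, y) (stair R l (y :: m) + (-1 : R) ^ l.length • stair R (x :: l) m)
termination_by L M => L.length + M.length

lemma stair_nil (M : List Q) : stair R ([] : List P) M = 0 := by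
  rw [stair]

lemma stair_cons_nil (x : P) (l : List P) :
    stair R (x :: l) ([] : List Q) = if l = [] then single [] 1 else 0 := by
  rw [stair]

lemma stair_cons_cons (x : P) (l : List P) (y : Q) (m : List Q) :
    stair R (x :: l) (y :: m) =
      cone (x, y) (stair R l (y :: m) + (-1 : R) ^ l.length • stair R (x :: l) m) := by
  rw [stair]

/-- The staircase product of chains. -/
def stair₂ : Chain R P →ₗ[R] Chain R Q →ₗ[R] Chain R (P × Q) :=
  ext fun L => ext (stair R L)

@[simp] lemma stair₂_single (L : List P) (M : List Q) :
    stair₂ (single L (1 : R)) (single M 1) = stair R L M := by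
  simp [stair₂, ext]

/-- The recursion of `stair` extended to chains, where the length of the list is no longer
available; `sgn` carries the sign in its place. -/
lemma stair₂_cone (x : P) (c : Chain R P) (y : Q) (m : List Q) :
    stair₂ (cone x c) (single (y :: m) 1) =
      cone (x, y) (stair₂ c (single (y :: m) 1) + stair₂ (cone x (sgn c)) (single m 1)) := by
  have : (stair₂.flip (single (y :: m) (1 : R))) ∘ₗ cone x = cone (x, y) ∘ₗ
      (stair₂.flip (single (y :: m) (1 : R)) +
        (stair₂.flip (single m (1 : R))) ∘ₗ cone x ∘ₗ sgn) := hom_ext fun L => by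
    simp [stair_cons_cons, -Finsupp.smul_single]
  exact congrArg (fun φ => φ c) this

lemma stair₂_cone_right (x : P) (l : List P) (y : Q) (c : Chain R Q) :
    stair₂ (single (x :: l) (1 : R)) (cone y c) =
      cone (x, y) (stair₂ (single l 1) (cone y c) +
        (-1 : R) ^ l.length • stair₂ (single (x :: l) 1) c) := by
  have : (stair₂ (single (x :: l) (1 : R))) ∘ₗ cone y = cone (x, y) ∘ₗ
      (stair₂ (single l (1 : R)) ∘ₗ cone y +
        (-1 : R) ^ l.length • (stair₂ (single (x :: l) (1 : R)))) := hom_ext fun L => by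
    simp [stair_cons_cons]
  exact congrArg (fun φ => φ c) this

/-- Pairing with the empty list sums the coefficients of the one-element lists, and this sum is zero
on a boundary: an edge contributes its two ends with opposite signs. -/
lemma stair₂_nil_right (L : List P) : stair₂ (bdList R L) (single ([] : List Q) 1) = 0 := by
  rcases L with _ | ⟨x, _ | ⟨x', l⟩⟩
  · simp
  · simp [stair_nil]
  · have h : ∀ c : Chain R P, stair₂ (cone x (cone x' c)) (single ([] : List Q) (1 : R)) = 0 := by
      intro c
      have : (stair₂.flip (single ([] : List Q) (1 : R))) ∘ₗ cone x ∘ₗ cone x' = 0 :=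
        hom_ext fun L => by simp [stair_cons_nil]
      exact congrArg (fun φ => φ c) this
    simp [h, stair_cons_nil]

/-- The Leibniz rule for the staircase product. -/
lemma bd_stair : ∀ (L : List P) (M : List Q), bd (stair R L M) =
    stair₂ (bdList R L) (single M 1) - (-1 : R) ^ L.length • stair₂ (single L 1) (bdList R M)
  | [], M => by
    have : stair₂ (single ([] : List P) (1 : R)) (bdList R M) = 0 := by
      have : stair₂ (single ([] : List P) (1 : R)) = (0 : Chain R Q →ₗ[R] _) :=
        hom_ext fun L => by simp [stair_nil]
      rw [this]; rfl
    simp [stair_nil, this]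
  | x :: l, [] => by
    rw [stair_cons_nil, stair₂_nil_right]
    split_ifs <;> simp
  | x :: l, y :: m => by
    have h1 := bd_stair l (y :: m)
    have h2 := bd_stair (x :: l) m
    have e : ((-1 : R) ^ l.length) * (-1 : R) ^ l.length = 1 := by
      rw [← mul_pow]; simp
    rw [stair_cons_cons, bd_cone, map_add, map_smul, h1, h2]
    simp only [bdList_cons, map_sub, LinearMap.sub_apply, stair₂_single, stair₂_cone,
      stair₂_cone_right, List.length_cons, pow_succ, sgn_bdList, map_add, map_smul, map_neg,
      LinearMap.smul_apply, LinearMap.neg_apply, neg_smul, smul_sub, smul_add, smul_neg,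
      smul_smul, mul_neg, neg_mul, mul_one, e, one_smul]
    abel
termination_by L M => L.length + M.length

/-- Naturality of the staircase product under maps of vertices. -/
lemma map_stair {P' Q' : Type*} (f : P → P') (g : Q → Q') : ∀ (L : List P) (M : List Q),
    ext (fun ξ => single (ξ.map (Prod.map f g)) 1) (stair R L M) = stair R (L.map f) (M.map g)
  | [], M => by simp [stair_nil]
  | x :: l, [] => by
    simp only [List.map_cons, List.map_nil, stair_cons_nil, List.map_eq_nil_iff]
    split_ifs <;> simp
  | x :: l, y :: m => by
    have h1 := map_stair f g l (y :: m)
    have h2 := map_stair f g (x :: l) m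
    have h3 : ∀ c : Chain R (P × Q), ext (fun ξ => single (ξ.map (Prod.map f g)) (1 : R))
        (cone (x, y) c) = cone (f x, g y) (ext (fun ξ => single (ξ.map (Prod.map f g)) 1) c) := by
      intro c
      have : (ext (fun ξ => single (ξ.map (Prod.map f g)) (1 : R))) ∘ₗ cone (x, y) =
        cone (f x, g y) ∘ₗ (ext (fun ξ => single (ξ.map (Prod.map f g)) (1 : R))) :=
        hom_ext fun L => by
          rw [LinearMap.comp_apply, LinearMap.comp_apply, cone_single, ext_single, ext_single,
            cone_single]; rfl
      exact congrArg (fun φ => φ c) this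
    rw [List.map_cons, List.map_cons, stair_cons_cons, stair_cons_cons, h3, map_add, map_smul, h1,
      h2]
    simp
termination_by L M => L.length + M.length

/-- A function on lists vanishing on the lists with two equal consecutive entries. -/
def Nondeg (a : List P → R) : Prop := ∀ u x v, a (u ++ x :: x :: v) = 0

lemma Nondeg.cons {a : List P → R} (h : Nondeg a) (y : P) : Nondeg fun l => a (y :: l) :=
  fun u x v => h (y :: u) x v

/-- A staircase with a step in the first coordinate repeats an entry in the second, where `b`
vanishes. Only when the first list is a single vertex is there a staircase without such a step. -/
lemma ext_snd_stair (x : P) (l : List P) : ∀ (M : List Q) {b : List Q → R}, Nondeg b →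
    ext (fun ξ : List (P × Q) => b (ξ.map Prod.snd)) (stair R (x :: l) M) =
      if l = [] then b M else 0
  | [], b, _ => by
    rw [stair_cons_nil]
    split_ifs <;> simp
  | y :: m, b, hb => by
    have hc : ∀ (b : List Q → R) (z : P × Q) (c : Chain R (P × Q)),
        ext (fun ξ : List (P × Q) => b (ξ.map Prod.snd)) (cone z c) =
          ext (fun ξ : List (P × Q) => b (z.2 :: ξ.map Prod.snd)) c := by
      intro b z c
      have : ext (fun ξ : List (P × Q) => b (ξ.map Prod.snd)) ∘ₗ cone (R := R) z =
          ext (fun ξ : List (P × Q) => b (z.2 :: ξ.map Prod.snd)) := hom_ext fun L => by simp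
      exact congrArg (fun φ => φ c) this
    rw [stair_cons_cons, hc, map_add, map_smul]
    have h1 : ext (fun ξ : List (P × Q) => b (y :: ξ.map Prod.snd)) (stair R l (y :: m)) = 0 := by
      rcases l with _ | ⟨x', l⟩
      · simp [stair_nil]
      · rw [stair_cons_cons, hc (fun l => b (y :: l))]
        have : (fun ξ : List (P × Q) => b (y :: y :: ξ.map Prod.snd)) = fun _ => 0 :=
          funext fun ξ => hb [] y _
        simp only [this]
        simp [Finsupp.linearCombination_apply]
    rw [h1, ext_snd_stair x l m (hb.cons y), zero_add]
    split_ifs with hl <;> simp [hl]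

/-- The Alexander–Whitney component of a pair of functions on lists. -/
def frontBack (a : List P → R) (b : List Q → R) (r : ℕ) : List (P × Q) → R :=
  fun ξ => a ((ξ.take (r + 1)).map Prod.fst) * b ((ξ.drop r).map Prod.snd)

/-- The Alexander–Whitney map is inverse to the staircase product on normalized functions. -/
lemma ext_frontBack_stair : ∀ (r : ℕ) {a : List P → R} {b : List Q → R}, Nondeg a → Nondeg b →
    ∀ (x : P) (l : List P) (y : Q) (m : List Q), r ≤ l.length + m.length →
    ext (frontBack a b r) (stair R (x :: l) (y :: m)) =
      if l.length = r then a (x :: l) * b (y :: m) else 0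
  | 0, a, b, ha, hb, x, l, y, m, _ => by
    -- For `r = 0` the front part is the single vertex `x`, so its value factors out and the rest is
    -- a projection to the second coordinate.
    have hc : ∀ c : Chain R (P × Q), ext (frontBack a b 0) (cone (x, y) c) =
        a [x] * ext (fun ξ : List (P × Q) => b (ξ.map Prod.snd)) (cone (x, y) c) := by
      intro c
      have : ext (frontBack a b 0) ∘ₗ cone (R := R) (x, y) =
          a [x] • ext (fun ξ : List (P × Q) => b (ξ.map Prod.snd)) ∘ₗ cone (x, y) :=
        hom_ext fun L => by simp [frontBack]
      exact congrArg (fun φ => φ c) this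
    rw [stair_cons_cons, hc, ← stair_cons_cons, ext_snd_stair x l _ hb]
    simp only [List.length_eq_zero_iff]
    split_ifs with hl <;> simp [hl]
  | r + 1, a, b, ha, hb, x, l, y, m, hr => by
    have hc : ∀ (r : ℕ) (a : List P → R) (z : P × Q) (c : Chain R (P × Q)),
        ext (frontBack a b (r + 1)) (cone z c) =
        ext (frontBack (fun l => a (z.1 :: l)) b r) c := by
      intro r a z c
      have : ext (frontBack a b (r + 1)) ∘ₗ cone (R := R) z =
          ext (frontBack (fun l => a (z.1 :: l)) b r) :=
        hom_ext fun L => by simp [frontBack]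
      exact congrArg (fun φ => φ c) this
    rw [stair_cons_cons, hc, map_add, map_smul]
    -- If the first step goes in the second coordinate, the front part, which has at least two
    -- entries, begins with `x` twice and `a` vanishes on it.
    have h2 : (-1 : R) ^ l.length •
        ext (frontBack (fun l => a (x :: l)) b r) (stair R (x :: l) m) = 0 := by
      rcases m with _ | ⟨y', m⟩
      · rw [stair_cons_nil, if_neg (by rintro rfl; simp at hr)]; simp
      · rw [stair_cons_cons]
        have : ∀ c : Chain R (P × Q),
            ext (frontBack (fun l => a (x :: l)) b r) (cone (x, y') c) = 0 := by
          intro c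
          have : ext (frontBack (fun l => a (x :: l)) b r) ∘ₗ cone (R := R) (x, y') = 0 :=
            hom_ext fun L => by
              simp only [LinearMap.comp_apply, cone_single, ext_single, frontBack,
                List.take_succ_cons, List.map_cons, LinearMap.zero_apply]
              exact mul_eq_zero_of_left (ha [] x _) _
          exact congrArg (fun φ => φ c) this
        rw [this, smul_zero]
    rw [h2, add_zero]
    rcases l with _ | ⟨x', l⟩
    · simp [stair_nil]
    · rw [ext_frontBack_stair r (ha.cons x) hb x' l y m (by simp at hr; omega)]
      simp

end ListChain

namespace ListChain

open Finsupp

variable {R : Type} [CommRing R] {E E' : Type*}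

/-! ### Natural chain operators are homotopic to the identity -/

lemma ext_bdList {M : Type*} [AddCommGroup M] [Module R M] (f : List E → M) (L : List E) :
    ext f (bdList R L) = ∑ i ∈ Finset.range L.length, (-1 : R) ^ i • f (L.eraseIdx i) := by
  rw [bdList_eq_sum, map_sum]
  exact Finset.sum_congr rfl fun i _ => by rw [map_smul, ext_single]

/-- The inductive step for operators defined on boundaries: `bdList R L` only involves lists with
one entry fewer than `L`. -/
lemma hom_eq_on_bdList {M : Type*} [AddCommGroup M] [Module R M] {f g : Chain R E →ₗ[R] M}
    {L : List E} (h : ∀ L' : List E, L'.length + 1 = L.length → f (single L' 1) = g (single L' 1)) :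
    f (bdList R L) = g (bdList R L) := by
  rw [bdList_eq_sum, map_sum, map_sum]
  refine Finset.sum_congr rfl fun i hi => ?_
  rw [map_smul, map_smul, h]
  rw [List.length_eraseIdx_of_lt (Finset.mem_range.1 hi)]
  have := Finset.mem_range.1 hi
  omega

/-- The map of chains induced by a map of vertices. -/
def mapChain (R : Type) [CommRing R] (f : E → E') : Chain R E →ₗ[R] Chain R E' :=
  ext fun L => single (L.map f) 1

@[simp] lemma mapChain_single (f : E → E') (L : List E) :
    mapChain R f (single L 1) = single (L.map f) 1 := ext_single _ _

lemma mapChain_cone (f : E → E') (x : E) (c : Chain R E) :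
    mapChain R f (cone x c) = cone (f x) (mapChain R f c) := by
  have : mapChain R f ∘ₗ cone x = cone (f x) ∘ₗ mapChain R f := hom_ext fun L => by simp
  exact congrArg (fun φ => φ c) this

lemma mapChain_bdList (f : E → E') (L : List E) :
    mapChain R f (bdList R L) = bdList R (L.map f) := by
  induction L with
  | nil => simp
  | cons x l ih => simp [mapChain_cone, ih]

/-- A family of operators on chains, the `n`-th of which is meant to be applied to lists of length
at most `n`, commuting with the boundary and fixing the augmentation. -/
structure IsChainOp (T : ℕ → List E → Chain R E) : Prop where
  nil : ∀ n, T n [] = single [] 1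
  bd : ∀ n L, L.length ≤ n + 1 → bd (T (n + 1) L) = ext (T n) (bdList R L)

/-- The homotopy from the identity to a chain operator, by the cone construction. -/
def htpy (T : ℕ → List E → Chain R E) : ℕ → List E → Chain R E
  | 0, _ => 0
  | _ + 1, [] => 0
  | n + 1, x :: l => cone x (T (n + 1) (x :: l) - single (x :: l) 1 -
      ext (htpy T n) (bdList R (x :: l)))

/-- This is `∂h + h∂ = T - 1`. By induction `T - 1 - h∂` has zero boundary on `L`, so it is the
boundary of its cone, which is how `htpy` is defined. -/
lemma bd_htpy {T : ℕ → List E → Chain R E} (hT : IsChainOp T) : ∀ (n : ℕ) (L : List E),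
    L.length ≤ n + 1 →
    bd (htpy T (n + 1) L) + ext (htpy T n) (bdList R L) = T (n + 1) L - single L 1
  | n, [], _ => by simp [htpy, hT.nil]
  | 0, x :: l, h => by
    obtain rfl : l = [] := List.length_eq_zero_iff.1 (by simpa using h)
    rw [htpy, bd_cone, map_sub (bd (R := R)), map_sub (bd (R := R)), hT.bd _ _ h]
    have : ext (R := R) (htpy T 0) = 0 := hom_ext fun L => by simp [htpy]
    simp [this, hT.nil]
  | n + 1, x :: l, h => by
    have e : bd (ext (htpy T (n + 1)) (bdList R (x :: l))) =
        ext (T (n + 1)) (bdList R (x :: l)) - bdList R (x :: l) := by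
      have := hom_eq_on_bdList (R := R) (L := x :: l)
        (f := bd ∘ₗ ext (htpy T (n + 1)) + ext (htpy T n) ∘ₗ bd)
        (g := ext (T (n + 1)) - LinearMap.id) fun L' h' => by
          have := bd_htpy hT n L' (by omega)
          simpa using this
      simpa [bd_bdList, -bdList_cons] using this
    rw [htpy, bd_cone, map_sub (bd (R := R)), map_sub (bd (R := R)), hT.bd _ _ h, e, bd_single]
    simp

/-- The cone point of `htpy` is the first vertex of the list itself, hence is respected by every map
of vertices; no choice destroys naturality. -/
lemma mapChain_htpy {T : ℕ → List E → Chain R E} {T' : ℕ → List E' → Chain R E'} {f : E → E'}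
    (h : ∀ n L, mapChain R f (T n L) = T' n (L.map f)) : ∀ (n : ℕ) (L : List E),
    mapChain R f (htpy T n L) = htpy T' n (L.map f)
  | 0, L => by simp [htpy]
  | n + 1, [] => by simp [htpy]
  | n + 1, x :: l => by
    have e : mapChain R f (ext (htpy T n) (bdList R (x :: l))) =
        ext (htpy T' n) (bdList R ((x :: l).map f)) := by
      rw [← mapChain_bdList]
      exact hom_eq_on_bdList (f := mapChain R f ∘ₗ ext (htpy T n))
        (g := ext (htpy T' n) ∘ₗ mapChain R f) fun L' _ => by simp [mapChain_htpy h n L']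
    rw [htpy, mapChain_cone, map_sub (mapChain R f), map_sub (mapChain R f), h, e, mapChain_single]
    rfl

/-! ### Subdivision -/

/-- Subdivision, given a choice of "barycenters". -/
def sd (R : Type) [CommRing R] (b : List E → E) : ℕ → List E → Chain R E
  -- Stopping with the identity keeps the compatibility with boundaries valid for lists of any
  -- length. The full subdivision is reached once the index is at least the length.
  | 0, L => single L 1
  | _ + 1, [] => single [] 1
  | n + 1, x :: l => cone (b (x :: l)) (ext (sd R b n) (bdList R (x :: l)))

/-- The chain that is coned off is the subdivided boundary, a cycle by induction, so `bd_cone`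
returns it unchanged. -/
lemma bd_sd (b : List E → E) : ∀ (n : ℕ) (L : List E),
    bd (sd R b (n + 1) L) = ext (sd R b n) (bdList R L)
  | n, [] => by simp [sd]
  | 0, x :: l => by
    have : ext (sd R b 0) = LinearMap.id := hom_ext fun L => by simp [sd]
    rw [sd, this, bd_cone, LinearMap.id_apply, bd_bdList, map_zero, sub_zero]
  | n + 1, x :: l => by
    have : bd (ext (sd R b (n + 1)) (bdList R (x :: l))) = 0 := by
      have := hom_eq_on_bdList (R := R) (L := x :: l)
        (f := bd ∘ₗ ext (sd R b (n + 1))) (g := ext (sd R b n) ∘ₗ bd) fun L' _ => by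
          simp [bd_sd b n L']
      simpa [bd_bdList, -bdList_cons] using this
    rw [sd, bd_cone, this, map_zero, sub_zero]

lemma isChainOp_sd (b : List E → E) : IsChainOp (sd R b) where
  nil n := by cases n <;> rfl
  bd n L _ := bd_sd b n L

lemma mapChain_sd {b : List E → E} {b' : List E' → E'} {f : E → E'}
    (h : ∀ L ≠ [], f (b L) = b' (L.map f)) : ∀ (n : ℕ) (L : List E),
    mapChain R f (sd R b n L) = sd R b' n (L.map f)
  | 0, L => by simp [sd]
  | n + 1, [] => by simp [sd]
  | n + 1, x :: l => by
    have e : mapChain R f (ext (sd R b n) (bdList R (x :: l))) =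
        ext (sd R b' n) (bdList R ((x :: l).map f)) := by
      rw [← mapChain_bdList]
      exact hom_eq_on_bdList (f := mapChain R f ∘ₗ ext (sd R b n))
        (g := ext (sd R b' n) ∘ₗ mapChain R f) fun L' _ => by simp [mapChain_sd h n L']
    rw [sd, mapChain_cone, e, h _ (by simp)]
    rfl

/-- Deleting either of the two equal entries gives the same list with opposite signs, and every
other face still has a repeated entry. -/
lemma ext_bdList_dup {M : Type*} [AddCommGroup M] [Module R M] (x : E) (v : List E) :
    ∀ (u : List E) (F : List E → M), (∀ (u' : List E) (y : E) (v' : List E),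
      u'.length + v'.length + 1 = u.length + v.length → F (u' ++ y :: y :: v') = 0) →
    ext F (bdList R (u ++ x :: x :: v)) = 0
  | [], F, h => by
    have e : bdList R ([] ++ x :: x :: v) = cone x (cone x (bdList R v)) := by simp
    rw [e]
    have := hom_eq_on_bdList (R := R) (L := v) (f := ext F ∘ₗ cone x ∘ₗ cone x) (g := 0)
      fun L' h' => by
        simpa using h [] x L' (by simp; omega)
    simpa using this
  | y :: u, F, h => by
    have e : bdList R (y :: u ++ x :: x :: v) =
      single (u ++ x :: x :: v) 1 - cone y (bdList R (u ++ x :: x :: v)) := rfl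
    have hc : ext F ∘ₗ cone (R := R) y = ext fun L => F (y :: L) := hom_ext fun L => by simp
    have h2 := ext_bdList_dup x v u (fun L => F (y :: L)) fun u' z v' h' =>
      h (y :: u') z v' (by simp; omega)
    rw [← hc] at h2
    rw [e, map_sub, ext_single, h u x v (by simp; omega), ← LinearMap.comp_apply, h2, sub_zero]

/-- Subdivision kills degenerate simplices. -/
lemma sd_dup (b : List E → E) : ∀ (n : ℕ) (u : List E) (x : E) (v : List E),
    u.length + v.length + 2 ≤ n → sd R b n (u ++ x :: x :: v) = 0
  | n + 1, u, x, v, h => by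
    obtain ⟨y, l, hl⟩ : ∃ y l, u ++ x :: x :: v = y :: l := by cases u <;> simp
    rw [hl, sd, ← hl, ext_bdList_dup, map_zero]
    exact fun u' y v' h' => sd_dup b n u' y v' (by omega)

/-! ### Reversal -/

/-- The sign of the reversal of a list of length `k`. -/
def revSign (R : Type) [CommRing R] : ℕ → R
  | 0 => 1
  | k + 1 => revSign R k * (-1) ^ k

/-- `revSign R k` is the parity of the number of pairs among `k` objects, and `C(m+n+1, 2) = C(m+1,
2) + C(n+1, 2) + mn`. The term `mn` becomes the sign of graded commutativity. -/
lemma revSign_add (m n : ℕ) :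
    revSign R (m + n + 1) = revSign R (m + 1) * revSign R (n + 1) * (-1) ^ (m * n) := by
  induction n with
  | zero => simp [revSign]
  | succ n ih =>
    have e1 : revSign R (m + (n + 1) + 1) = revSign R (m + n + 1) * (-1) ^ (m + n + 1) := rfl
    have e2 : revSign R (n + 1 + 1) = revSign R (n + 1) * (-1) ^ (n + 1) := rfl
    rw [e1, e2, ih]
    ring

/-- The signed reversal of the vertices. -/
def rev (R : Type) [CommRing R] (_ : ℕ) (L : List E) : Chain R E :=
  revSign R L.length • single L.reverse 1

/-- For a list of length `k + 1`, deleting position `i` and then reversing is reversing and then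
deleting position `k - i`. The resulting sign `(-1) ^ k` is the ratio of consecutive values of
`revSign`. -/
lemma isChainOp_rev : IsChainOp (rev R (E := E)) where
  nil n := by simp [rev, revSign]
  bd n L _ := by
    rw [ext_bdList, rev, map_smul, bd_single, bdList_eq_sum, List.length_reverse,
      ← Finset.sum_range_reflect, Finset.smul_sum]
    refine Finset.sum_congr rfl fun i hi => ?_
    obtain ⟨k, hk⟩ : ∃ k, L.length = k + 1 := ⟨L.length - 1, by
      have := Finset.mem_range.1 hi; omega⟩
    have hik : i ≤ k := by
      have := Finset.mem_range.1 hi; omega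
    have e : (L.reverse).eraseIdx (L.length - 1 - i) = (L.eraseIdx i).reverse := by
      rw [List.eraseIdx_eq_take_drop_succ, List.eraseIdx_eq_take_drop_succ, List.take_reverse,
        List.drop_reverse, List.reverse_append]
      congr 3 <;> omega
    rw [rev, e, List.length_eraseIdx_of_lt (Finset.mem_range.1 hi), hk, smul_smul, smul_smul,
      revSign]
    congr 1
    have : k + 1 - 1 - i = k - i := by omega
    rw [this, Nat.add_sub_cancel]
    have : (-1 : R) ^ k * (-1) ^ (k - i) = (-1) ^ i := by
      rw [← pow_add]
      have : k + (k - i) = i + 2 * (k - i) := by omega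
      rw [this, pow_add, pow_mul]
      simp
    rw [mul_assoc, this, mul_comm]

lemma mapChain_rev (f : E → E') (n : ℕ) (L : List E) :
    mapChain R f (rev R n L) = rev R n (L.map f) := by
  rw [rev, rev, map_smul, mapChain_single, List.map_reverse, List.length_map]

end ListChain

/-! ### Affine maps between standard simplices -/

namespace SimplexAffine

variable {ι κ μ : Type*} [Fintype ι] [Fintype κ] [Fintype μ]

/-- The affine map of standard simplices with given images of the vertices. -/
def affine (v : ι → stdSimplex ℝ κ) : C(stdSimplex ℝ ι, stdSimplex ℝ κ) where
  toFun x := ⟨fun j => ∑ i, x i * v i j, fun j =>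
    Finset.sum_nonneg fun i _ => mul_nonneg (x.2.1 i) ((v i).2.1 j), by
      rw [Finset.sum_comm]
      simp only [← Finset.mul_sum]
      simp⟩
  continuous_toFun := by
    refine Continuous.subtype_mk (continuous_pi fun j => continuous_finsetSum _ fun i _ => ?_) _
    exact ((continuous_apply i).comp continuous_subtype_val).mul continuous_const

lemma affine_apply (v : ι → stdSimplex ℝ κ) (x : stdSimplex ℝ ι) (j : κ) :
    affine v x j = ∑ i, x i * v i j := rfl

lemma affine_vertex [DecidableEq ι] (v : ι → stdSimplex ℝ κ) (i : ι) :
    affine v (stdSimplex.vertex i) = v i := by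
  ext j
  rw [affine_apply]
  simp [Pi.single_apply]

lemma affine_vertices [DecidableEq ι] :
    affine (fun i : ι => stdSimplex.vertex (S := ℝ) i) = ContinuousMap.id _ := by
  ext x j
  rw [affine_apply]
  simp [Pi.single_apply]

lemma affine_affine (v : ι → stdSimplex ℝ κ) (w : μ → stdSimplex ℝ ι) (x : stdSimplex ℝ μ) :
    affine v (affine w x) = affine (fun k => affine v (w k)) x := by
  ext j
  simp only [affine_apply, Finset.sum_mul, Finset.mul_sum]
  rw [Finset.sum_comm]
  simp only [mul_assoc]

lemma map_eq_affine [DecidableEq κ] (f : ι → κ) (x : stdSimplex ℝ ι) :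
    stdSimplex.map f x = affine (fun i => stdSimplex.vertex (f i)) x := by
  classical
  ext j
  rw [affine_apply, stdSimplex.map_coe, FunOnFinite.linearMap_apply_apply, Finset.sum_filter]
  refine Finset.sum_congr rfl fun i _ => ?_
  simp [Pi.single_apply, eq_comm]

lemma affine_map [DecidableEq κ] (v : κ → stdSimplex ℝ μ) (f : ι → κ) (x : stdSimplex ℝ ι) :
    affine v (stdSimplex.map f x) = affine (v ∘ f) x := by
  rw [map_eq_affine, affine_affine]
  simp only [affine_vertex]
  rfl

end SimplexAffine

/-! ### Evaluating cochains on lists of vertices -/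

namespace SSetCohomology

open CategoryTheory Simplicial ListChain SimplexAffine

variable {R : Type} [CommRing R]

/-- A natural way of making ordered simplices in `K` out of finite sequences of points of `E`. -/
structure Realization (E : Type*) (K : SSet.{u}) where
  /-- The simplex with given vertices. -/
  toFun : ∀ n : ℕ, (Fin (n + 1) → E) → K _⦋n⦌
  map : ∀ {m n : ℕ} (θ : ⦋m⦌ ⟶ ⦋n⦌) (v : Fin (n + 1) → E),
    K.map θ.op (toFun n v) = toFun m fun i => v (θ.toOrderHom i)

namespace Realization

variable {E : Type*} {K : SSet.{u}} (ρ : Realization E K)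

/-- The value of a cochain on a list of vertices; it is zero if the length is wrong. -/
def ev {n : ℕ} (f : Cochain R K n) (L : List E) : R :=
  if h : L.length = n + 1 then f (ρ.toFun n fun i => L[i.val]) else 0

lemma ev_of_ne {n : ℕ} (f : Cochain R K n) {L : List E} (h : L.length ≠ n + 1) :
    ρ.ev f L = 0 := dif_neg h

lemma ev_ofFn {n : ℕ} (f : Cochain R K n) (v : Fin (n + 1) → E) :
    ρ.ev f (List.ofFn v) = f (ρ.toFun n v) := by
  rw [ev, dif_pos (by simp)]
  congr 2
  funext i
  exact List.getElem_ofFn _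

lemma eraseIdx_ofFn {n : ℕ} (v : Fin (n + 1) → E) (i : Fin (n + 1)) :
    (List.ofFn v).eraseIdx i = List.ofFn fun j => v (i.succAbove j) := by
  refine List.ext_getElem ?_ fun j h1 h2 => ?_
  · rw [List.length_eraseIdx_of_lt (by simp [i.isLt])]
    simp
  · rw [List.getElem_eraseIdx]
    simp only [List.getElem_ofFn, Fin.succAbove, Fin.lt_def, Fin.val_castSucc]
    split_ifs <;> rfl

lemma exists_ofFn {n : ℕ} {L : List E} (h : L.length = n) : ∃ v : Fin n → E, L = List.ofFn v := by
  subst h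
  exact ⟨L.get, (List.ofFn_get L).symm⟩

/-- Evaluation is compatible with the boundary. -/
lemma ev_bd {n : ℕ} (f : Cochain R K n) (L : List E) :
    ext (ρ.ev f) (bdList R L) = ρ.ev (d R K n f) L := by
  rw [ext_bdList]
  by_cases h : L.length = n + 1 + 1
  · obtain ⟨v, rfl⟩ := exists_ofFn h
    rw [ev_ofFn, d_apply, List.length_ofFn, Finset.sum_range]
    refine Finset.sum_congr rfl fun i _ => ?_
    rw [eraseIdx_ofFn, ev_ofFn, ρ.map]
    rfl
  · rw [ev_of_ne _ _ h]
    refine Finset.sum_eq_zero fun i hi => ?_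
    rw [ev_of_ne, smul_zero]
    rw [List.length_eraseIdx_of_lt (Finset.mem_range.1 hi)]
    have := Finset.mem_range.1 hi
    omega

lemma ext_ev_bd {n : ℕ} (f : Cochain R K n) (c : Chain R E) :
    ext (ρ.ev f) (bd c) = ext (ρ.ev (d R K n f)) c := by
  have : ext (R := R) (ρ.ev f) ∘ₗ bd = ext (ρ.ev (d R K n f)) := ListChain.hom_ext fun L => by
    rw [LinearMap.comp_apply, bd_single, ev_bd, ext_single]
  exact congrArg (fun φ => φ c) this

lemma ev_cup {m n N : ℕ} (h : m + n = N) (f : Cochain R K m) (g : Cochain R K n) (L : List E)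
    (hL : L.length = N + 1) :
    ρ.ev (cup h f g) L = ρ.ev f (L.take (m + 1)) * ρ.ev g (L.drop m) := by
  obtain ⟨v, rfl⟩ := exists_ofFn hL
  rw [ev_ofFn, cup, ρ.map, ρ.map, ev, ev, dif_pos (by simp; omega), dif_pos (by simp; omega)]
  congr 3
  · funext i
    simp only [List.getElem_take, List.getElem_ofFn]
    rfl
  · funext i
    simp only [List.getElem_drop, List.getElem_ofFn]
    congr 1
    apply Fin.ext
    change N - n + i.val = m + i.val
    omega

end Realization

/-! ### Natural operators on singular cochains -/

/-- The standard topological simplex. -/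
abbrev Simp (m : ℕ) : Type := stdSimplex ℝ (Fin (m + 1))

/-- The singular simplicial set. -/
abbrev Sing (Y : Type u) [TopologicalSpace Y] : SSet.{u} := TopCat.toSSet.obj (TopCat.of Y)

section

variable {Y Z : Type u} [TopologicalSpace Y] [TopologicalSpace Z]

/-- Singular simplices are continuous maps. -/
def toMap {m : ℕ} : (Sing Y) _⦋m⦌ ≃ C(Simp m, Y) := TopCat.toSSetObjEquiv _ _

/-- The map of singular simplicial sets induced by a continuous map. -/
abbrev singMap (f : C(Y, Z)) : Sing Y ⟶ Sing Z := TopCat.toSSet.map (TopCat.ofHom f)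

lemma toMap_map {m n : ℕ} (θ : ⦋m⦌ ⟶ ⦋n⦌) (σ : (Sing Y) _⦋n⦌) (x : Simp m) :
    toMap ((Sing Y).map θ.op σ) x = toMap σ (stdSimplex.map θ.toOrderHom x) := rfl

lemma toMap_singMap (f : C(Y, Z)) {n : ℕ} (σ : (Sing Y) _⦋n⦌) :
    toMap ((singMap f).app _ σ) = f.comp (toMap σ) := rfl

/-- The affine singular simplices in a singular simplex. -/
def realize {m : ℕ} (σ : (Sing Y) _⦋m⦌) : Realization (Simp m) (Sing Y) where
  toFun n v := toMap.symm ((toMap σ).comp (affine v))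
  map θ v := by
    apply toMap.injective
    ext x
    rw [toMap_map, Equiv.apply_symm_apply, Equiv.apply_symm_apply]
    exact congrArg (toMap σ) (affine_map _ _ _)

lemma toMap_realize {m : ℕ} (σ : (Sing Y) _⦋m⦌) {n : ℕ} (v : Fin (n + 1) → Simp m) (x : Simp n) :
    toMap ((realize σ).toFun n v) x = toMap σ (affine v x) := by
  simp [realize]

/-- The list of the vertices of a standard simplex. -/
def vertices (m : ℕ) : List (Simp m) := List.ofFn fun i => stdSimplex.vertex i

@[simp] lemma length_vertices (m : ℕ) : (vertices m).length = m + 1 := by simp [vertices]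

lemma realize_vertices {m : ℕ} (σ : (Sing Y) _⦋m⦌) :
    (realize σ).toFun m (fun i => stdSimplex.vertex i) = σ := by
  apply toMap.injective
  ext x
  rw [toMap_realize, affine_vertices]
  rfl

lemma realize_realize {m n k : ℕ} (σ : (Sing Y) _⦋m⦌) (v : Fin (n + 1) → Simp m)
    (w : Fin (k + 1) → Simp n) : (realize ((realize σ).toFun n v)).toFun k w =
      (realize σ).toFun k fun i => affine v (w i) := by
  apply toMap.injective
  ext x
  rw [toMap_realize, toMap_realize, toMap_realize, affine_affine]

/-- The affine map of a coface. -/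
def coface {m : ℕ} (i : Fin (m + 2)) : Simp m → Simp (m + 1) := stdSimplex.map i.succAbove

lemma coface_eq_affine {m : ℕ} (i : Fin (m + 2)) :
    coface (m := m) i = affine fun j => stdSimplex.vertex (i.succAbove j) :=
  funext fun _ => map_eq_affine _ _

lemma vertices_map_coface {m : ℕ} (i : Fin (m + 2)) :
    (vertices m).map (coface i) = (vertices (m + 1)).eraseIdx i := by
  rw [vertices, vertices, Realization.eraseIdx_ofFn, List.map_ofFn]
  congr 1
  funext j
  exact stdSimplex.map_vertex _ _

lemma realize_face {m : ℕ} (σ : (Sing Y) _⦋m + 1⦌) (i : Fin (m + 2)) {n : ℕ}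
    (v : Fin (n + 1) → Simp m) :
    (realize ((Sing Y).map (SimplexCategory.δ i).op σ)).toFun n v =
      (realize σ).toFun n fun j => coface i (v j) := by
  have : (Sing Y).map (SimplexCategory.δ i).op σ =
      (realize σ).toFun m fun j => stdSimplex.vertex (i.succAbove j) := by
    conv_lhs => rw [← realize_vertices σ, (realize σ).map]
    rfl
  rw [this, realize_realize, coface_eq_affine]

lemma ev_map {E E' : Type*} {K : SSet.{u}} (ρ : Realization E K) (ρ' : Realization E' K)
    (g : E → E') (h : ∀ n (v : Fin (n + 1) → E), ρ.toFun n v = ρ'.toFun n fun i => g (v i))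
    {n : ℕ} (f : Cochain R K n) (c : Chain R E) :
    ext (ρ.ev f) c = ext (ρ'.ev f) (mapChain R g c) := by
  have : ext (R := R) (ρ.ev f) = ext (ρ'.ev f) ∘ₗ mapChain R g := ListChain.hom_ext fun L => by
    rw [LinearMap.comp_apply, mapChain_single, ext_single, ext_single]
    by_cases hL : L.length = n + 1
    · obtain ⟨v, rfl⟩ := Realization.exists_ofFn hL
      rw [List.map_ofFn, Realization.ev_ofFn, Realization.ev_ofFn, h]
      rfl
    · rw [Realization.ev_of_ne _ _ hL, Realization.ev_of_ne _ _ (by simpa using hL)]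
  exact congrArg (fun φ => φ c) this

/-- The operation on singular cochains defined by a family of chains in the standard simplices. -/
def opCochain (T : ∀ m : ℕ, ℕ → List (Simp m) → Chain R (Simp m)) {k : ℕ}
    (f : Cochain R (Sing Y) k) (m : ℕ) : Cochain R (Sing Y) m :=
  -- The index `m + 1` is the number of vertices, so the recursions defining `T` run to their end.
  fun σ => ext ((realize σ).ev f) (T m (m + 1) (vertices m))

/-- Compatibility of operators with affine maps. -/
def IsNatural (T : ∀ m : ℕ, ℕ → List (Simp m) → Chain R (Simp m)) : Prop :=
  ∀ (k m : ℕ) (v : Fin (k + 1) → Simp m) (n : ℕ) (L : List (Simp k)),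
    mapChain R (affine v) (T k n L) = T m n (L.map (affine v))

/-- The faces of `σ` are affine simplices in `σ`, so naturality under cofaces carries the chains of
all faces into one simplex, where they add up to `T` on the boundary of the vertex list. -/
lemma d_opCochain {T : ∀ m : ℕ, ℕ → List (Simp m) → Chain R (Simp m)} (hT : IsNatural T) {k : ℕ}
    (f : Cochain R (Sing Y) k) (m : ℕ) (σ : (Sing Y) _⦋m + 1⦌) :
    d R (Sing Y) m (opCochain T f m) σ =
      ext ((realize σ).ev f) (ext (T (m + 1) (m + 1)) (bdList R (vertices (m + 1)))) := by
  rw [d_apply, ext_bdList, length_vertices, Finset.sum_range, map_sum]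
  refine Finset.sum_congr rfl fun i _ => ?_
  rw [map_smul, smul_eq_mul, opCochain, ev_map _ (realize σ) (coface i) (fun _ v => realize_face σ i v),
    coface_eq_affine, hT, ← coface_eq_affine, vertices_map_coface]

lemma isNatural_htpy {T : ∀ m : ℕ, ℕ → List (Simp m) → Chain R (Simp m)} (hT : IsNatural T) :
    IsNatural fun m => htpy (T m) :=
  fun k m v n L => mapChain_htpy (fun n L => hT k m v n L) n L

/-- Naturality replaces the model vertices by arbitrary points. This permits the iteration of
operators and their evaluation on degenerate lists. -/
lemma ev_opCochain {T : ∀ m : ℕ, ℕ → List (Simp m) → Chain R (Simp m)} (hT : IsNatural T) {k : ℕ}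
    (f : Cochain R (Sing Y) k) (m : ℕ) {n : ℕ} (σ : (Sing Y) _⦋n⦌) {L : List (Simp n)}
    (hL : L.length = m + 1) :
    (realize σ).ev (opCochain T f m) L = ext ((realize σ).ev f) (T n (m + 1) L) := by
  obtain ⟨v, rfl⟩ := Realization.exists_ofFn hL
  rw [Realization.ev_ofFn, opCochain, ev_map _ (realize σ) (affine v)
    (fun _ w => realize_realize σ v w), hT, vertices, List.map_ofFn]
  congr 3
  funext i
  exact affine_vertex _ _

/-- Natural chain operators are cochain maps. -/
lemma d_opCochain_eq {T : ∀ m : ℕ, ℕ → List (Simp m) → Chain R (Simp m)} (hT : IsNatural T)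
    (hT' : ∀ m, IsChainOp (T m)) {k : ℕ} (f : Cochain R (Sing Y) k) (m : ℕ) :
    d R (Sing Y) m (opCochain T f m) = opCochain T (d R (Sing Y) k f) (m + 1) := by
  funext σ
  rw [d_opCochain hT, opCochain, ← Realization.ext_ev_bd, (hT' _).bd _ _ (by simp)]

/-- Natural chain operators are homotopic to the identity. -/
lemma opCochain_sub {T : ∀ m : ℕ, ℕ → List (Simp m) → Chain R (Simp m)} (hT : IsNatural T)
    (hT' : ∀ m, IsChainOp (T m)) {m : ℕ} (f : Cochain R (Sing Y) (m + 1))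
    (hf : d R (Sing Y) (m + 1) f = 0) :
    opCochain T f (m + 1) - f = d R (Sing Y) m (opCochain (fun m => htpy (T m)) f m) := by
  funext σ
  rw [d_opCochain (isNatural_htpy hT)]
  have := bd_htpy (hT' (m + 1)) (m + 1) (vertices (m + 1)) (by simp)
  have h2 : ext ((realize σ).ev f) (bd (htpy (T (m + 1)) (m + 1 + 1) (vertices (m + 1)))) = 0 := by
    rw [Realization.ext_ev_bd, hf]
    have : (realize σ).ev (0 : Cochain R (Sing Y) (m + 1 + 1)) = fun _ => 0 := by
      funext L
      rw [Realization.ev]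
      split_ifs <;> rfl
    rw [this]
    simp [Finsupp.linearCombination_apply]
  have h3 := congrArg (ext ((realize σ).ev f)) this
  rw [map_add, h2, zero_add, map_sub, ext_single] at h3
  rw [h3, Pi.sub_apply, opCochain, vertices, Realization.ev_ofFn, realize_vertices]

end

end SSetCohomology

namespace SSetCohomology

open CategoryTheory Simplicial ListChain SimplexAffine

section

variable {R : Type} [CommRing R] {Y Z : Type u} [TopologicalSpace Y] [TopologicalSpace Z]

lemma mem_cocycles_iff {K : SSet.{u}} {n : ℕ} {f : Cochain R K n} :
    f ∈ cocycles R K n ↔ d R K n f = 0 := LinearMap.mem_ker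

lemma cls_eq_cls {K : SSet.{u}} {n : ℕ} (f g : cocycles R K (n + 1)) (h : Cochain R K n)
    (e : f.1 - g.1 = d R K n h) : cls f = cls g := by
  rw [← sub_eq_zero, ← map_sub]
  exact cls_eq_zero ⟨h, e.symm⟩

lemma exists_of_cls_eq_zero {K : SSet.{u}} {n : ℕ} {f : cocycles R K (n + 1)} (h : cls f = 0) :
    ∃ g, d R K n g = f.1 :=
  (Submodule.Quotient.mk_eq_zero _).1 h

/-- The cocycle obtained from a natural chain operator. -/
def opCocycle {T : ∀ m : ℕ, ℕ → List (Simp m) → Chain R (Simp m)} (hT : IsNatural T)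
    (hT' : ∀ m, IsChainOp (T m)) {m : ℕ} (f : cocycles R (Sing Y) m) : cocycles R (Sing Y) m :=
  ⟨opCochain T f.1 m, by
    rw [mem_cocycles_iff, d_opCochain_eq hT hT', mem_cocycles_iff.1 f.2]
    funext σ
    have : (realize σ).ev (0 : Cochain R (Sing Y) (m + 1)) = fun _ => 0 := by
      funext L
      rw [Realization.ev]
      split_ifs <;> rfl
    rw [opCochain, this]
    simp [Finsupp.linearCombination_apply]⟩

lemma cls_opCocycle {T : ∀ m : ℕ, ℕ → List (Simp m) → Chain R (Simp m)} (hT : IsNatural T)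
    (hT' : ∀ m, IsChainOp (T m)) {m : ℕ} (f : cocycles R (Sing Y) (m + 1)) :
    cls (opCocycle hT hT' f) = cls f :=
  cls_eq_cls _ _ _ (opCochain_sub hT hT' f.1 (mem_cocycles_iff.1 f.2))

/-! ### Graded commutativity -/

lemma isNatural_rev : IsNatural (R := R) fun _ => rev R := fun _ _ _ n L => mapChain_rev _ n L

/-- Reversal exchanges front and back faces, so graded commutativity already holds for cochains once
both factors are reversed. On classes of positive degree reversal is the identity. -/
lemma opCochain_rev_cup {m n N : ℕ} (h : m + n = N) (h' : n + m = N) (f : Cochain R (Sing Y) m)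
    (g : Cochain R (Sing Y) n) :
    opCochain (fun _ => rev R) (cup h f g) N = (-1 : R) ^ (m * n) •
      cup h' (opCochain (fun _ => rev R) g n) (opCochain (fun _ => rev R) f m) := by
  funext σ
  have e1 : ∀ {k : ℕ} (f : Cochain R (Sing Y) k) (L : List (Simp N)), L.length = k + 1 →
      (realize σ).ev (opCochain (fun _ => rev R) f k) L =
        revSign R (k + 1) * (realize σ).ev f L.reverse := by
    intro k f L hL
    rw [ev_opCochain isNatural_rev _ _ _ hL, rev, map_smul, ext_single, hL, smul_eq_mul]
  have e2 := (realize σ).ev_ofFn (cup h' (opCochain (fun _ => rev R) g n)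
    (opCochain (fun _ => rev R) f m)) fun i => stdSimplex.vertex i
  rw [realize_vertices, ← vertices, Realization.ev_cup _ _ _ _ _ (by simp),
    e1 _ _ (by simp; omega), e1 _ _ (by simp; omega)] at e2
  rw [Pi.smul_apply, ← e2, opCochain, rev, map_smul, ext_single,
    Realization.ev_cup _ _ _ _ _ (by simp), List.take_reverse, List.drop_reverse, length_vertices]
  have a1 : N + 1 - (m + 1) = n := by omega
  have a2 : N + 1 - m = n + 1 := by omega
  have a3 : revSign R (N + 1) = revSign R (m + 1) * revSign R (n + 1) * (-1) ^ (m * n) := by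
    rw [← h, revSign_add]
  rw [a1, a2, a3, smul_eq_mul, smul_eq_mul]
  ring

/-- Graded commutativity of the cup product in positive degrees. -/
lemma cupH_comm {m n N : ℕ} (h : m + n = N) (h' : n + m = N) (hm : m ≠ 0) (hn : n ≠ 0)
    (a : Cohomology R (Sing Y) m) (b : Cohomology R (Sing Y) n) :
    cupH R (Sing Y) h a b = (-1 : R) ^ (m * n) • cupH R (Sing Y) h' b a := by
  obtain ⟨m, rfl⟩ := Nat.exists_eq_succ_of_ne_zero hm
  obtain ⟨n, rfl⟩ := Nat.exists_eq_succ_of_ne_zero hn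
  obtain ⟨N, rfl⟩ : ∃ M, N = M + 1 := ⟨N - 1, by omega⟩
  induction a using cls_ind with
  | h f =>
  induction b using cls_ind with
  | h g =>
    rw [cupH_cls, ← cls_opCocycle isNatural_rev (fun _ => isChainOp_rev) ⟨cup h f.1 g.1, _⟩,
      ← cls_opCocycle isNatural_rev (fun _ => isChainOp_rev) f,
      ← cls_opCocycle isNatural_rev (fun _ => isChainOp_rev) g, cupH_cls, ← map_smul]
    congr 1
    exact Subtype.ext (opCochain_rev_cup h h' f.1 g.1)

/-! ### Barycentric subdivision -/

/-- The barycenter of a list of points. -/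
def bary {m : ℕ} (L : List (Simp m)) : Simp m :=
  if h : L = [] then stdSimplex.vertex 0 else
    affine (fun i : Fin (L.length - 1 + 1) => L[i.val]'(by
      have := List.length_pos_iff.2 h
      omega)) stdSimplex.barycenter

lemma bary_ofFn {m k : ℕ} (v : Fin (k + 1) → Simp m) :
    bary (List.ofFn v) = affine v stdSimplex.barycenter := by
  have key : ∀ (L : List (Simp m)) (h : L.length = k + 1),
      bary L = affine (fun i : Fin (k + 1) => L[i.val]) stdSimplex.barycenter := by
    intro L h
    obtain rfl : k = L.length - 1 := by omega
    rw [bary, dif_neg (by rintro rfl; simp at h)]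
  rw [key _ (by simp)]
  congr 2
  funext i
  exact List.getElem_ofFn _

lemma exists_ofFn_of_ne_nil {E : Type*} {L : List E} (h : L ≠ []) :
    ∃ (k : ℕ) (v : Fin (k + 1) → E), L = List.ofFn v := by
  obtain ⟨k, hk⟩ := Nat.exists_eq_succ_of_ne_zero (List.length_pos_iff.2 h).ne'
  exact ⟨k, Realization.exists_ofFn hk⟩

/-- Barycentric subdivision in the standard simplices. -/
abbrev sdOp (R : Type) [CommRing R] (m : ℕ) : ℕ → List (Simp m) → Chain R (Simp m) := sd R bary

lemma isNatural_sdOp : IsNatural (sdOp R) := fun k m v n L =>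
  mapChain_sd (fun L hL => by
    obtain ⟨j, w, rfl⟩ := exists_ofFn_of_ne_nil hL
    rw [bary_ofFn, affine_affine, List.map_ofFn, bary_ofFn]
    rfl) n L

lemma isChainOp_sdOp (m : ℕ) : IsChainOp (sdOp R m) := isChainOp_sd _

/-- Every class of positive degree is represented by a cocycle which vanishes on degenerate
affine simplices. -/
lemma exists_nondeg {m : ℕ} (f : cocycles R (Sing Y) (m + 1)) :
    ∃ f' : cocycles R (Sing Y) (m + 1), cls f' = cls f ∧
      ∀ {n : ℕ} (σ : (Sing Y) _⦋n⦌), Nondeg ((realize σ).ev f'.1) := by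
  -- Subdivision keeps the class, and by `sd_dup` it kills every list with a repeated consecutive
  -- vertex.
  refine ⟨opCocycle isNatural_sdOp isChainOp_sdOp f, cls_opCocycle _ _ f, fun σ u x v => ?_⟩
  by_cases h : (u ++ x :: x :: v).length = m + 1 + 1
  · change (realize σ).ev (opCochain (sdOp R) f.1 (m + 1)) _ = 0
    rw [ev_opCochain isNatural_sdOp _ _ _ h, sdOp, sd_dup, map_zero]
    simp at h
    omega
  · exact Realization.ev_of_ne _ _ h

/-! ### Pairing with chains -/

end

section

variable {F : Type} [Field F] {K : SSet.{u}}

/-- The pairing of a cochain with a chain. -/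
def pair {n : ℕ} (f : Cochain F K n) : (K _⦋n⦌ →₀ F) →ₗ[F] F := Finsupp.linearCombination F f

lemma pair_single {n : ℕ} (f : Cochain F K n) (σ : K _⦋n⦌) : pair f (Finsupp.single σ 1) = f σ := by
  simp [pair]

lemma pair_apply {n : ℕ} (f : Cochain F K n) (z : K _⦋n⦌ →₀ F) :
    pair f z = z.sum fun σ c => c * f σ := rfl

lemma pair_sub {n : ℕ} (f g : Cochain F K n) (z : K _⦋n⦌ →₀ F) :
    pair (f - g) z = pair f z - pair g z := by
  simp [pair_apply, mul_sub, Finsupp.sum_sub]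

/-- The boundary of singular chains. -/
def boundary (F : Type) [Field F] (K : SSet.{u}) (n : ℕ) : (K _⦋n + 1⦌ →₀ F) →ₗ[F] (K _⦋n⦌ →₀ F) :=
  Finsupp.linearCombination F fun σ => ∑ i : Fin (n + 2),
    (-1 : F) ^ (i : ℕ) • Finsupp.single (K.map (SimplexCategory.δ i).op σ) 1

lemma pair_boundary {n : ℕ} (f : Cochain F K n) (z : K _⦋n + 1⦌ →₀ F) :
    pair f (boundary F K n z) = pair (d F K n f) z := by
  have : pair f ∘ₗ boundary F K n = pair (d F K n f) := by
    refine Finsupp.lhom_ext' fun σ => LinearMap.ext_ring ?_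
    change pair f (boundary F K n (Finsupp.single σ 1)) = pair _ (Finsupp.single σ 1)
    rw [pair_single, boundary, Finsupp.linearCombination_single, one_smul, map_sum, d_apply]
    refine Finset.sum_congr rfl fun i _ => ?_
    rw [map_smul, pair_single, smul_eq_mul]
  exact congrArg (fun φ => φ z) this

/-- Over a field, a cochain which vanishes on cycles is a coboundary. -/
lemma exists_d_eq {n : ℕ} (f : Cochain F K (n + 1))
    (h : ∀ z, boundary F K n z = 0 → pair f z = 0) : ∃ g, d F K n g = f := by
  have : pair f ∈ (LinearMap.range (boundary F K n).dualMap) := by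
    rw [LinearMap.range_dualMap_eq_dualAnnihilator_ker]
    exact (Submodule.mem_dualAnnihilator _).2 fun z hz => h z hz
  obtain ⟨ψ, hψ⟩ := this
  refine ⟨fun σ => ψ (Finsupp.single σ 1), funext fun σ => ?_⟩
  have := congrArg (fun φ => φ (Finsupp.single σ 1)) hψ
  replace this : ψ _ = _ := this.trans (pair_single _ _)
  rw [← this, d_apply, boundary, Finsupp.linearCombination_single,
    one_smul, map_sum]
  refine Finset.sum_congr rfl fun i _ => ?_
  rw [map_smul, smul_eq_mul]

/-- Over a field, nonzero classes are detected by cycles. -/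
lemma exists_cycle_of_cls_ne_zero {n : ℕ} {f : cocycles F K (n + 1)} (h : cls f ≠ 0) :
    ∃ z, boundary F K n z = 0 ∧ pair f.1 z ≠ 0 := by
  by_contra! hc
  obtain ⟨g, hg⟩ := exists_d_eq f.1 hc
  exact h (cls_eq_zero ⟨g, hg⟩)

lemma pair_eq_of_cls_eq {n : ℕ} {f g : cocycles F K (n + 1)} (h : cls f = cls g)
    {z : K _⦋n + 1⦌ →₀ F} (hz : boundary F K n z = 0) : pair f.1 z = pair g.1 z := by
  rw [← sub_eq_zero, ← map_sub] at h
  obtain ⟨c, hc⟩ := exists_of_cls_eq_zero h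
  rw [← sub_eq_zero, ← pair_sub]
  have : pair (d F K n c) z = 0 := by rw [← pair_boundary, hz, map_zero]
  rwa [hc] at this

end

end SSetCohomology

namespace SSetCohomology

open CategoryTheory Simplicial ListChain SimplexAffine

/-! ### Small simplices -/

section

variable {ι κ : Type*} [Fintype ι] [Fintype κ]

/-- An affine combination averages the coordinate differences. The bounds `r i` may differ, since in
the barycentre estimate one of them is zero. -/
lemma dist_affine_le (x : stdSimplex ℝ κ) (v : ι → stdSimplex ℝ κ) (y : stdSimplex ℝ ι)
    (r : ι → ℝ) (h : ∀ i, dist x (v i) ≤ r i) : dist x (affine v y) ≤ ∑ i, y i * r i := by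
  have hr : ∀ i, 0 ≤ r i := fun i => dist_nonneg.trans (h i)
  refine (dist_pi_le_iff (Finset.sum_nonneg fun i _ => mul_nonneg (stdSimplex.zero_le y i) (hr i))).2 fun c => ?_
  have e : x.1 c - (affine v y).1 c = ∑ i, y i * (x c - v i c) := by
    simp only [mul_sub, Finset.sum_sub_distrib, ← Finset.sum_mul, stdSimplex.sum_eq_one, one_mul]
    rfl
  rw [Real.dist_eq, e]
  refine (Finset.abs_sum_le_sum_abs _ _).trans (Finset.sum_le_sum fun i _ => ?_)
  rw [abs_mul, abs_of_nonneg (stdSimplex.zero_le y i)]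
  refine mul_le_mul_of_nonneg_left ?_ (stdSimplex.zero_le y i)
  exact (dist_le_pi_dist x.1 (v i).1 c).trans (h i)

lemma dist_affine_le_const (x : stdSimplex ℝ κ) (v : ι → stdSimplex ℝ κ) (y : stdSimplex ℝ ι)
    (r : ℝ) (h : ∀ i, dist x (v i) ≤ r) : dist x (affine v y) ≤ r := by
  refine (dist_affine_le x v y (fun _ => r) h).trans_eq ?_
  rw [← Finset.sum_mul, stdSimplex.sum_eq_one, one_mul]

/-- The points of the list have mutual distance at most `r`. -/
def Mesh {m : ℕ} (r : ℝ) (L : List (Simp m)) : Prop := ∀ x ∈ L, ∀ y ∈ L, dist x y ≤ r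

/-- Every ball containing the points of `L` contains the points of `L'`. -/
def InHull {m : ℕ} (L L' : List (Simp m)) : Prop :=
  ∀ (x : Simp m) (s : ℝ), (∀ y ∈ L, dist x y ≤ s) → ∀ y ∈ L', dist x y ≤ s

/-- The distance is at most the mean of `k + 1` numbers, one of which is `0` and the others at most
`r`. The common bound `K` makes the contraction factor independent of the dimension of the face. -/
lemma dist_bary_le {m k K : ℕ} (hk : k ≤ K) (v : Fin (k + 1) → Simp m) {r : ℝ} (hr : 0 ≤ r)
    (h : Mesh r (List.ofFn v)) (j : Fin (k + 1)) :
    dist (bary (List.ofFn v)) (v j) ≤ K / (K + 1) * r := by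
  rw [bary_ofFn, dist_comm]
  refine (dist_affine_le (v j) v _ (fun i => if i = j then 0 else r) fun i => ?_).trans ?_
  · split_ifs with hij
    · rw [hij, dist_self]
    · exact h _ ((List.mem_ofFn' _ _).2 ⟨j, rfl⟩) _ ((List.mem_ofFn' _ _).2 ⟨i, rfl⟩)
  · have e : ∀ i, (stdSimplex.barycenter : Simp k) i * (if i = j then 0 else r) =
        (k + 1 : ℝ)⁻¹ * r - if i = j then (k + 1 : ℝ)⁻¹ * r else 0 := by
      intro i
      have : (stdSimplex.barycenter : Simp k) i = (k + 1 : ℝ)⁻¹ := by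
        refine (stdSimplex.barycenter_apply (𝕜 := ℝ) i).trans ?_
        simp
      rw [this]
      split_ifs <;> simp
    rw [Finset.sum_congr rfl fun i _ => e i, Finset.sum_sub_distrib]
    simp only [Finset.sum_const, Finset.card_univ, Fintype.card_fin, nsmul_eq_mul,
      Finset.sum_ite_eq', Finset.mem_univ, if_true]
    have h1 : (k : ℝ) ≤ K := by exact_mod_cast hk
    have h2 : ((k + 1 : ℕ) : ℝ) * ((k + 1 : ℝ)⁻¹ * r) - (k + 1 : ℝ)⁻¹ * r = k / (k + 1) * r := by
      push_cast
      field_simp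
      ring
    rw [h2]
    refine mul_le_mul_of_nonneg_right ?_ hr
    rw [div_le_div_iff₀ (by positivity) (by positivity)]
    linarith

end

section

variable {R : Type} [CommRing R]

lemma ext_mem {E M : Type*} [AddCommGroup M] [Module R M] (S : Submodule R M) {f : List E → M}
    {c : Chain R E} (h : ∀ L ∈ c.support, f L ∈ S) : ext f c ∈ S := by
  rw [ListChain.ext, Finsupp.linearCombination_apply]
  exact Submodule.sum_mem _ fun L hL => S.smul_mem _ (h L hL)

/-- Subdivision shrinks the mesh. -/
lemma sd_mem_supported {m K : ℕ} {r : ℝ} (hr : 0 ≤ r) : ∀ (n : ℕ) (L : List (Simp m)),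
    L.length ≤ n → L.length ≤ K + 1 → Mesh r L →
    sd R bary n L ∈ Finsupp.supported R R {L' | InHull L L' ∧ Mesh (K / (K + 1) * r) L'} := by
  have hnil : (Finsupp.single [] 1 : Chain R (Simp m)) ∈
      Finsupp.supported R R {L' | InHull [] L' ∧ Mesh (K / (K + 1) * r) L'} :=
    Finsupp.single_mem_supported _ _ ⟨fun x s _ y hy => (List.not_mem_nil hy).elim,
      fun x hx => (List.not_mem_nil hx).elim⟩
  intro n
  induction n with
  | zero =>
    intro L h _ _
    obtain rfl := List.length_eq_zero_iff.1 (Nat.le_zero.1 h)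
    exact hnil
  | succ n ih =>
    intro L h hK hm
    cases L with
    | nil => exact hnil
    | cons x l =>
        rw [sd]
        have h1 : ext (sd R bary n) (bdList R (x :: l)) ∈ Finsupp.supported R R
            {L' | InHull (x :: l) L' ∧ Mesh (K / (K + 1) * r) L'} := by
          rw [ext_bdList]
          refine Submodule.sum_mem _ fun i hi => Submodule.smul_mem _ _ ?_
          have hsub : ∀ y ∈ (x :: l).eraseIdx i, y ∈ x :: l := fun y hy => List.mem_of_mem_eraseIdx hy
          have hlen := List.length_eraseIdx_of_lt (Finset.mem_range.1 hi)
          simp only [List.length_cons] at h hK hlen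
          have := ih ((x :: l).eraseIdx i) (by omega) (by omega)
            fun y hy z hz => hm y (hsub y hy) z (hsub z hz)
          refine Finsupp.supported_mono ?_ this
          exact fun L' hL' => ⟨fun y s hs => hL'.1 y s fun z hz => hs z (hsub z hz), hL'.2⟩
        refine ext_mem _ fun L' hL' => Finsupp.single_mem_supported _ _ ?_
        obtain ⟨hh, hm'⟩ := h1 hL'
        obtain ⟨k, v, hv⟩ := exists_ofFn_of_ne_nil (List.cons_ne_nil x l)
        have hk : k ≤ K := by
          have := congrArg List.length hv
          simp only [List.length_ofFn] at this
          omega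
        rw [hv] at hh hm ⊢
        have hb : ∀ y ∈ List.ofFn v, dist (bary (List.ofFn v)) y ≤ K / (K + 1) * r := by
          intro y hy
          obtain ⟨j, rfl⟩ := (List.mem_ofFn' _ _).1 hy
          exact dist_bary_le hk v hr hm j
        -- The ball of radius `K / (K + 1) * r` about the barycentre contains all vertices of the
        -- simplex, hence also those of its subdivided boundary, by `InHull`.
        have hb' := hh _ _ hb
        have h0 : 0 ≤ K / (K + 1) * r := by positivity
        refine ⟨fun y s hs z hz => ?_, fun y hy z hz => ?_⟩
        · rcases List.mem_cons.1 hz with rfl | hz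
          · rw [bary_ofFn]
            exact dist_affine_le_const _ _ _ _ fun i => hs _ ((List.mem_ofFn' _ _).2 ⟨i, rfl⟩)
          · exact hh y s hs z hz
        · rcases List.mem_cons.1 hy with rfl | hy <;> rcases List.mem_cons.1 hz with rfl | hz
          · simpa using h0
          · exact hb' z hz
          · rw [dist_comm]
            exact hb' y hy
          · exact hm' y hy z hz

end

section

variable {F : Type} [Field F] {Y : Type u} [TopologicalSpace Y]

lemma mesh_vertices (m : ℕ) : Mesh 1 (vertices m) := by
  intro x _ y _
  rw [Subtype.dist_eq, dist_pi_le_iff zero_le_one]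
  intro c
  have hx := mem_Icc_of_mem_stdSimplex x.2 c
  have hy := mem_Icc_of_mem_stdSimplex y.2 c
  rw [Real.dist_eq, abs_le]
  constructor <;> linarith [hx.1, hx.2, hy.1, hy.2]

/-- A cocycle which vanishes on the simplices inside the members of an open cover is a
coboundary. -/
lemma exists_d_eq_of_small {U V : Set Y} (hU : IsOpen U) (hV : IsOpen V) (hUV : U ∪ V = Set.univ)
    {n : ℕ} (f : cocycles F (Sing Y) (n + 1))
    (hfU : ∀ σ, (∀ x, toMap σ x ∈ U) → f.1 σ = 0) (hfV : ∀ σ, (∀ x, toMap σ x ∈ V) → f.1 σ = 0) :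
    ∃ g, d F (Sing Y) n g = f.1 := by
  -- Over a field it suffices to pair with cycles. Iterated subdivision of `f` does not change its
  -- value on the cycle `z`; as `z` has finitely many simplices, a high iterate vanishes on all of
  -- them.
  refine exists_d_eq f.1 fun z hz => ?_
  let op : cocycles F (Sing Y) (n + 1) → cocycles F (Sing Y) (n + 1) :=
    opCocycle isNatural_sdOp isChainOp_sdOp
  have hop : ∀ k : ℕ, cls (op^[k] f) = cls f := by
    intro k
    induction k with
    | zero => rfl
    | succ k ih => rw [Function.iterate_succ_apply', cls_opCocycle, ih]
  have key : ∀ σ : (Sing Y) _⦋n + 1⦌, ∀ᶠ k in Filter.atTop, (op^[k] f).1 σ = 0 := by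
    intro σ
    obtain ⟨δ, hδ, hball⟩ := lebesgue_number_lemma_of_metric (s := (Set.univ : Set (Simp (n + 1))))
      (c := fun b : Bool => toMap σ ⁻¹' (if b then U else V)) isCompact_univ
      (fun b => by
        cases b
        · exact hV.preimage (toMap σ).continuous
        · exact hU.preimage (toMap σ).continuous)
      (fun x _ => by
        have : toMap σ x ∈ U ∪ V := hUV ▸ Set.mem_univ _
        rcases this with h | h
        · exact Set.mem_iUnion.2 ⟨true, h⟩
        · exact Set.mem_iUnion.2 ⟨false, h⟩)
    have h0 : ∀ v : Fin (n + 1 + 1) → Simp (n + 1), Mesh (δ / 2) (List.ofFn v) →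
        f.1 ((realize σ).toFun (n + 1) v) = 0 := by
      intro v hv
      have hd : ∀ x, affine v x ∈ Metric.ball (v 0) δ := fun x => by
        rw [Metric.mem_ball']
        refine (dist_affine_le_const (v 0) v x (δ / 2) fun i => ?_).trans_lt (by linarith)
        exact hv _ (List.mem_ofFn' _ _ |>.2 ⟨0, rfl⟩) _ (List.mem_ofFn' _ _ |>.2 ⟨i, rfl⟩)
      obtain ⟨b, hb⟩ := hball (v 0) (Set.mem_univ _)
      cases b
      · exact hfV _ fun x => by
          rw [toMap_realize]
          exact hb (hd x)
      · exact hfU _ fun x => by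
          rw [toMap_realize]
          exact hb (hd x)
    let c : ℝ := (n + 1 : ℕ) / ((n + 1 : ℕ) + 1)
    have hc0 : 0 ≤ c := by positivity
    have hc1 : c < 1 := by
      rw [div_lt_one (by positivity)]
      linarith
    -- Each subdivision multiplies the mesh by `c < 1`. Once it is at most half the Lebesgue number
    -- `δ`, each small simplex lies in an open ball of radius `δ`, hence in `U` or in `V`.
    have hk : ∀ (k : ℕ) (r : ℝ), 0 ≤ r → c ^ k * r ≤ δ / 2 → ∀ L : List (Simp (n + 1)), Mesh r L →
        (realize σ).ev (op^[k] f).1 L = 0 := by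
      intro k
      induction k with
      | zero =>
        intro r _ hr' L hL
        by_cases h : L.length = n + 1 + 1
        · obtain ⟨v, rfl⟩ := Realization.exists_ofFn h
          rw [Realization.ev_ofFn]
          refine h0 v fun x hx y hy => (hL x hx y hy).trans ?_
          simpa using hr'
        · exact Realization.ev_of_ne _ _ h
      | succ k ih =>
        intro r hr hr' L hL
        by_cases h : L.length = n + 1 + 1
        · rw [Function.iterate_succ_apply']
          change (realize σ).ev (opCochain (sdOp F) (op^[k] f).1 (n + 1)) L = 0
          rw [ev_opCochain isNatural_sdOp _ _ _ h]
          have := sd_mem_supported (R := F) (K := n + 1) hr (n + 1 + 1) L h.le h.le hL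
          refine (Submodule.mem_bot F).1 (ext_mem _ fun L' hL' => (Submodule.mem_bot F).2 ?_)
          refine ih (c * r) (by positivity) ?_ L' (this hL').2
          rw [← mul_assoc, ← pow_succ]
          exact hr'
        · exact Realization.ev_of_ne _ _ h
    have ht := (tendsto_pow_atTop_nhds_zero_of_lt_one hc0 hc1).eventually_lt_const
      (half_pos hδ)
    filter_upwards [ht] with k hk'
    have := hk k 1 zero_le_one (by linarith) _ (mesh_vertices (n + 1))
    rwa [vertices, Realization.ev_ofFn, realize_vertices] at this
  obtain ⟨k, hk⟩ := ((Filter.eventually_all_finset z.support).2 fun σ _ => key σ).exists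
  rw [← pair_eq_of_cls_eq (hop k) hz, pair_apply]
  exact Finset.sum_eq_zero fun σ hσ => mul_eq_zero_of_right _ (hk σ hσ)

/-! ### Vanishing of cup products -/

/-- The inclusion of a subspace. -/
def incl (U : Set Y) : C(U, Y) := ⟨Subtype.val, continuous_subtype_val⟩

lemma d_mem_cocycles {R : Type} [CommRing R] {n : ℕ} (g : Cochain R (Sing Y) n) :
    d R (Sing Y) n g ∈ cocycles R (Sing Y) (n + 1) := by
  rw [mem_cocycles_iff]
  funext σ
  have h := (realize σ).ev_ofFn (d R (Sing Y) (n + 1) (d R (Sing Y) n g))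
    fun i => stdSimplex.vertex i
  rw [realize_vertices, ← Realization.ev_bd, ← Realization.ext_ev_bd, bd_bdList, map_zero] at h
  exact h.symm

/-- A class which restricts to zero on a subspace is represented by a cocycle which vanishes on
its simplices. -/
lemma exists_rep_vanishing {R : Type} [CommRing R] (U : Set Y) {n : ℕ}
    (f : cocycles R (Sing Y) (n + 1)) (h : map R (singMap (incl U)) (n + 1) (cls f) = 0) :
    ∃ f' : cocycles R (Sing Y) (n + 1), cls f' = cls f ∧
      ∀ σ, (∀ x, toMap σ x ∈ U) → f'.1 σ = 0 := by
  classical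
  have h' : cls (⟨cochainMap R (singMap (incl U)) (n + 1) f.1,
    cochainMap_mem_cocycles _ f.2⟩ : cocycles R (Sing U) (n + 1)) = 0 := h
  obtain ⟨g, hg⟩ := exists_of_cls_eq_zero h'
  let lift : ∀ {k : ℕ} (σ : (Sing Y) _⦋k⦌), (∀ x, toMap σ x ∈ U) → (Sing U) _⦋k⦌ :=
    fun σ hσ => toMap.symm ⟨fun x => ⟨toMap σ x, hσ x⟩, by fun_prop⟩
  -- A primitive of the restricted cocycle is extended by zero to all simplices; subtracting its
  -- coboundary clears `f` on the simplices in `U`.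
  let g' : Cochain R (Sing Y) n := fun σ => if hσ : ∀ x, toMap σ x ∈ U then g (lift σ hσ) else 0
  have hd : d R (Sing Y) n g' ∈ cocycles R (Sing Y) (n + 1) := d_mem_cocycles g'
  refine ⟨f - ⟨d R (Sing Y) n g', hd⟩, cls_eq_cls _ _ (-g') (by simp), fun σ hσ => ?_⟩
  have e1 : f.1 σ = d R (Sing U) n g (lift σ hσ) := by
    rw [hg]
    rfl
  have e2 : d R (Sing Y) n g' σ = d R (Sing U) n g (lift σ hσ) := by
    rw [d_apply, d_apply]
    refine Finset.sum_congr rfl fun i _ => ?_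
    have : ∀ x, toMap ((Sing Y).map (SimplexCategory.δ i).op σ) x ∈ U := fun x => hσ _
    simp only [g', dif_pos this]
    rfl
  change f.1 σ - d R (Sing Y) n g' σ = 0
  rw [e1, e2, sub_self]

/-- The product of classes which vanish on the respective members of an open cover is zero. -/
lemma cupH_eq_zero {U V : Set Y} (hU : IsOpen U) (hV : IsOpen V) (hUV : U ∪ V = Set.univ)
    {m n N : ℕ} (h : m + n = N) (hm : m ≠ 0) (hn : n ≠ 0) (a : Cohomology F (Sing Y) m)
    (b : Cohomology F (Sing Y) n) (ha : map F (singMap (incl U)) m a = 0)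
    (hb : map F (singMap (incl V)) n b = 0) : cupH F (Sing Y) h a b = 0 := by
  obtain ⟨m, rfl⟩ := Nat.exists_eq_succ_of_ne_zero hm
  obtain ⟨n, rfl⟩ := Nat.exists_eq_succ_of_ne_zero hn
  obtain ⟨N, rfl⟩ : ∃ M, N = M + 1 := ⟨N - 1, by omega⟩
  induction a using cls_ind with
  | h f =>
  induction b using cls_ind with
  | h g =>
    obtain ⟨f', hf', hfU⟩ := exists_rep_vanishing U f ha
    obtain ⟨g', hg', hgV⟩ := exists_rep_vanishing V g hb
    rw [← hf', ← hg', cupH_cls]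
    -- On a simplex in `U` the first factor vanishes on the front face; on a simplex in `V` the
    -- second vanishes on the back face.
    obtain ⟨c, hc⟩ := exists_d_eq_of_small hU hV hUV
      ⟨cup h f'.1 g'.1, cup_mem_cocycles h f'.2 g'.2⟩
      (fun σ hσ => mul_eq_zero_of_left (hfU _ fun x => hσ _) _)
      (fun σ hσ => mul_eq_zero_of_right _ (hgV _ fun x => hσ _))
    exact cls_eq_zero ⟨c, hc⟩

end

end SSetCohomology

namespace SSetCohomology

open CategoryTheory Simplicial ListChain SimplexAffine

section

variable {R : Type} [CommRing R] {S T Y Z : Type u} [TopologicalSpace S] [TopologicalSpace T]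
  [TopologicalSpace Y] [TopologicalSpace Z]

/-! ### Singular simplices in products -/

/-- The affine singular simplices in the image of a product of two simplices. -/
def biRealize {p q : ℕ} (G : C(Simp p × Simp q, Z)) : Realization (Simp p × Simp q) (Sing Z) where
  toFun n v := toMap.symm
    (G.comp ((affine fun i => (v i).1).prodMk (affine fun i => (v i).2)))
  map θ v := by
    apply toMap.injective
    ext x
    rw [toMap_map, Equiv.apply_symm_apply, Equiv.apply_symm_apply]
    exact congrArg G (Prod.ext (affine_map _ _ _) (affine_map _ _ _))

lemma toMap_biRealize {p q : ℕ} (G : C(Simp p × Simp q, Z)) {n : ℕ}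
    (v : Fin (n + 1) → Simp p × Simp q) (x : Simp n) :
    toMap ((biRealize G).toFun n v) x =
      G (affine (fun i => (v i).1) x, affine (fun i => (v i).2) x) := by
  simp [biRealize]

/-- The value of a cochain on the Eilenberg–Zilber chain of a product of two simplices. -/
def biEval {p q N : ℕ} (g : Cochain R (Sing Z) N) (G : C(Simp p × Simp q, Z)) : R :=
  ext ((biRealize G).ev g) (stair R (vertices p) (vertices q))

/-- Coface maps are continuous. -/
def cofaceMap {m : ℕ} (i : Fin (m + 2)) : C(Simp m, Simp (m + 1)) :=
  ⟨coface i, stdSimplex.continuous_map _⟩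

lemma affine_coface {m k : ℕ} (i : Fin (m + 2)) (v : Fin (k + 1) → Simp m) (x : Simp k) :
    affine (fun j => coface i (v j)) x = coface i (affine v x) := by
  rw [coface_eq_affine, affine_affine]

/-- By `map_stair`, deleting a vertex from the first list amounts to composing with the
corresponding coface. Together with `biEval_right` this turns the Leibniz rule into one for maps out
of products. -/
lemma biEval_left {p q N : ℕ} (g : Cochain R (Sing Z) N) (G : C(Simp (p + 1) × Simp q, Z)) :
    ext ((biRealize G).ev g) (stair₂ (bdList R (vertices (p + 1)))
      (Finsupp.single (vertices q) 1)) =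
    ∑ i : Fin (p + 2), (-1 : R) ^ (i : ℕ) *
      biEval g (G.comp ((cofaceMap i).prodMap (ContinuousMap.id _))) := by
  rw [bdList_eq_sum, length_vertices, Finset.sum_range, map_sum, LinearMap.sum_apply, map_sum]
  refine Finset.sum_congr rfl fun i _ => ?_
  rw [map_smul, LinearMap.smul_apply, map_smul, smul_eq_mul, stair₂_single, ← vertices_map_coface,
    biEval]
  have := map_stair (R := R) (coface i) (id : Simp q → Simp q) (vertices p) (vertices q)
  rw [List.map_id] at this
  rw [← this]
  congr 1
  symm
  refine ev_map _ _ (Prod.map (coface i) id) (fun n v => ?_) g _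
  apply toMap.injective
  ext x
  rw [toMap_biRealize, toMap_biRealize]
  simp only [Prod.map_fst, Prod.map_snd, affine_coface]
  rfl

lemma biEval_right {p q N : ℕ} (g : Cochain R (Sing Z) N) (G : C(Simp p × Simp (q + 1), Z)) :
    ext ((biRealize G).ev g) (stair₂ (Finsupp.single (vertices p) 1)
      (bdList R (vertices (q + 1)))) =
    ∑ i : Fin (q + 2), (-1 : R) ^ (i : ℕ) *
      biEval g (G.comp ((ContinuousMap.id _).prodMap (cofaceMap i))) := by
  rw [bdList_eq_sum, length_vertices, Finset.sum_range, map_sum, map_sum]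
  refine Finset.sum_congr rfl fun i _ => ?_
  rw [map_smul, map_smul, smul_eq_mul, stair₂_single, ← vertices_map_coface, biEval]
  have := map_stair (R := R) (id : Simp p → Simp p) (coface i) (vertices p) (vertices q)
  rw [List.map_id] at this
  rw [← this]
  congr 1
  symm
  refine ev_map _ _ (Prod.map id (coface i)) (fun n v => ?_) g _
  apply toMap.injective
  ext x
  rw [toMap_biRealize, toMap_biRealize]
  simp only [Prod.map_fst, Prod.map_snd, affine_coface]
  rfl

lemma biEval_d {p q N : ℕ} (g : Cochain R (Sing Z) N) (G : C(Simp p × Simp q, Z)) :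
    biEval (d R (Sing Z) N g) G =
      ext ((biRealize G).ev g) (stair₂ (bdList R (vertices p)) (Finsupp.single (vertices q) 1)) -
      (-1 : R) ^ (p + 1) • ext ((biRealize G).ev g)
        (stair₂ (Finsupp.single (vertices p) 1) (bdList R (vertices q))) := by
  rw [biEval, ← Realization.ext_ev_bd, bd_stair, map_sub, map_smul, length_vertices]

/-! ### Homotopy invariance -/

/-- Over a single point there is only one staircase. It identifies the two ends of the prism in the
proof of homotopy invariance. -/
lemma stair_singleton {P Q : Type*} (y : Q) (x : P) (l : List P) :
    stair R (x :: l) [y] = Finsupp.single ((x :: l).map fun x => (x, y)) 1 := by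
  induction l generalizing x with
  | nil => simp [stair_cons_cons, stair_nil, stair_cons_nil]
  | cons x' l ih =>
    rw [stair_cons_cons, ih x', stair_cons_nil, if_neg (by simp)]
    simp

lemma map_singMap_comp (f : C(Y, Z)) (g : C(S, Y)) {n : ℕ} (a : Cohomology R (Sing Z) n) :
    map R (singMap (f.comp g)) n a = map R (singMap g) n (map R (singMap f) n a) := by
  induction a using cls_ind with
  | h f => rfl

lemma map_cupH {K L : SSet.{u}} (φ : K ⟶ L) {m n N : ℕ} (h : m + n = N) (a : Cohomology R L m)
    (b : Cohomology R L n) : map R φ N (cupH R L h a b) = cupH R K h (map R φ m a) (map R φ n b) := by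
  induction a using cls_ind with
  | h f =>
  induction b using cls_ind with
  | h g =>
    refine congrArg (cls (R := R) (K := K)) (Subtype.ext (funext fun σ => ?_))
    change cup h f.1 g.1 (φ.app _ σ) = f.1 (φ.app _ _) * g.1 (φ.app _ _)
    rw [NatTrans.naturality_apply, NatTrans.naturality_apply]
    rfl

lemma affine_const {m k : ℕ} (y : Simp m) (x : Simp k) : affine (fun _ => y) x = y := by
  ext j
  rw [affine_apply, ← Finset.sum_mul, stdSimplex.sum_eq_one, one_mul]

/-- The parametrization of the unit interval by the standard `1`-simplex. -/
def simpToI : C(Simp 1, unitInterval) where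
  toFun x := ⟨x 1, x.2.1 1, stdSimplex.le_one x 1⟩
  continuous_toFun := by
    refine Continuous.subtype_mk ?_ _
    exact (continuous_apply (1 : Fin 2)).comp continuous_subtype_val

/-- Homotopic maps induce the same map in cohomology. -/
lemma map_eq_of_homotopy {f₀ f₁ : C(Y, Z)} (H : f₀.Homotopy f₁) {n : ℕ}
    (a : Cohomology R (Sing Z) (n + 1)) :
    map R (singMap f₀) (n + 1) a = map R (singMap f₁) (n + 1) a := by
  induction a using cls_ind with
  | h f =>
    let G : ∀ {m : ℕ}, (Sing Y) _⦋m⦌ → C(Simp m × Simp 1, Z) := fun σ =>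
      H.toContinuousMap.comp ((simpToI.comp ContinuousMap.snd).prodMk
        ((toMap σ).comp ContinuousMap.fst))
    -- The prism operator: `f` is evaluated on the Eilenberg–Zilber chain of a simplex times `Simp
    -- 1`. As `f` is a cocycle, the Leibniz rule leaves only the coboundary of `h` and the two ends.
    let h : Cochain R (Sing Y) n := fun σ => biEval f.1 (G σ)
    have hd : ∀ σ, d R (Sing Y) n h σ =
        (-1 : R) ^ (n + 2) * (f.1 ((singMap f₁).app _ σ) - f.1 ((singMap f₀).app _ σ)) := by
      intro σ
      have e1 : d R (Sing Y) n h σ = ext ((biRealize (G σ)).ev f.1)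
          (stair₂ (bdList R (vertices (n + 1))) (Finsupp.single (vertices 1) 1)) := by
        rw [biEval_left, d_apply]
        rfl
      have e2 := biEval_d f.1 (G σ)
      rw [mem_cocycles_iff.1 f.2] at e2
      have e3 : biEval (0 : Cochain R (Sing Z) (n + 1 + 1)) (G σ) = 0 := by
        have : (biRealize (G σ)).ev (0 : Cochain R (Sing Z) (n + 1 + 1)) = fun _ => 0 := by
          funext L
          rw [Realization.ev]
          split_ifs <;> rfl
        rw [biEval, this]
        simp [Finsupp.linearCombination_apply]
      have e4 : bdList R (vertices 1) = Finsupp.single [stdSimplex.vertex 1] (1 : R) -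
          Finsupp.single [stdSimplex.vertex 0] 1 := by
        simp [vertices]
      have e5 : ∀ j : Fin 2, ext ((biRealize (G σ)).ev f.1)
          (stair₂ (Finsupp.single (vertices (n + 1)) (1 : R))
            (Finsupp.single [stdSimplex.vertex j] 1)) =
          f.1 ((biRealize (G σ)).toFun (n + 1)
            fun i => (stdSimplex.vertex i, stdSimplex.vertex j)) := by
        intro j
        obtain ⟨x, l, hl⟩ : ∃ x l, vertices (n + 1) = x :: l := by
          rw [vertices, List.ofFn_succ]
          exact ⟨_, _, rfl⟩
        rw [stair₂_single, hl, stair_singleton, ← hl, ext_single, vertices, List.map_ofFn]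
        exact Realization.ev_ofFn _ _ _
      have e6 : ∀ j : Fin 2, ∀ x, toMap ((biRealize (G σ)).toFun (n + 1)
            fun i => (stdSimplex.vertex i, stdSimplex.vertex j)) x =
            H (simpToI (stdSimplex.vertex j), toMap σ x) := by
        intro j x
        rw [toMap_biRealize]
        simp only [affine_const, affine_vertices]
        rfl
      have e7 : (biRealize (G σ)).toFun (n + 1) (fun i => (stdSimplex.vertex i,
          stdSimplex.vertex 1)) = (singMap f₁).app _ σ := by
        apply toMap.injective
        ext x
        rw [e6]
        have : simpToI (stdSimplex.vertex 1) = 1 := Subtype.ext (by simp [simpToI])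
        rw [this, H.apply_one]
        rfl
      have e8 : (biRealize (G σ)).toFun (n + 1) (fun i => (stdSimplex.vertex i,
          stdSimplex.vertex 0)) = (singMap f₀).app _ σ := by
        apply toMap.injective
        ext x
        rw [e6]
        have : simpToI (stdSimplex.vertex 0) = 0 := Subtype.ext (by simp [simpToI])
        rw [this, H.apply_zero]
        rfl
      rw [e3, e4, map_sub, map_sub, e5, e5, e7, e8, ← e1] at e2
      rw [← sub_eq_zero, ← smul_eq_mul]
      exact e2.symm
    refine (cls_eq_cls _ _ ((-1 : R) ^ (n + 2) • h) ?_).symm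
    funext σ
    rw [map_smul, Pi.smul_apply, hd, smul_eq_mul, ← mul_assoc, ← mul_pow]
    simp
    rfl

/-- Constant maps induce zero in positive degrees. -/
lemma map_const (z : Z) {n : ℕ} (a : Cohomology R (Sing Z) (n + 1)) :
    map R (singMap (ContinuousMap.const Y z)) (n + 1) a = 0 := by
  induction a using cls_ind with
  | h f =>
    -- A constant simplex of positive dimension is an affine simplex with all vertices equal, so a
    -- normalized representative vanishes on it.
    obtain ⟨f', hf', hnd⟩ := exists_nondeg f
    rw [← hf']
    refine cls_eq_zero ?_
    have : cochainMap R (singMap (ContinuousMap.const Y z)) (n + 1) f'.1 = 0 := by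
      funext σ
      let τ : (Sing Z) _⦋0⦌ := toMap.symm (ContinuousMap.const _ z)
      have e := (realize τ).ev_ofFn f'.1 fun _ : Fin (n + 1 + 1) => stdSimplex.vertex (0 : Fin 1)
      rw [List.ofFn_succ, List.ofFn_succ] at e
      have e' := hnd τ [] (stdSimplex.vertex (0 : Fin 1))
        (List.ofFn fun _ : Fin n => stdSimplex.vertex (0 : Fin 1))
      rw [List.nil_append] at e'
      rw [e'] at e
      refine Eq.trans (congrArg f'.1 ?_) e.symm
      apply toMap.injective
      ext x
      rw [toMap_realize]
      simp [τ]
      rfl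
    change cochainMap R (singMap (ContinuousMap.const Y z)) (n + 1) f'.1 ∈ _
    rw [this]
    exact Submodule.zero_mem _

end

/-! ### The Künneth pairing -/

section

variable {F : Type} [Field F] {S T : Type u} [TopologicalSpace S] [TopologicalSpace T]

/-- The pairing of a cochain on a product with the Eilenberg–Zilber product of two chains. -/
def crossPair {p q N : ℕ} (g : Cochain F (Sing (S × T)) N) (z : (Sing S) _⦋p⦌ →₀ F)
    (w : (Sing T) _⦋q⦌ →₀ F) : F :=
  pair (fun σ => pair (fun τ => biEval g ((toMap σ).prodMap (toMap τ))) w) z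

/-- By the Leibniz rule a coboundary is evaluated on the products of `∂z` with `w` and of `z` with
`∂w`, and both boundaries are zero. -/
lemma crossPair_d {p q N : ℕ} (g : Cochain F (Sing (S × T)) N) {z : (Sing S) _⦋p + 1⦌ →₀ F}
    {w : (Sing T) _⦋q + 1⦌ →₀ F} (hz : boundary F (Sing S) p z = 0)
    (hw : boundary F (Sing T) q w = 0) : crossPair (d F (Sing (S × T)) N g) z w = 0 := by
  have e : ∀ (σ : (Sing S) _⦋p + 1⦌) (τ : (Sing T) _⦋q + 1⦌),
      biEval (d F (Sing (S × T)) N g) ((toMap σ).prodMap (toMap τ)) =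
        d F (Sing S) p (fun σ => biEval g ((toMap σ).prodMap (toMap τ))) σ -
        (-1 : F) ^ (p + 1 + 1) *
          d F (Sing T) q (fun τ => biEval g ((toMap σ).prodMap (toMap τ))) τ := by
    intro σ τ
    rw [biEval_d, biEval_left, biEval_right, d_apply, d_apply]
    rfl
  have h1 : ∀ (h : (Sing T) _⦋q + 1⦌ → Cochain F (Sing S) p),
      pair (fun τ => pair (d F (Sing S) p (h τ)) z) w = 0 := fun h => by
    have : (fun τ => pair (d F (Sing S) p (h τ)) z) = (0 : Cochain F (Sing T) (q + 1)) :=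
      funext fun τ => by rw [← pair_boundary, hz, map_zero]; rfl
    rw [this]
    simp [pair_apply]
  have h2 : ∀ (h : (Sing S) _⦋p + 1⦌ → Cochain F (Sing T) q),
      pair (fun σ => pair (d F (Sing T) q (h σ)) w) z = 0 := fun h => by
    have : (fun σ => pair (d F (Sing T) q (h σ)) w) = (0 : Cochain F (Sing S) (p + 1)) :=
      funext fun τ => by rw [← pair_boundary, hw, map_zero]; rfl
    rw [this]
    simp [pair_apply]
  have h3 : crossPair (d F (Sing (S × T)) N g) z w =
      pair (fun τ => pair (d F (Sing S) p
        (fun σ => biEval g ((toMap σ).prodMap (toMap τ)))) z) w -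
      (-1 : F) ^ (p + 1 + 1) * pair (fun σ => pair (d F (Sing T) q
        (fun τ => biEval g ((toMap σ).prodMap (toMap τ)))) w) z := by
    -- The two finite sums are interchanged so that the coboundary in the first factor meets `z`
    -- directly.
    have s : pair (fun τ => pair (d F (Sing S) p
        (fun σ => biEval g ((toMap σ).prodMap (toMap τ)))) z) w =
        pair (fun σ => pair (fun τ => d F (Sing S) p
          (fun σ => biEval g ((toMap σ).prodMap (toMap τ))) σ) w) z := by
      simp only [pair_apply, Finsupp.mul_sum]
      rw [Finsupp.sum_comm]
      refine Finsupp.sum_congr fun τ _ => Finsupp.sum_congr fun σ _ => ?_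
      ring
    rw [s]
    simp only [crossPair, e, pair_apply, mul_sub, Finsupp.sum_sub, Finsupp.mul_sum]
    congr 1
    refine Finsupp.sum_congr fun τ _ => Finsupp.sum_congr fun σ _ => ?_
    ring
  rw [h3, h1, h2, mul_zero, sub_zero]

/-- On lists the exterior product is the Alexander–Whitney component `frontBack`, so
`ext_frontBack_stair` applies: only the bidegree that matches the two simplices contributes. -/
lemma biEval_cup {p q r s N : ℕ} (h : r + s = N) (hN : p + q = N) {f : Cochain F (Sing S) r}
    {g : Cochain F (Sing T) s} (hf : ∀ {n : ℕ} (σ : (Sing S) _⦋n⦌), Nondeg ((realize σ).ev f))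
    (hg : ∀ {n : ℕ} (σ : (Sing T) _⦋n⦌), Nondeg ((realize σ).ev g))
    (σ : (Sing S) _⦋p⦌) (τ : (Sing T) _⦋q⦌) :
    biEval (cup h (cochainMap F (singMap (ContinuousMap.fst : C(S × T, S))) r f)
      (cochainMap F (singMap (ContinuousMap.snd : C(S × T, T))) s g))
      ((toMap σ).prodMap (toMap τ)) =
      if p = r then (realize σ).ev f (vertices p) * (realize τ).ev g (vertices q) else 0 := by
  have e : (biRealize ((toMap σ).prodMap (toMap τ))).ev
      (cup h (cochainMap F (singMap (ContinuousMap.fst : C(S × T, S))) r f)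
        (cochainMap F (singMap (ContinuousMap.snd : C(S × T, T))) s g)) =
      frontBack ((realize σ).ev f) ((realize τ).ev g) r := by
    funext L
    have a1 : ∀ (L : List (Simp p × Simp q)), (biRealize ((toMap σ).prodMap (toMap τ))).ev
        (cochainMap F (singMap (ContinuousMap.fst : C(S × T, S))) r f) L =
        (realize σ).ev f (L.map Prod.fst) := by
      intro L
      by_cases hL : L.length = r + 1
      · obtain ⟨v, rfl⟩ := Realization.exists_ofFn hL
        rw [List.map_ofFn, Realization.ev_ofFn, Realization.ev_ofFn]
        refine congrArg f (toMap.injective (ContinuousMap.ext fun x => ?_))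
        rw [toMap_singMap, ContinuousMap.comp_apply, toMap_biRealize, toMap_realize]
        rfl
      · rw [Realization.ev_of_ne _ _ hL, Realization.ev_of_ne _ _ (by simpa using hL)]
    have a2 : ∀ (L : List (Simp p × Simp q)), (biRealize ((toMap σ).prodMap (toMap τ))).ev
        (cochainMap F (singMap (ContinuousMap.snd : C(S × T, T))) s g) L =
        (realize τ).ev g (L.map Prod.snd) := by
      intro L
      by_cases hL : L.length = s + 1
      · obtain ⟨v, rfl⟩ := Realization.exists_ofFn hL
        rw [List.map_ofFn, Realization.ev_ofFn, Realization.ev_ofFn]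
        refine congrArg g (toMap.injective (ContinuousMap.ext fun x => ?_))
        rw [toMap_singMap, ContinuousMap.comp_apply, toMap_biRealize, toMap_realize]
        rfl
      · rw [Realization.ev_of_ne _ _ hL, Realization.ev_of_ne _ _ (by simpa using hL)]
    by_cases hL : L.length = N + 1
    · rw [Realization.ev_cup _ _ _ _ _ hL, a1, a2]
      rfl
    · rw [Realization.ev_of_ne _ _ hL, frontBack, (realize τ).ev_of_ne _ (by simp; omega),
        mul_zero]
  obtain ⟨x, l, hl⟩ : ∃ x l, vertices p = x :: l := by
    rw [vertices, List.ofFn_succ]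
    exact ⟨_, _, rfl⟩
  obtain ⟨y, m, hm⟩ : ∃ x l, vertices q = x :: l := by
    rw [vertices, List.ofFn_succ]
    exact ⟨_, _, rfl⟩
  have hl' : l.length = p := by
    have := congrArg List.length hl
    simpa using this.symm
  have hm' : m.length = q := by
    have := congrArg List.length hm
    simpa using this.symm
  rw [biEval, e, hl, hm, ext_frontBack_stair r (hf σ) (hg τ) x l y m (by omega), hl']

lemma ev_vertices {Y : Type u} [TopologicalSpace Y] {n : ℕ} (f : Cochain F (Sing Y) n)
    (σ : (Sing Y) _⦋n⦌) : (realize σ).ev f (vertices n) = f σ := by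
  rw [vertices, Realization.ev_ofFn, realize_vertices]

/-- The Künneth pairing of an exterior product. -/
lemma crossPair_cup {p q N : ℕ} (h : p + q = N) {f : Cochain F (Sing S) p}
    {g : Cochain F (Sing T) q} (hf : ∀ {n : ℕ} (σ : (Sing S) _⦋n⦌), Nondeg ((realize σ).ev f))
    (hg : ∀ {n : ℕ} (σ : (Sing T) _⦋n⦌), Nondeg ((realize σ).ev g))
    (z : (Sing S) _⦋p⦌ →₀ F) (w : (Sing T) _⦋q⦌ →₀ F) :
    crossPair (cup h (cochainMap F (singMap (ContinuousMap.fst : C(S × T, S))) p f)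
      (cochainMap F (singMap (ContinuousMap.snd : C(S × T, T))) q g)) z w =
      pair f z * pair g w := by
  simp only [crossPair, biEval_cup h h hf hg, if_true, ev_vertices, pair_apply]
  rw [Finsupp.sum_mul]
  refine Finsupp.sum_congr fun σ _ => ?_
  rw [mul_assoc, Finsupp.mul_sum, Finsupp.mul_sum, Finsupp.mul_sum]
  refine Finsupp.sum_congr fun τ _ => ?_
  ring

lemma crossPair_cup_of_ne {p q r s N : ℕ} (h : r + s = N) (hN : p + q = N) (hr : p ≠ r)
    {f : Cochain F (Sing S) r} {g : Cochain F (Sing T) s}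
    (hf : ∀ {n : ℕ} (σ : (Sing S) _⦋n⦌), Nondeg ((realize σ).ev f))
    (hg : ∀ {n : ℕ} (σ : (Sing T) _⦋n⦌), Nondeg ((realize σ).ev g))
    (z : (Sing S) _⦋p⦌ →₀ F) (w : (Sing T) _⦋q⦌ →₀ F) :
    crossPair (cup h (cochainMap F (singMap (ContinuousMap.fst : C(S × T, S))) r f)
      (cochainMap F (singMap (ContinuousMap.snd : C(S × T, T))) s g)) z w = 0 := by
  simp [crossPair, biEval_cup h hN hf hg, hr, pair_apply]

end

end SSetCohomology

namespace SSetCohomology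

open CategoryTheory Simplicial ListChain SimplexAffine

/-! ### The Künneth pairing on cohomology -/

section

variable {F : Type} [Field F] {S T : Type u} [TopologicalSpace S] [TopologicalSpace T]

lemma biEval_add {p q N : ℕ} (g g' : Cochain F (Sing (S × T)) N) (G : C(Simp p × Simp q, S × T)) :
    biEval (g + g') G = biEval g G + biEval g' G := by
  have : (biRealize G).ev (g + g') = (biRealize G).ev g + (biRealize G).ev g' := by
    funext L
    simp only [Realization.ev, Pi.add_apply]
    split_ifs <;> simp
  rw [biEval, biEval, biEval, this]
  simp [Finsupp.linearCombination_apply, Finsupp.sum_add, mul_add]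

lemma biEval_smul {p q N : ℕ} (c : F) (g : Cochain F (Sing (S × T)) N)
    (G : C(Simp p × Simp q, S × T)) : biEval (c • g) G = c * biEval g G := by
  have : (biRealize G).ev (c • g) = c • (biRealize G).ev g := by
    funext L
    simp only [Realization.ev, Pi.smul_apply]
    split_ifs <;> simp
  rw [biEval, biEval, this]
  simp only [Finsupp.linearCombination_apply, Finsupp.mul_sum]
  refine Finsupp.sum_congr fun L _ => ?_
  simp only [Pi.smul_apply, smul_eq_mul]
  ring

/-- The functional on the cohomology of a product given by two cycles. -/
def crossClass {p q : ℕ} (N : ℕ) {z : (Sing S) _⦋p + 1⦌ →₀ F} {w : (Sing T) _⦋q + 1⦌ →₀ F}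
    (hz : boundary F (Sing S) p z = 0) (hw : boundary F (Sing T) q w = 0) :
    Cohomology F (Sing (S × T)) (N + 1) →ₗ[F] F :=
  Submodule.liftQ _
    ({ toFun := fun g => crossPair g.1 z w
       map_add' := fun g g' => by
        simp [crossPair, biEval_add, pair_apply, mul_add, Finsupp.sum_add]
       map_smul' := fun c g => by
        simp only [crossPair, Submodule.coe_smul, biEval_smul, pair_apply, RingHom.id_apply,
          smul_eq_mul, Finsupp.mul_sum]
        refine Finsupp.sum_congr fun σ _ => Finsupp.sum_congr fun τ _ => ?_
        ring } : cocycles F (Sing (S × T)) (N + 1) →ₗ[F] F)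
    fun g hg => by
      obtain ⟨c, hc⟩ := hg
      change crossPair g.1 z w = 0
      rw [show g.1 = d F (Sing (S × T)) N c from hc.symm, crossPair_d c hz hw]

/-- The first projection. -/
abbrev prFst (S T : Type u) [TopologicalSpace S] [TopologicalSpace T] : C(S × T, S) :=
  ContinuousMap.fst

/-- The second projection. -/
abbrev prSnd (S T : Type u) [TopologicalSpace S] [TopologicalSpace T] : C(S × T, T) :=
  ContinuousMap.snd

/-- Both sides depend only on the classes, so the cocycles may be replaced by normalized ones, for
which the formula holds on cochains. -/
lemma crossClass_cup {p q N : ℕ} {z : (Sing S) _⦋p + 1⦌ →₀ F} {w : (Sing T) _⦋q + 1⦌ →₀ F}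
    (hz : boundary F (Sing S) p z = 0) (hw : boundary F (Sing T) q w = 0)
    (h : p + 1 + (q + 1) = N + 1) (f : cocycles F (Sing S) (p + 1))
    (g : cocycles F (Sing T) (q + 1)) :
    crossClass N hz hw (cupH F _ h (map F (singMap (prFst S T)) _ (cls f))
      (map F (singMap (prSnd S T)) _ (cls g))) = pair f.1 z * pair g.1 w := by
  obtain ⟨f', hf', hnf⟩ := exists_nondeg f
  obtain ⟨g', hg', hng⟩ := exists_nondeg g
  rw [← pair_eq_of_cls_eq hf' hz, ← pair_eq_of_cls_eq hg' hw, ← hf', ← hg']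
  exact crossPair_cup h (fun σ => hnf σ) (fun σ => hng σ) z w

lemma crossClass_cup_of_ne {p q r s N : ℕ} {z : (Sing S) _⦋p + 1⦌ →₀ F}
    {w : (Sing T) _⦋q + 1⦌ →₀ F}
    (hz : boundary F (Sing S) p z = 0) (hw : boundary F (Sing T) q w = 0)
    (hN : p + 1 + (q + 1) = N + 1) (h : r + s = N + 1) (hr : r ≠ 0) (hs : s ≠ 0) (hpr : p + 1 ≠ r)
    (a : Cohomology F (Sing S) r) (b : Cohomology F (Sing T) s) :
    crossClass N hz hw (cupH F _ h (map F (singMap (prFst S T)) _ a)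
      (map F (singMap (prSnd S T)) _ b)) = 0 := by
  obtain ⟨r, rfl⟩ := Nat.exists_eq_succ_of_ne_zero hr
  obtain ⟨s, rfl⟩ := Nat.exists_eq_succ_of_ne_zero hs
  induction a using cls_ind with
  | h f =>
  induction b using cls_ind with
  | h g =>
    obtain ⟨f', hf', hnf⟩ := exists_nondeg f
    obtain ⟨g', hg', hng⟩ := exists_nondeg g
    rw [← hf', ← hg']
    exact crossPair_cup_of_ne h hN hpr (fun σ => hnf σ) (fun σ => hng σ) z w

/-! ### Products in spaces covered by two contractible open subsets -/

/-- The space is covered by two open subsets which can be contracted in it to the base point. -/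
def TwoCover (S : Type u) [TopologicalSpace S] (s₀ : S) : Prop :=
  ∃ U V : Set S, IsOpen U ∧ IsOpen V ∧ U ∪ V = Set.univ ∧
    (incl U).Homotopic (ContinuousMap.const U s₀) ∧ (incl V).Homotopic (ContinuousMap.const V s₀)

lemma map_eq_of_homotopic {R : Type} [CommRing R] {Y Z : Type u} [TopologicalSpace Y]
    [TopologicalSpace Z] {f₀ f₁ : C(Y, Z)} (h : f₀.Homotopic f₁) {n : ℕ} (hn : n ≠ 0)
    (a : Cohomology R (Sing Z) n) : map R (singMap f₀) n a = map R (singMap f₁) n a := by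
  obtain ⟨n, rfl⟩ := Nat.exists_eq_succ_of_ne_zero hn
  obtain ⟨H⟩ := h
  exact map_eq_of_homotopy H a

lemma map_const' {R : Type} [CommRing R] {Y Z : Type u} [TopologicalSpace Y] [TopologicalSpace Z]
    (z : Z) {n : ℕ} (hn : n ≠ 0) (a : Cohomology R (Sing Z) n) :
    map R (singMap (ContinuousMap.const Y z)) n a = 0 := by
  obtain ⟨n, rfl⟩ := Nat.exists_eq_succ_of_ne_zero hn
  exact map_const z a

variable {X : Type u} [TopologicalSpace X]

/-- The restriction of a class to a subspace vanishes. -/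
def VanishesOn (W : Set (S × T)) {n : ℕ} (c : Cohomology F (Sing (S × T)) n) : Prop :=
  map F (singMap (incl W)) n c = 0

lemma VanishesOn.cup_left {W : Set (S × T)} {m n N : ℕ} (h : m + n = N)
    {c : Cohomology F (Sing (S × T)) m} (hc : VanishesOn W c) (b : Cohomology F (Sing (S × T)) n) :
    VanishesOn W (cupH F _ h c b) := by
  rw [VanishesOn, map_cupH, hc, LinearMap.map_zero₂]

lemma VanishesOn.cup_right {W : Set (S × T)} {m n N : ℕ} (h : m + n = N)
    {c : Cohomology F (Sing (S × T)) n} (hc : VanishesOn W c) (b : Cohomology F (Sing (S × T)) m) :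
    VanishesOn W (cupH F _ h b c) := by
  rw [VanishesOn, map_cupH, hc, map_zero]

lemma VanishesOn.add {W : Set (S × T)} {n : ℕ} {c c' : Cohomology F (Sing (S × T)) n}
    (hc : VanishesOn W c) (hc' : VanishesOn W c') : VanishesOn W (c + c') := by
  rw [VanishesOn, map_add, hc, hc', add_zero]

section restrict

variable (μ : C(S × T, X)) (s₀ : S) (t₀ : T)

/-- The restriction of a map on `S × T` to `S`. -/
def restrictFst : C(S, X) := μ.comp ((ContinuousMap.id S).prodMk (ContinuousMap.const S t₀))

/-- The restriction of a map on `S × T` to `T`. -/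
def restrictSnd : C(T, X) := μ.comp ((ContinuousMap.const T s₀).prodMk (ContinuousMap.id T))

/-- The part of a class coming from `S`. -/
def partFst {n : ℕ} (x : Cohomology F (Sing X) n) : Cohomology F (Sing (S × T)) n :=
  map F (singMap (prFst S T)) n (map F (singMap (restrictFst μ t₀)) n x)

/-- The part of a class coming from `T`. -/
def partSnd {n : ℕ} (x : Cohomology F (Sing X) n) : Cohomology F (Sing (S × T)) n :=
  map F (singMap (prSnd S T)) n (map F (singMap (restrictSnd μ s₀)) n x)

/-- The remaining part of a class. -/
def partMix {n : ℕ} (x : Cohomology F (Sing X) n) : Cohomology F (Sing (S × T)) n :=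
  map F (singMap μ) n x - partFst μ t₀ x - partSnd μ s₀ x

variable {s₀ t₀}

lemma homotopic_fst {U : Set S} (h : (incl U).Homotopic (ContinuousMap.const U s₀)) :
    (incl (Prod.fst ⁻¹' U : Set (S × T))).Homotopic
      (((ContinuousMap.const T s₀).prodMk (ContinuousMap.id T)).comp
        ((prSnd S T).comp (incl (Prod.fst ⁻¹' U : Set (S × T))))) := by
  obtain ⟨H⟩ := h
  exact ⟨{
    toFun := fun q => (H (q.1, ⟨q.2.1.1, q.2.2⟩), q.2.1.2)
    continuous_toFun := by fun_prop
    map_zero_left := fun q => by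
      change (H (0, _), _) = _
      rw [H.apply_zero]
      rfl
    map_one_left := fun q => by
      change (H (1, _), _) = _
      rw [H.apply_one]
      rfl }⟩

lemma homotopic_snd {V : Set T} (h : (incl V).Homotopic (ContinuousMap.const V t₀)) :
    (incl (Prod.snd ⁻¹' V : Set (S × T))).Homotopic
      (((ContinuousMap.id S).prodMk (ContinuousMap.const S t₀)).comp
        ((prFst S T).comp (incl (Prod.snd ⁻¹' V : Set (S × T))))) := by
  obtain ⟨H⟩ := h
  exact ⟨{
    toFun := fun q => (q.2.1.1, H (q.1, ⟨q.2.1.2, q.2.2⟩))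
    continuous_toFun := by fun_prop
    map_zero_left := fun q => by
      change (_, H (0, _)) = _
      rw [H.apply_zero]
      rfl
    map_one_left := fun q => by
      change (_, H (1, _)) = _
      rw [H.apply_one]
      rfl }⟩

lemma partFst_vanishes {U : Set S} (h : (incl U).Homotopic (ContinuousMap.const U s₀)) {n : ℕ}
    (hn : n ≠ 0) (x : Cohomology F (Sing X) n) :
    VanishesOn (Prod.fst ⁻¹' U : Set (S × T)) (partFst μ t₀ x) := by
  rw [VanishesOn, map_eq_of_homotopic (homotopic_fst h) hn, partFst, ← map_singMap_comp,
    ← map_singMap_comp]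
  exact map_const' (restrictFst μ t₀ s₀) hn x

lemma partSnd_vanishes {V : Set T} (h : (incl V).Homotopic (ContinuousMap.const V t₀)) {n : ℕ}
    (hn : n ≠ 0) (x : Cohomology F (Sing X) n) :
    VanishesOn (Prod.snd ⁻¹' V : Set (S × T)) (partSnd μ s₀ x) := by
  rw [VanishesOn, map_eq_of_homotopic (homotopic_snd h) hn, partSnd, ← map_singMap_comp,
    ← map_singMap_comp]
  exact map_const' (restrictSnd μ s₀ t₀) hn x

/-- Over `U × T` the map `μ` is homotopic to its restriction to the second axis after projection.
There `μ^* x` agrees with its part from `T`, and its part from `S` restricts to zero. -/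
lemma partMix_vanishes_fst {U : Set S} (h : (incl U).Homotopic (ContinuousMap.const U s₀)) {n : ℕ}
    (hn : n ≠ 0) (x : Cohomology F (Sing X) n) :
    VanishesOn (Prod.fst ⁻¹' U : Set (S × T)) (partMix μ s₀ t₀ x) := by
  have h1 := partFst_vanishes μ (t₀ := t₀) h hn x
  rw [VanishesOn] at h1
  rw [VanishesOn, partMix, map_sub, map_sub, h1, sub_zero, map_eq_of_homotopic (homotopic_fst h) hn,
    map_eq_of_homotopic (homotopic_fst h) hn, partSnd, ← map_singMap_comp, ← map_singMap_comp,
    ← map_singMap_comp, sub_eq_zero]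
  rfl

lemma partMix_vanishes_snd {V : Set T} (h : (incl V).Homotopic (ContinuousMap.const V t₀)) {n : ℕ}
    (hn : n ≠ 0) (x : Cohomology F (Sing X) n) :
    VanishesOn (Prod.snd ⁻¹' V : Set (S × T)) (partMix μ s₀ t₀ x) := by
  have h1 := partSnd_vanishes μ (s₀ := s₀) h hn x
  rw [VanishesOn] at h1
  rw [VanishesOn, partMix, map_sub, map_sub, h1, sub_zero, map_eq_of_homotopic (homotopic_snd h) hn,
    map_eq_of_homotopic (homotopic_snd h) hn, partFst, ← map_singMap_comp, ← map_singMap_comp,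
    ← map_singMap_comp, sub_eq_zero]
  rfl

end restrict

/-- The restrictions of a class to two subspaces vanish. -/
def VanishesOnBoth (W W' : Set (S × T)) {n : ℕ} (c : Cohomology F (Sing (S × T)) n) : Prop :=
  VanishesOn W c ∧ VanishesOn W' c

lemma cup_eq_zero_of_vanishes {W W' : Set (S × T)} (hW : IsOpen W) (hW' : IsOpen W')
    (hWW : W ∪ W' = Set.univ) {m n N : ℕ} (h : m + n = N) (hm : m ≠ 0) (hn : n ≠ 0)
    {a : Cohomology F (Sing (S × T)) m} {b : Cohomology F (Sing (S × T)) n}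
    (ha : VanishesOnBoth W W' a) (hb : VanishesOnBoth W W' b) : cupH F _ h a b = 0 :=
  cupH_eq_zero hW hW' hWW h hm hn a b ha.1 hb.2

/-- The products of two pulled back classes, and the vanishing of products of three. -/
lemma cup_pullback (μ : C(S × T, X)) {s₀ : S} {t₀ : T} (hS : TwoCover S s₀) (hT : TwoCover T t₀)
    {m n N : ℕ} (h : m + n = N) (hm : m ≠ 0) (hn : n ≠ 0) (x : Cohomology F (Sing X) m)
    (y : Cohomology F (Sing X) n) :
    cupH F _ h (map F (singMap μ) m x) (map F (singMap μ) n y) =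
      cupH F _ h (partFst μ t₀ x) (partSnd μ s₀ y) + cupH F _ h (partSnd μ s₀ x) (partFst μ t₀ y) ∧
    ∀ {k M : ℕ} (hM : N + k = M) (_ : k ≠ 0) (z : Cohomology F (Sing X) k),
      cupH F _ hM (cupH F _ h (map F (singMap μ) m x) (map F (singMap μ) n y))
        (map F (singMap μ) k z) = 0 := by
  obtain ⟨U, U', hU, hU', hUU, hUc, hUc'⟩ := hS
  obtain ⟨V, V', hV, hV', hVV, hVc, hVc'⟩ := hT
  let A : Set (S × T) := {q | q.1 ∈ U}
  let A' : Set (S × T) := {q | q.1 ∈ U'}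
  let B : Set (S × T) := {q | q.2 ∈ V}
  let B' : Set (S × T) := {q | q.2 ∈ V'}
  have hAA : A ∪ A' = Set.univ := Set.eq_univ_of_forall fun q =>
    (hUU ▸ Set.mem_univ q.1 : q.1 ∈ U ∪ U')
  have hBB : B ∪ B' = Set.univ := Set.eq_univ_of_forall fun q =>
    (hVV ▸ Set.mem_univ q.2 : q.2 ∈ V ∪ V')
  have pA := fun {m n N : ℕ} (h : m + n = N) (hm : m ≠ 0) (hn : n ≠ 0)
    (a : Cohomology F (Sing (S × T)) m) (b : Cohomology F (Sing (S × T)) n) =>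
    cup_eq_zero_of_vanishes (W := A) (W' := A') (hU.preimage continuous_fst)
      (hU'.preimage continuous_fst) hAA h hm hn (a := a) (b := b)
  have pB := fun {m n N : ℕ} (h : m + n = N) (hm : m ≠ 0) (hn : n ≠ 0)
    (a : Cohomology F (Sing (S × T)) m) (b : Cohomology F (Sing (S × T)) n) =>
    cup_eq_zero_of_vanishes (W := B) (W' := B') (hV.preimage continuous_snd)
      (hV'.preimage continuous_snd) hBB h hm hn (a := a) (b := b)
  have f1 : ∀ {m : ℕ}, m ≠ 0 → ∀ x : Cohomology F (Sing X) m,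
      VanishesOnBoth A A' (partFst μ t₀ x) := fun hm x =>
    ⟨partFst_vanishes μ hUc hm x, partFst_vanishes μ hUc' hm x⟩
  have f2 : ∀ {m : ℕ}, m ≠ 0 → ∀ x : Cohomology F (Sing X) m,
      VanishesOnBoth B B' (partSnd μ s₀ x) := fun hm x =>
    ⟨partSnd_vanishes μ hVc hm x, partSnd_vanishes μ hVc' hm x⟩
  have f3 : ∀ {m : ℕ}, m ≠ 0 → ∀ x : Cohomology F (Sing X) m,
      VanishesOnBoth A A' (partMix μ s₀ t₀ x) := fun hm x =>
    ⟨partMix_vanishes_fst μ hUc hm x, partMix_vanishes_fst μ hUc' hm x⟩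
  have f4 : ∀ {m : ℕ}, m ≠ 0 → ∀ x : Cohomology F (Sing X) m,
      VanishesOnBoth B B' (partMix μ s₀ t₀ x) := fun hm x =>
    ⟨partMix_vanishes_snd μ hVc hm x, partMix_vanishes_snd μ hVc' hm x⟩
  have dec : ∀ {m : ℕ} (x : Cohomology F (Sing X) m), map F (singMap μ) m x =
      partFst μ t₀ x + partSnd μ s₀ x + partMix μ s₀ t₀ x := fun x => by
    rw [partMix]; abel
  have e : cupH F _ h (map F (singMap μ) m x) (map F (singMap μ) n y) =
      cupH F _ h (partFst μ t₀ x) (partSnd μ s₀ y) +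
        cupH F _ h (partSnd μ s₀ x) (partFst μ t₀ y) := by
    rw [dec x, dec y]
    simp only [map_add, LinearMap.add_apply]
    -- Of the nine products seven vanish: two factors that are first or mixed parts die by the cover
    -- of `S`, two that are second or mixed parts by the cover of `T`. The two cross terms remain.
    rw [pA h hm hn _ _ (f1 hm x) (f1 hn y), pA h hm hn _ _ (f1 hm x) (f3 hn y),
      pA h hm hn _ _ (f3 hm x) (f1 hn y), pA h hm hn _ _ (f3 hm x) (f3 hn y),
      pB h hm hn _ _ (f2 hm x) (f2 hn y), pB h hm hn _ _ (f2 hm x) (f4 hn y),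
      pB h hm hn _ _ (f4 hm x) (f2 hn y)]
    abel
  refine ⟨e, fun {k M} hM hk z => ?_⟩
  have hN : N ≠ 0 := by omega
  rw [e, dec z]
  -- Each cross term has a factor from `S` and one from `T`, hence vanishes over the members of both
  -- covers; its product with any of the three parts of a third class is then zero.
  have g1 : VanishesOnBoth A A' (cupH F _ h (partFst μ t₀ x) (partSnd μ s₀ y) +
      cupH F _ h (partSnd μ s₀ x) (partFst μ t₀ y)) :=
    ⟨((f1 hm x).1.cup_left h _).add ((f1 hn y).1.cup_right h _),
      ((f1 hm x).2.cup_left h _).add ((f1 hn y).2.cup_right h _)⟩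
  have g2 : VanishesOnBoth B B' (cupH F _ h (partFst μ t₀ x) (partSnd μ s₀ y) +
      cupH F _ h (partSnd μ s₀ x) (partFst μ t₀ y)) :=
    ⟨((f2 hn y).1.cup_right h _).add ((f2 hm x).1.cup_left h _),
      ((f2 hn y).2.cup_right h _).add ((f2 hm x).2.cup_left h _)⟩
  rw [map_add, map_add, pA hM hN hk _ _ g1 (f1 hk z), pB hM hN hk _ _ g2 (f2 hk z),
    pA hM hN hk _ _ g1 (f3 hk z), add_zero, add_zero]

end

end SSetCohomology

/-! ### Detection of exterior products, and cohomology in degree zero -/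

namespace SSetCohomology

open CategoryTheory Simplicial ListChain SimplexAffine

/-- A functional on the cohomology of a product detecting the cross product of two classes. -/
lemma exists_functional {F : Type} [Field F] {S T : Type u} [TopologicalSpace S]
    [TopologicalSpace T] {d e : ℕ} (hd : d ≠ 0) (he : e ≠ 0) {a : Cohomology F (Sing S) d}
    {b : Cohomology F (Sing T) e} (ha : a ≠ 0) (hb : b ≠ 0) :
    ∃ ψ : Cohomology F (Sing (S × T)) (d + e) →ₗ[F] F,
      ψ (cupH F _ rfl (map F (singMap (prFst S T)) _ a) (map F (singMap (prSnd S T)) _ b)) ≠ 0 ∧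
      ∀ {r s : ℕ} (h : r + s = d + e), r ≠ 0 → s ≠ 0 → d ≠ r →
        ∀ (a' : Cohomology F (Sing S) r) (b' : Cohomology F (Sing T) s),
        ψ (cupH F _ h (map F (singMap (prFst S T)) _ a') (map F (singMap (prSnd S T)) _ b')) = 0 := by
  obtain ⟨d, rfl⟩ := Nat.exists_eq_succ_of_ne_zero hd
  obtain ⟨e, rfl⟩ := Nat.exists_eq_succ_of_ne_zero he
  induction a using cls_ind with
  | h f =>
  induction b using cls_ind with
  | h g =>
    obtain ⟨z, hz, hfz⟩ := exists_cycle_of_cls_ne_zero ha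
    obtain ⟨w, hw, hgw⟩ := exists_cycle_of_cls_ne_zero hb
    refine ⟨crossClass (d + 1 + e) hz hw, ?_, fun h hr hs hdr a' b' => ?_⟩
    · exact (crossClass_cup hz hw rfl f g).trans_ne (mul_ne_zero hfz hgw)
    · exact crossClass_cup_of_ne hz hw rfl h hr hs hdr a' b'

/-- A `0`-cocycle takes equal values at the ends of a path. This is used to show that polynomial
generators have positive degree. -/
lemma exists_eq_smul_one {R : Type} [CommRing R] {X : Type u} [TopologicalSpace X]
    [PathConnectedSpace X] (a : Cohomology R (Sing X) 0) :
    ∃ c : R, a = c • cls (oneCocycle R (Sing X)) := by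
  induction a using cls_ind with
  | h f =>
    obtain ⟨x₀⟩ := (inferInstance : Nonempty X)
    let pt : X → (Sing X) _⦋0⦌ := fun x => toMap.symm (ContinuousMap.const _ x)
    refine ⟨f.1 (pt x₀), ?_⟩
    rw [← map_smul]
    congr 1
    apply Subtype.ext
    funext σ
    change f.1 σ = f.1 (pt x₀) * 1
    rw [mul_one]
    have hx : ∀ x : Simp 0, x = stdSimplex.vertex 0 := fun x => by
      ext j
      obtain rfl : j = (0 : Fin 1) := Fin.eq_zero j
      have h1 : ∑ i : Fin 1, x i = 1 := stdSimplex.sum_eq_one x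
      rw [Fin.sum_univ_one] at h1
      exact h1.trans (by simp)
    let γ := PathConnectedSpace.somePath x₀ (toMap σ (stdSimplex.vertex 0))
    let τ : (Sing X) _⦋1⦌ := toMap.symm ((γ : C(unitInterval, X)).comp simpToI)
    have hτ : ∀ i : Fin 2, ∀ x, toMap ((Sing X).map (SimplexCategory.δ i).op τ) x =
        γ (simpToI (stdSimplex.vertex ((SimplexCategory.δ i).toOrderHom 0))) := fun i x => by
      rw [toMap_map, hx x, stdSimplex.map_vertex]
      simp only [τ, Equiv.apply_symm_apply]
      rfl
    have h1 := congrFun (mem_cocycles_iff.1 f.2) τ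
    have e0 : (Sing X).map (SimplexCategory.δ (0 : Fin 2)).op τ = σ := by
      apply toMap.injective
      ext x
      have : simpToI (stdSimplex.vertex ((SimplexCategory.δ (0 : Fin 2)).toOrderHom 0)) = 1 :=
        Subtype.ext (by simp [simpToI, SimplexCategory.δ])
      rw [hτ, this, γ.target, hx x]
    have e1 : (Sing X).map (SimplexCategory.δ (1 : Fin 2)).op τ = pt x₀ := by
      apply toMap.injective
      ext x
      have : simpToI (stdSimplex.vertex ((SimplexCategory.δ (1 : Fin 2)).toOrderHom 0)) = 0 :=
        Subtype.ext (by simp [simpToI, SimplexCategory.δ])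
      rw [hτ, this, γ.source]
      simp [pt]
    rw [d_apply, Fin.sum_univ_two, e0, e1] at h1
    simpa [← sub_eq_add_neg, sub_eq_zero] using h1

end SSetCohomology

/-! ### Polynomial cohomology rings and pullbacks to products of suspensions -/

namespace Samelson

open SSetCohomology MvPolynomial

section

variable {p : ℕ} {Y Z : Type u} [TopologicalSpace Y] [TopologicalSpace Z]

lemma of_mul_of {m n N : ℕ} (h : m + n = N) (a : ModCohomology p Y m) (b : ModCohomology p Y n) :
    DirectSum.of (ModCohomology p Y) m a * DirectSum.of (ModCohomology p Y) n b =
      DirectSum.of (ModCohomology p Y) N (cupH (ZMod p) _ h a b) := by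
  subst h
  exact DirectSum.of_mul_of _ _

/-- The ring homomorphism induced on cohomology by a map. -/
def pullbackRing (p : ℕ) (f : C(Y, Z)) : CohomologyRing p Z →+* CohomologyRing p Y :=
  DirectSum.toSemiring
    (fun n => (DirectSum.of (ModCohomology p Y) n).comp (pullback p f n).toAddMonoidHom)
    (by rfl)
    (fun {m n} a b => by
      change DirectSum.of (ModCohomology p Y) (m + n) (pullback p f (m + n) (cupH _ _ rfl a b)) = _
      refine Eq.trans ?_ (of_mul_of rfl _ _).symm
      rw [pullback, map_cupH]
      rfl)

lemma pullbackRing_of (f : C(Y, Z)) (n : ℕ) (a : ModCohomology p Z n) :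
    pullbackRing p f (DirectSum.of (ModCohomology p Z) n a) =
      DirectSum.of (ModCohomology p Y) n (pullback p f n a) :=
  DirectSum.toSemiring_of _ _ _ _ _

lemma mul_of_apply_zero (u : CohomologyRing p Y) {d : ℕ} (hd : d ≠ 0) (a : ModCohomology p Y d) :
    (u * DirectSum.of (ModCohomology p Y) d a) 0 = 0 := by
  induction u using DirectSum.induction_on with
  | zero => simp
  | of m b =>
    rw [of_mul_of rfl, DirectSum.of_eq_of_ne _ _ _ (by omega)]
  | add u v hu hv => rw [add_mul, DirectSum.add_apply, hu, hv, add_zero]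

end

section

variable {p : ℕ} [Fact p.Prime] {X : Type u} [TopologicalSpace X]
  {n : ℕ} {deg : Fin n → ℕ} {x : ∀ s : Fin n, ModCohomology p X (deg s)}
  {φ : MvPolynomial (Fin n) (ZMod p) ≃+* CohomologyRing p X}

/-- A ring isomorphism is automatically compatible with scalars here, because each scalar is the
image of a natural number. -/
lemma equiv_C (c : ZMod p) : φ (C c) =
    DirectSum.of (ModCohomology p X) 0 (c • cls (oneCocycle (ZMod p) _)) := by
  have h : c = ((c.val : ℕ) : ZMod p) := (ZMod.natCast_zmod_val c).symm
  rw [h, map_natCast, map_natCast]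
  rfl

variable [PathConnectedSpace X]

/-- Degree zero consists of scalars, the images of constant polynomials, and a variable is not
constant. -/
lemma deg_ne_zero (hφ : ∀ s, φ (MvPolynomial.X s) = DirectSum.of (ModCohomology p X) (deg s) (x s))
    (s : Fin n) : deg s ≠ 0 := by
  intro h
  have key : ∀ {d : ℕ} (_ : d = 0) (a : ModCohomology p X d), ∃ c : ZMod p,
      DirectSum.of (ModCohomology p X) d a = φ (C c) := by
    rintro d rfl a
    obtain ⟨c, rfl⟩ := exists_eq_smul_one a
    exact ⟨c, (equiv_C c).symm⟩
  obtain ⟨c, hc⟩ := key h (x s)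
  rw [← hφ] at hc
  have := congrArg (MvPolynomial.coeff (Finsupp.single s 1)) (φ.injective hc)
  rw [coeff_X, if_pos rfl, coeff_C, if_neg (Ne.symm (by simp))] at this
  exact one_ne_zero this

/-- Since all generators have positive degree, the degree-zero component of a class is the constant
term of its polynomial. Thus "positive degree" means "no constant term". -/
lemma equiv_apply_zero (hφ : ∀ s, φ (MvPolynomial.X s) = DirectSum.of (ModCohomology p X) (deg s) (x s))
    (P : MvPolynomial (Fin n) (ZMod p)) :
    φ P 0 = constantCoeff P • cls (oneCocycle (ZMod p) _) := by
  induction P using MvPolynomial.induction_on with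
  | C a => rw [equiv_C, DirectSum.of_eq_same, constantCoeff_C]
  | add P Q hP hQ => rw [map_add, DirectSum.add_apply, hP, hQ, map_add, add_smul]
  | mul_X P s _ => rw [map_mul, hφ, mul_of_apply_zero _ (deg_ne_zero hφ s)]; simp

lemma constantCoeff_symm (hφ : ∀ s, φ (MvPolynomial.X s) = DirectSum.of (ModCohomology p X) (deg s) (x s))
    {u : CohomologyRing p X} (hu : u 0 = 0) :
    constantCoeff (φ.symm u) = 0 := by
  have h := equiv_apply_zero hφ (φ.symm u)
  rw [RingEquiv.apply_symm_apply, hu] at h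
  have h2 : φ (C (constantCoeff (φ.symm u))) = 0 := by rw [equiv_C, ← h, map_zero]
  rw [map_eq_zero_iff _ φ.injective] at h2
  exact (C_eq_zero).1 h2

/-- A product of two polynomials without constant term has no terms of degree less than two. -/
lemma coeff_of_isDecomposable (hφ : ∀ s, φ (MvPolynomial.X s) = DirectSum.of (ModCohomology p X) (deg s) (x s))
    {z : CohomologyRing p X} (hz : IsDecomposable z)
    {m : Fin n →₀ ℕ} (hm : m.degree < 2) : coeff m (φ.symm z) = 0 := by
  refine AddSubgroup.closure_induction (p := fun z _ => coeff m (φ.symm z) = 0)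
    ?_ ?_ (fun a b _ _ ha hb => ?_) (fun a _ ha => ?_) hz
  · rintro _ ⟨u, v, hu, hv, rfl⟩
    rw [map_mul, coeff_mul]
    refine Finset.sum_eq_zero fun ab hab => ?_
    have hab := Finset.HasAntidiagonal.mem_antidiagonal.1 hab
    have h1 := constantCoeff_symm hφ hu
    have h2 := constantCoeff_symm hφ hv
    rw [constantCoeff_eq] at h1 h2
    have h3 : ab.1.degree + ab.2.degree < 2 := by
      rw [← map_add, hab]
      exact hm
    rcases (by omega : ab.1.degree = 0 ∨ ab.2.degree = 0) with h | h
    · rw [(Finsupp.degree_eq_zero_iff _).1 h, h1, zero_mul]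
    · rw [(Finsupp.degree_eq_zero_iff _).1 h, h2, mul_zero]
  · simp
  · simp [ha, hb]
  · simp [ha]

end

lemma exists_add_single {n : ℕ} {m : Fin n →₀ ℕ} (hm : m ≠ 0) :
    ∃ s m', m = Finsupp.single s 1 + m' := by
  obtain ⟨s, hs⟩ := Finsupp.ne_iff.1 hm
  have hs : m s ≠ 0 := hs
  refine ⟨s, m - Finsupp.single s 1, ?_⟩
  rw [add_tsub_cancel_of_le]
  rw [Finsupp.single_le_iff]
  omega

/-- In odd degree graded commutativity gives `2 x_s² = 0`, which is impossible in a polynomial ring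
over `ZMod p` with `p` odd. -/
lemma even_deg {p : ℕ} [Fact p.Prime] (hp : p ≠ 2) {X : Type u} [TopologicalSpace X]
    {n : ℕ} {deg : Fin n → ℕ} {x : ∀ s : Fin n, ModCohomology p X (deg s)}
    {φ : MvPolynomial (Fin n) (ZMod p) ≃+* CohomologyRing p X}
    (hφ : ∀ s, φ (MvPolynomial.X s) = DirectSum.of (ModCohomology p X) (deg s) (x s)) (s : Fin n)
    (hs : deg s ≠ 0) : Even (deg s) := by
  by_contra h
  rw [Nat.not_even_iff_odd] at h
  have h1 := cupH_comm (R := ZMod p) rfl rfl hs hs (x s) (x s)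
  rw [(h.mul h).neg_one_pow, neg_smul, one_smul] at h1
  have h2 : φ (MvPolynomial.X s * MvPolynomial.X s + MvPolynomial.X s * MvPolynomial.X s) = 0 := by
    rw [map_add, map_mul, hφ, of_mul_of rfl, ← map_add]
    nth_rewrite 1 [h1]
    rw [neg_add_cancel, map_zero]
  rw [map_eq_zero_iff _ φ.injective, ← two_mul, MvPolynomial.X, monomial_mul] at h2
  have h3 := congrArg (coeff (Finsupp.single s 1 + Finsupp.single s 1)) h2
  have h4 : (2 : MvPolynomial (Fin n) (ZMod p)) = C 2 := (map_ofNat C 2).symm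
  rw [h4, coeff_C_mul, coeff_monomial, if_pos rfl, coeff_zero, mul_one, mul_one] at h3
  have : Fact (2 < p) := ⟨lt_of_le_of_ne (Fact.out : p.Prime).two_le (Ne.symm hp)⟩
  have h5 : ((2 : ℕ) : ZMod p) = 0 := by exact_mod_cast h3
  rw [ZMod.natCast_eq_zero_iff] at h5
  have := Nat.le_of_dvd (by norm_num) h5
  have := (Fact.out : 2 < p)
  omega

/-- A map on a product whose restrictions to the factors detect `x i` and `x j` detects
decomposable polynomials containing the monomial `x i * x j`. -/
theorem pullback_ne_zero {p : ℕ} [Fact p.Prime] (hp : p ≠ 2) {X : Type u} [TopologicalSpace X]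
    [PathConnectedSpace X] {n : ℕ} {deg : Fin n → ℕ} (hdeg : deg.Injective)
    {x : ∀ s : Fin n, ModCohomology p X (deg s)}
    {φ : MvPolynomial (Fin n) (ZMod p) ≃+* CohomologyRing p X}
    (hφ : ∀ s, φ (MvPolynomial.X s) = DirectSum.of (ModCohomology p X) (deg s) (x s))
    {S T : Type u} [TopologicalSpace S] [TopologicalSpace T] {s₀ : S} {t₀ : T}
    (hS : TwoCover S s₀) (hT : TwoCover T t₀) (μ : C(S × T, X)) {i j : Fin n}
    (hi : pullback p (restrictFst μ t₀) (deg i) (x i) ≠ 0)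
    (hj : pullback p (restrictSnd μ s₀) (deg j) (x j) ≠ 0)
    {l : ℕ} {z : ModCohomology p X l}
    (hdec : IsDecomposable (DirectSum.of (ModCohomology p X) l z))
    (hcoeff : coeff (Finsupp.single i 1 + Finsupp.single j 1)
      (φ.symm (DirectSum.of (ModCohomology p X) l z)) ≠ 0) :
    pullback p μ l z ≠ 0 := by
  have hd := deg_ne_zero hφ
  obtain ⟨ψ, hψ, hψ'⟩ := exists_functional (hd i) (hd j) hi hj
  -- `Λ` pulls a polynomial back along `μ` and measures its component in degree `deg i + deg j` by
  -- `ψ`. It is computed monomial by monomial.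
  let Λ : MvPolynomial (Fin n) (ZMod p) →+ ZMod p :=
    { toFun := fun P => ψ (pullbackRing p μ (φ P) (deg i + deg j))
      map_zero' := by simp
      map_add' := by simp }
  have hΛ : ∀ P, Λ P = ψ (pullbackRing p μ (φ P) (deg i + deg j)) := fun P => rfl
  set κ := ψ (cupH _ _ rfl (partFst μ t₀ (x i)) (partSnd μ s₀ (x j))) with hκ
  have hκ0 : κ ≠ 0 := hψ
  have hX : ∀ s, pullbackRing p μ (φ (MvPolynomial.X s)) =
      DirectSum.of (ModCohomology p (S × T)) (deg s) (map (ZMod p) (singMap μ) (deg s) (x s)) :=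
    fun s => by rw [hφ, pullbackRing_of]; rfl
  -- The functional sees only bidegree `(deg i, deg j)`, and since `deg` is injective only the pair
  -- `(i, j)` has it.
  have hE : ∀ s t (h : deg s + deg t = deg i + deg j),
      ψ (cupH _ _ h (partFst μ t₀ (x s)) (partSnd μ s₀ (x t))) =
        if s = i ∧ t = j then κ else 0 := by
    intro s t h
    by_cases hs : s = i
    · subst hs
      obtain rfl : t = j := hdeg (by omega)
      rw [if_pos ⟨rfl, rfl⟩]
    · rw [if_neg (fun h => hs h.1)]
      exact hψ' h (hd s) (hd t) (fun e => hs (hdeg e).symm) _ _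
  have hpair : ∀ s t (h : deg s + deg t = deg i + deg j), Λ (MvPolynomial.X s * MvPolynomial.X t) =
      (if s = i ∧ t = j then κ else 0) +
        (-1) ^ (deg s * deg t) * (if t = i ∧ s = j then κ else 0) := by
    intro s t h
    rw [hΛ, map_mul, map_mul, hX, hX, of_mul_of h, DirectSum.of_eq_same,
      (cup_pullback μ hS hT h (hd s) (hd t) (x s) (x t)).1, map_add, hE,
      cupH_comm h (by omega) (hd s) (hd t), map_smul, hE t s, smul_eq_mul]
  have hpair' : ∀ s t, deg s + deg t ≠ deg i + deg j →
      Λ (MvPolynomial.X s * MvPolynomial.X t) = 0 := by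
    intro s t h
    rw [hΛ, map_mul, map_mul, hX, hX, of_mul_of rfl, DirectSum.of_eq_of_ne _ _ _ (Ne.symm h),
      map_zero]
  have htriple : ∀ s t r Q, Λ (MvPolynomial.X s * MvPolynomial.X t * MvPolynomial.X r * Q) = 0 := by
    intro s t r Q
    rw [hΛ, map_mul, map_mul, map_mul, map_mul, map_mul, map_mul, hX, hX, hX, of_mul_of rfl,
      of_mul_of rfl, (cup_pullback μ hS hT rfl (hd s) (hd t) (x s) (x t)).2 rfl (hd r) (x r),
      map_zero, zero_mul]
    simp
  have hmon : ∀ m : Fin n →₀ ℕ, 2 ≤ m.degree → m ≠ Finsupp.single i 1 + Finsupp.single j 1 →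
      Λ (monomial m 1) = 0 := by
    intro m hm hne
    obtain ⟨s, m, rfl⟩ := exists_add_single (m := m) (by rintro rfl; simp at hm)
    obtain ⟨t, m, rfl⟩ := exists_add_single (m := m) (by rintro rfl; simp at hm)
    by_cases h0 : m = 0
    · subst h0
      rw [add_zero] at hne ⊢
      have e : monomial (Finsupp.single s 1 + Finsupp.single t 1) (1 : ZMod p) =
          MvPolynomial.X s * MvPolynomial.X t := by rw [MvPolynomial.X, MvPolynomial.X, monomial_mul, mul_one]
      rw [e]
      by_cases h : deg s + deg t = deg i + deg j
      · rw [hpair s t h, if_neg (fun h => hne (by rw [h.1, h.2])),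
          if_neg (fun h => hne (by rw [h.1, h.2, add_comm])), mul_zero, add_zero]
      · exact hpair' s t h
    · obtain ⟨r, m, rfl⟩ := exists_add_single h0
      have e : monomial (Finsupp.single s 1 + (Finsupp.single t 1 + (Finsupp.single r 1 + m)))
          (1 : ZMod p) = MvPolynomial.X s * MvPolynomial.X t * MvPolynomial.X r * monomial m 1 := by
        simp only [MvPolynomial.X, monomial_mul, mul_one, add_assoc]
      rw [e, htriple]
  have hij : Λ (monomial (Finsupp.single i 1 + Finsupp.single j 1) 1) ≠ 0 := by
    have e : monomial (Finsupp.single i 1 + Finsupp.single j 1) (1 : ZMod p) =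
        MvPolynomial.X i * MvPolynomial.X j := by rw [MvPolynomial.X, MvPolynomial.X, monomial_mul, mul_one]
    rw [e, hpair i j rfl, if_pos ⟨rfl, rfl⟩]
    -- For `i = j` both cross terms contribute and their signs agree because the degree is even,
    -- whence `2κ`. For `i ≠ j` only one contributes.
    by_cases h : i = j
    · subst h
      rw [if_pos ⟨rfl, rfl⟩, ((even_deg hp hφ i (hd i)).mul_right _).neg_one_pow, one_mul,
        ← two_mul]
      refine mul_ne_zero (fun h => ?_) hκ0
      have h5 : ((2 : ℕ) : ZMod p) = 0 := by exact_mod_cast h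
      rw [ZMod.natCast_eq_zero_iff] at h5
      exact hp ((Nat.prime_dvd_prime_iff_eq Fact.out Nat.prime_two).1 h5)
    · rw [if_neg (fun h' => h h'.2), mul_zero, add_zero]
      exact hκ0
  intro h0
  set P := φ.symm (DirectSum.of (ModCohomology p X) l z) with hP
  have hzero : Λ P = 0 := by
    rw [hΛ, hP, RingEquiv.apply_symm_apply, pullbackRing_of, h0]
    simp
  -- Additive maps between `ZMod p`-modules are linear.
  have hsm : ∀ m c, Λ (monomial m c) = c * Λ (monomial m 1) := fun m c => by
    rw [← smul_eq_mul, ← ZMod.map_smul, smul_monomial, smul_eq_mul, mul_one]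
  rw [P.as_sum, map_sum, Finset.sum_eq_single (Finsupp.single i 1 + Finsupp.single j 1), hsm]
    at hzero
  · exact mul_ne_zero hcoeff hij hzero
  · intro m hm hne
    have hm2 : 2 ≤ m.degree := by
      by_contra h
      exact (mem_support_iff.1 hm) (coeff_of_isDecomposable hφ hdec (by omega))
    rw [hsm, hmon m hm2 hne, mul_zero]
  · intro h
    rw [notMem_support_iff] at h
    exact absurd h hcoeff

end Samelson

/-! ### Neighbourhood deformation structures and homotopy extension -/

/-- A neighbourhood deformation structure on a pair `(Y, P)`, in the form given by Strøm. -/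
structure NDR {Y : Type*} [TopologicalSpace Y] (P : Set Y) where
  /-- The function measuring the distance from the subspace. -/
  u : C(Y, unitInterval)
  /-- The deformation. -/
  H : C(Y × unitInterval, Y)
  H_zero : ∀ y, H (y, 0) = y
  H_mem : ∀ y ∈ P, ∀ τ, H (y, τ) = y
  u_mem : ∀ y ∈ P, u y = 0
  H_end : ∀ y τ, u y ≤ τ → u y < 1 → H (y, τ) ∈ P

namespace NDR

variable {Y Z S T : Type*} [TopologicalSpace Y] [TopologicalSpace Z] [TopologicalSpace S]
  [TopologicalSpace T]

lemma mem_iff {P : Set Y} (N : NDR P) {y : Y} : y ∈ P ↔ N.u y = 0 :=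
  ⟨N.u_mem y, fun h => N.H_zero y ▸ N.H_end y 0 h.le (h ▸ zero_lt_one)⟩

lemma isClosed {P : Set Y} (N : NDR P) : IsClosed P := by
  have : P = N.u ⁻¹' {0} := Set.ext fun y => N.mem_iff
  rw [this]
  exact isClosed_singleton.preimage N.u.continuous

/-- The homotopy extension property. -/
lemma extend {P : Set Y} (N : NDR P) (f : C(Y, Z)) (K : Y × unitInterval → Z)
    (hK : ContinuousOn K (P ×ˢ Set.univ)) (h0 : ∀ y ∈ P, K (y, 0) = f y) :
    ∃ E : C(Y × unitInterval, Z), (∀ y, E (y, 0) = f y) ∧ ∀ y ∈ P, ∀ τ, E (y, τ) = K (y, τ) := by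
  classical
  let D : C(Y × unitInterval, unitInterval) :=
    ⟨fun q => Set.projIcc 0 1 zero_le_one ((q.2 : ℝ) - N.u q.1), by fun_prop⟩
  have hD0 : ∀ q : Y × unitInterval, q.2 ≤ N.u q.1 → D q = 0 := fun q hq =>
    Set.projIcc_of_le_left zero_le_one (sub_nonpos.2 hq)
  -- Until time `u y` the point follows the deformation under `f`. By then it has arrived in `P`,
  -- and `K` runs for the remaining time `τ - u y`.
  let e : Y × unitInterval → Z := fun q =>
    if q.2 ≤ N.u q.1 then f (N.H q) else K (N.H q, D q)
  have e1 : ContinuousOn e {q | q.2 ≤ N.u q.1} :=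
    (f.continuous.comp N.H.continuous).continuousOn.congr fun q hq => if_pos hq
  have e2 : ContinuousOn e {q | N.u q.1 ≤ q.2 ∧ N.H q ∈ P} := by
    have : ContinuousOn (fun q => K (N.H q, D q)) {q | N.u q.1 ≤ q.2 ∧ N.H q ∈ P} :=
      hK.comp (f := fun q => (N.H q, D q)) (by fun_prop) fun q hq => ⟨hq.2, Set.mem_univ _⟩
    refine this.congr fun q hq => ?_
    by_cases h : q.2 ≤ N.u q.1
    · simp only [e, if_pos h, hD0 q h, h0 _ hq.2]
    · simp only [e, if_neg h]
  have hc : Continuous e := by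
    rw [← continuousOn_univ]
    refine (e1.union_of_isClosed e2 (isClosed_le (by fun_prop) (by fun_prop))
      ((isClosed_le (by fun_prop) (by fun_prop)).inter
        (N.isClosed.preimage N.H.continuous))).mono fun q _ => ?_
    rcases le_or_gt q.2 (N.u q.1) with h | h
    · exact Or.inl h
    · exact Or.inr ⟨h.le, N.H_end q.1 q.2 h.le (h.trans_le unitInterval.le_one')⟩
  refine ⟨⟨e, hc⟩, fun y => ?_, fun y hy τ => ?_⟩
  · change e _ = _
    simp only [e, if_pos (show (0 : unitInterval) ≤ N.u y from unitInterval.nonneg'), N.H_zero]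
  · change e _ = _
    have hd : D (y, τ) = τ := by
      simp only [D, ContinuousMap.coe_mk, N.u_mem y hy]
      simp
    by_cases h : τ ≤ N.u y
    · have h' : τ = 0 := le_antisymm (N.u_mem y hy ▸ h) unitInterval.nonneg'
      subst h'
      simp only [e, if_pos h, N.H_zero, h0 y hy]
    · simp only [e, if_neg h, N.H_mem y hy, hd]

/-- The product of two neighbourhood deformation retract pairs. -/
def prod {P : Set S} {Q : Set T} (N : NDR P) (M : NDR Q) :
    NDR {q : S × T | q.1 ∈ P ∨ q.2 ∈ Q} where
  u := ⟨fun q => min (N.u q.1) (M.u q.2), by fun_prop⟩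
  -- Each coordinate is stopped at the height of the other. The lower one thus has time to arrive in
  -- its subspace, and a coordinate does not move when the other already lies in its subspace.
  H := ⟨fun q => (N.H (q.1.1, min q.2 (M.u q.1.2)), M.H (q.1.2, min q.2 (N.u q.1.1))),
    by fun_prop⟩
  H_zero q := by
    change (N.H (q.1, min 0 _), M.H (q.2, min 0 _)) = q
    rw [min_eq_left unitInterval.nonneg', min_eq_left unitInterval.nonneg', N.H_zero, M.H_zero]
  H_mem q hq τ := by
    change (N.H (q.1, min τ _), M.H (q.2, min τ _)) = q
    rcases hq with hq | hq
    · rw [N.H_mem _ hq, N.u_mem _ hq, min_eq_right unitInterval.nonneg', M.H_zero]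
    · rw [M.H_mem _ hq, M.u_mem _ hq, min_eq_right unitInterval.nonneg', N.H_zero]
  u_mem q hq := by
    change min (N.u q.1) (M.u q.2) = 0
    rcases hq with hq | hq
    · rw [N.u_mem _ hq, min_eq_left unitInterval.nonneg']
    · rw [M.u_mem _ hq, min_eq_right unitInterval.nonneg']
  H_end q τ h1 h2 := by
    change min (N.u q.1) (M.u q.2) ≤ τ at h1
    change min (N.u q.1) (M.u q.2) < 1 at h2
    change N.H (q.1, min τ (M.u q.2)) ∈ P ∨ M.H (q.2, min τ (N.u q.1)) ∈ Q
    rcases le_total (N.u q.1) (M.u q.2) with h | h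
    · rw [min_eq_left h] at h1 h2
      exact Or.inl (N.H_end _ _ (le_min h1 h) h2)
    · rw [min_eq_right h] at h1 h2
      exact Or.inr (M.H_end _ _ (le_min h1 h) h2)

/-- The endpoints of the unit interval. -/
def interval : NDR {t : unitInterval | t = 0 ∨ t = 1} where
  u := ⟨fun t => Set.projIcc 0 1 zero_le_one (4 * min (t : ℝ) (1 - t)), by fun_prop⟩
  -- Stretching about the midpoint by `1 + τ` sends `t` to `t(1 + τ) - τ/2`, which is at most `0` as
  -- soon as `4t ≤ τ`; this explains the factor in `u`.
  H := ⟨fun q => Set.projIcc 0 1 zero_le_one (1 / 2 + ((q.1 : ℝ) - 1 / 2) * (1 + q.2)),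
    by fun_prop⟩
  H_zero t := by
    have : (1 / 2 + ((t : ℝ) - 1 / 2) * (1 + ((0 : unitInterval) : ℝ))) = t := by simp
    change Set.projIcc 0 1 zero_le_one _ = t
    rw [this, Set.projIcc_val]
  H_mem t ht τ := by
    have h1 := τ.2.1
    rcases ht with rfl | rfl
    · exact Set.projIcc_of_le_left zero_le_one (by simp; linarith)
    · exact Set.projIcc_of_right_le zero_le_one (by simp; linarith)
  u_mem t ht := by
    refine Set.projIcc_of_le_left zero_le_one ?_
    rcases ht with rfl | rfl <;> simp
  H_end t τ h1 h2 := by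
    have h1' : Set.projIcc (0 : ℝ) 1 zero_le_one (4 * min (t : ℝ) (1 - t)) ≤ τ := h1
    have h2' : Set.projIcc (0 : ℝ) 1 zero_le_one (4 * min (t : ℝ) (1 - t)) < 1 := h2
    have hlt : 4 * min (t : ℝ) (1 - t) < 1 := by
      by_contra h
      rw [Set.projIcc_of_right_le zero_le_one (not_lt.1 h)] at h2'
      exact lt_irrefl _ h2'
    have h0 : 0 ≤ 4 * min (t : ℝ) (1 - t) :=
      mul_nonneg (by norm_num) (le_min t.2.1 (by linarith [t.2.2]))
    rw [Set.projIcc_of_mem _ ⟨h0, hlt.le⟩] at h1'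
    have h3 : 4 * min (t : ℝ) (1 - t) ≤ τ := h1'
    have ht := t.2.1
    have ht' := t.2.2
    rcases le_total (t : ℝ) (1 - t) with h | h
    · rw [min_eq_left h] at h3 hlt
      exact Or.inl (Set.projIcc_of_le_left zero_le_one (by nlinarith))
    · rw [min_eq_right h] at h3 hlt
      exact Or.inr (Set.projIcc_of_right_le zero_le_one (by nlinarith))

/-- Homotopies of the restrictions of a map to the axes of a product extend. -/
lemma wedge_extend {s₀ : S} {t₀ : T} (N : NDR {s₀}) (M : NDR {t₀}) (f : C(S × T, Z))
    (K : C(S × unitInterval, Z)) (L : C(T × unitInterval, Z)) (hK : ∀ s, K (s, 0) = f (s, t₀))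
    (hL : ∀ t, L (t, 0) = f (s₀, t)) (hKL : ∀ τ, K (s₀, τ) = L (t₀, τ)) :
    ∃ E : C((S × T) × unitInterval, Z), (∀ q, E (q, 0) = f q) ∧
      (∀ s τ, E ((s, t₀), τ) = K (s, τ)) ∧ ∀ t τ, E ((s₀, t), τ) = L (t, τ) := by
  classical
  let e : (S × T) × unitInterval → Z := fun q =>
    if q.1.2 = t₀ then K (q.1.1, q.2) else L (q.1.2, q.2)
  have e1 : ∀ s τ, e ((s, t₀), τ) = K (s, τ) := fun s τ => if_pos rfl
  have e2 : ∀ t τ, e ((s₀, t), τ) = L (t, τ) := fun t τ => by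
    by_cases h : t = t₀
    · subst h
      rw [e1, hKL]
    · exact if_neg h
  have hc : ContinuousOn e
      ({q : S × T | q.1 ∈ ({s₀} : Set S) ∨ q.2 ∈ ({t₀} : Set T)} ×ˢ Set.univ) := by
    have c1 : ContinuousOn e {q | q.1.1 ∈ ({s₀} : Set S)} :=
      (show Continuous fun q : (S × T) × unitInterval => L (q.1.2, q.2) by fun_prop).continuousOn.congr
        fun q hq => by
          obtain ⟨⟨s, t⟩, τ⟩ := q
          obtain rfl : s = s₀ := hq
          exact e2 t τ
    have c2 : ContinuousOn e {q | q.1.2 ∈ ({t₀} : Set T)} :=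
      (show Continuous fun q : (S × T) × unitInterval => K (q.1.1, q.2) by fun_prop).continuousOn.congr
        fun q hq => if_pos hq
    exact (c1.union_of_isClosed c2 (N.isClosed.preimage (by fun_prop))
      (M.isClosed.preimage (by fun_prop))).mono fun q hq => hq.1
  obtain ⟨E, hE0, hE⟩ := (N.prod M).extend f e hc (by
    rintro ⟨s, t⟩ (h | h)
    · obtain rfl : s = s₀ := h
      rw [e2, hL]
    · obtain rfl : t = t₀ := h
      rw [e1, hK])
  exact ⟨E, hE0, fun s τ => (hE (s, t₀) (Or.inr rfl) τ).trans (e1 s τ),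
    fun t τ => (hE (s₀, t) (Or.inl rfl) τ).trans (e2 t τ)⟩

end NDR

/-! ### Suspensions of well-pointed spaces -/

namespace Samelson

lemma collapse_isQuotientMap {Y : Type u} [TopologicalSpace Y] (P : Set Y) :
    Topology.IsQuotientMap (Quotient.mk (collapseSetoid P)) := isQuotientMap_quot_mk

/-- The neighbourhood deformation structure on a quotient space. -/
def ndrCollapse {Y : Type u} [TopologicalSpace Y] {P : Set Y} (N : NDR P) {y₀ : Y} (h₀ : y₀ ∈ P) :
    NDR ({Quotient.mk (collapseSetoid P) y₀} : Set (Collapse P)) where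
  u := ⟨Quotient.lift N.u fun y z h => by
      rcases h with rfl | ⟨hy, hz⟩
      · rfl
      · rw [N.u_mem y hy, N.u_mem z hz], N.u.continuous.quotient_lift _⟩
  H := ⟨fun q => Quotient.lift (fun y => (Quotient.mk (collapseSetoid P) (N.H (y, q.2))))
      (fun y z h => by
        rcases h with rfl | ⟨hy, hz⟩
        · rfl
        · exact Quotient.sound (Or.inr ⟨(N.H_mem y hy q.2).symm ▸ hy,
            (N.H_mem z hz q.2).symm ▸ hz⟩)) q.1, by
    refine (collapse_isQuotientMap P).continuous_lift_prod_left ?_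
    exact continuous_quot_mk.comp N.H.continuous⟩
  H_zero y := by
    induction y using Quotient.inductionOn with
    | h y => exact congrArg _ (N.H_zero y)
  H_mem y hy τ := by
    obtain rfl := hy
    exact congrArg _ (N.H_mem y₀ h₀ τ)
  u_mem y hy := by
    obtain rfl := hy
    exact N.u_mem y₀ h₀
  H_end y τ h1 h2 := by
    induction y using Quotient.inductionOn with
    | h y => exact Quotient.sound (Or.inr ⟨N.H_end y τ h1 h2, h₀⟩)

/-- The suspension of a well-pointed space is well-pointed. -/
def ndrSusp {A : Type u} [TopologicalSpace A] {a₀ : A} (N : NDR {a₀}) : NDR {Susp.base a₀} :=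
  ndrCollapse (N.prod NDR.interval) (Or.inl rfl)

open SSetCohomology in
/-- The suspension of a well-pointed space is covered by two contractible open subsets. -/
lemma twoCover_susp {A : Type u} [TopologicalSpace A] {a₀ : A} (N : NDR {a₀}) :
    TwoCover (Susp a₀) (Susp.base a₀) := by
  let M := ndrSusp N
  let q : A × unitInterval → Susp a₀ := fun x => Susp.mk a₀ x.1 x.2
  have hq : Topology.IsQuotientMap q := collapse_isQuotientMap _
  let U : Set (Susp a₀) := {Susp.base a₀}ᶜ
  have hU : IsOpen U := M.isClosed.isOpen_compl
  have hqU := hq.restrictPreimage_isOpen hU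
  have key : ∀ x y : A × unitInterval, q x ∈ U → q x = q y → x = y := fun x y hx h => by
    rcases Quotient.exact h with h | ⟨h, _⟩
    · exact h
    · exact absurd (Susp.mk_eq_base h) hx
  refine ⟨U, {s | M.u s < 1}, hU, isOpen_lt M.u.continuous continuous_const, ?_, ?_, ?_⟩
  · refine Set.eq_univ_of_forall fun s => ?_
    by_cases h : s = Susp.base a₀
    · refine Or.inr ?_
      change M.u s < 1
      rw [M.u_mem s h]
      exact zero_lt_one
    · exact Or.inl h
  · refine ⟨{
      -- Away from the base point the pair `(a, t)` is uniquely determined, so `U` contracts by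
      -- shrinking the suspension coordinate to `0`. The other open set contracts by the deformation
      -- `M.H`.
      toFun := fun x => Susp.mk a₀ x.2.1.out.1 (unitInterval.symm x.1 * x.2.1.out.2)
      continuous_toFun := ?_
      map_zero_left := fun s => ?_
      map_one_left := fun s => ?_ }⟩
    · refine hqU.continuous_lift_prod_right ?_
      have : ∀ x : unitInterval × (q ⁻¹' U), Susp.mk a₀ ((U.restrictPreimage q x.2).1.out.1)
          (unitInterval.symm x.1 * (U.restrictPreimage q x.2).1.out.2) =
          Susp.mk a₀ x.2.1.1 (unitInterval.symm x.1 * x.2.1.2) := fun x => by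
        have := key x.2.1 (q x.2.1).out x.2.2 (Quotient.out_eq _).symm
        change Susp.mk a₀ (q x.2.1).out.1 (unitInterval.symm x.1 * (q x.2.1).out.2) = _
        rw [← this]
      refine Continuous.congr ?_ fun x => (this x).symm
      exact (Susp.continuous_mk a₀).comp (by fun_prop : Continuous
        fun x : unitInterval × (q ⁻¹' U) => (x.2.1.1, unitInterval.symm x.1 * x.2.1.2))
    · simp only [unitInterval.symm_zero, one_mul]
      exact Quotient.out_eq s.1
    · simp only [unitInterval.symm_one, zero_mul]
      exact Susp.mk_eq_base (Or.inr (Or.inl rfl))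
  · refine ⟨{
      toFun := fun x => M.H (x.2.1, x.1)
      continuous_toFun := by fun_prop
      map_zero_left := fun s => M.H_zero s.1
      map_one_left := fun s => M.H_end s.1 1 unitInterval.le_one' s.2 }⟩

end Samelson

/-! ### Vertices of finite-dimensional CW complexes are well-placed base points -/

open Topology

section

variable {E W : Type*} [NormedAddCommGroup E] [NormedSpace ℝ E] [TopologicalSpace W]

/-- The homotopy extension property of the closed unit ball relative to its boundary. -/
lemma exists_extend_closedBall (f : E → W) (hf : ContinuousOn f (Metric.closedBall 0 1))
    (g : E → C(unitInterval, W)) (hg : ContinuousOn g (Metric.sphere 0 1))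
    (h0 : ∀ x ∈ Metric.sphere (0 : E) 1, g x 0 = f x) :
    ∃ G : E → C(unitInterval, W), ContinuousOn G (Metric.closedBall 0 1) ∧
      (∀ x ∈ Metric.sphere (0 : E) 1, G x = g x) ∧ (∀ x ∈ Metric.closedBall (0 : E) 1, G x 0 = f x) ∧
      ∀ x ∈ Metric.closedBall (0 : E) 1, ∀ τ,
        (∃ y ∈ Metric.closedBall (0 : E) 1, G x τ = f y) ∨
          ∃ y ∈ Metric.sphere (0 : E) 1, ∃ σ, G x τ = g y σ := by
  classical
  let X := Metric.closedBall (0 : E) 1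
  have hX : ∀ x : X, ‖x.1‖ ≤ 1 := fun x => mem_closedBall_zero_iff.1 x.2
  -- Radial projection of the cylinder from the point `(0, 2)`: it meets the bottom in `a q` if `‖x‖
  -- ≤ 1 - τ/2`, and otherwise the side in `b q` at height `s q`.
  let a : X × unitInterval → E := fun q => (2 / (2 - (q.2 : ℝ))) • q.1.1
  let b : X × unitInterval → E := fun q => ‖q.1.1‖⁻¹ • q.1.1
  let s : X × unitInterval → unitInterval := fun q =>
    Set.projIcc 0 1 zero_le_one (2 - (2 - (q.2 : ℝ)) / ‖q.1.1‖)
  have hpos : ∀ q : X × unitInterval, 0 < 2 - (q.2 : ℝ) := fun q => by linarith [q.2.2.2]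
  have ha : ∀ q : X × unitInterval, ‖q.1.1‖ ≤ 1 - q.2 / 2 → a q ∈ Metric.closedBall (0 : E) 1 := by
    intro q hq
    rw [mem_closedBall_zero_iff, norm_smul, Real.norm_of_nonneg (by have := hpos q; positivity),
      div_mul_eq_mul_div, div_le_one (hpos q)]
    linarith
  have hne : ∀ q : X × unitInterval, 1 - q.2 / 2 ≤ ‖q.1.1‖ → ‖q.1.1‖ ≠ 0 := fun q hq => by
    have := hpos q
    intro h
    linarith
  have hb : ∀ q : X × unitInterval, 1 - q.2 / 2 ≤ ‖q.1.1‖ → b q ∈ Metric.sphere (0 : E) 1 := by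
    intro q hq
    rw [mem_sphere_zero_iff_norm, norm_smul, norm_inv, norm_norm, inv_mul_cancel₀ (hne q hq)]
  let h : X × unitInterval → W := fun q =>
    if ‖q.1.1‖ ≤ 1 - q.2 / 2 then f (a q) else g (b q) (s q)
  have hs1 : ∀ q : X × unitInterval, ‖q.1.1‖ = 1 → s q = q.2 := fun q hq => by
    simp only [s, hq]
    rw [show (2 - (2 - (q.2 : ℝ)) / 1) = q.2 by ring, Set.projIcc_val]
  have c1 : ContinuousOn h {q | ‖q.1.1‖ ≤ 1 - q.2 / 2} := by
    refine (hf.comp (f := a) ?_ ha).congr fun q hq => if_pos hq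
    exact (Continuous.smul (Continuous.div continuous_const (by fun_prop)
      fun q => (hpos q).ne') (by fun_prop)).continuousOn
  have c2 : ContinuousOn h {q | 1 - q.2 / 2 ≤ ‖q.1.1‖} := by
    have : ContinuousOn (fun q => g (b q) (s q)) {q : X × unitInterval | 1 - q.2 / 2 ≤ ‖q.1.1‖} := by
      have hn : ContinuousOn (fun q : X × unitInterval => ‖q.1.1‖) {q | 1 - q.2 / 2 ≤ ‖q.1.1‖} :=
        by fun_prop
      refine (hg.comp (f := b) ((hn.inv₀ hne).smul (by fun_prop)) hb).eval ?_
      exact continuous_projIcc.comp_continuousOn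
        (continuousOn_const.sub (ContinuousOn.div (by fun_prop) hn hne))
    refine this.congr fun q hq => ?_
    by_cases hq' : ‖q.1.1‖ ≤ 1 - q.2 / 2
    · have e : ‖q.1.1‖ = 1 - q.2 / 2 := le_antisymm hq' hq
      have hs : s q = 0 := by
        refine Set.projIcc_of_le_left _ ?_
        rw [e, show (2 - (q.2 : ℝ)) = 2 * (1 - q.2 / 2) by ring, mul_div_assoc,
          div_self (e ▸ hne q hq)]
        norm_num
      have hab : a q = b q := by
        simp only [a, b, e]
        congr 1
        have := hpos q
        have h2 : (1 - (q.2 : ℝ) / 2) ≠ 0 := e ▸ hne q hq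
        field_simp
      simp only [h, if_pos hq', hs]
      rw [h0 _ (hb q hq), hab]
    · simp only [h, if_neg hq']
  have hc : Continuous h := by
    rw [← continuousOn_univ]
    refine (c1.union_of_isClosed c2 (isClosed_le (by fun_prop) (by fun_prop))
      (isClosed_le (by fun_prop) (by fun_prop))).mono fun q _ =>
      (le_total ‖q.1.1‖ (1 - (q.2 : ℝ) / 2) : _ ∨ _)
  let G' : C(X, C(unitInterval, W)) := ContinuousMap.curry ⟨h, hc⟩
  have hG' : ∀ x τ, G' x τ = h (x, τ) := fun _ _ => rfl
  let G : E → C(unitInterval, W) := fun x => if hx : x ∈ X then G' ⟨x, hx⟩ else g x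
  have hG : ∀ x (hx : x ∈ X) τ, G x τ = h (⟨x, hx⟩, τ) := fun x hx τ => by
    simp only [G, dif_pos hx, hG']
  refine ⟨G, ?_, fun x hx => ?_, fun x hx => ?_, fun x hx τ => ?_⟩
  · rw [continuousOn_iff_continuous_domRestrict]
    refine G'.continuous.congr fun x => ?_
    have e : G x.1 = G' ⟨x.1, x.2⟩ := dif_pos x.2
    exact e.symm
  · have hx' : x ∈ X := Metric.sphere_subset_closedBall hx
    have hx1 : ‖x‖ = 1 := mem_sphere_zero_iff_norm.1 hx
    ext τ
    rw [hG x hx']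
    by_cases hτ : ‖x‖ ≤ 1 - (τ : ℝ) / 2
    · have : τ = 0 := le_antisymm (by
        have : (τ : ℝ) ≤ 0 := by linarith
        exact this) unitInterval.nonneg'
      subst this
      simp only [h, if_pos hτ, a]
      rw [h0 x hx]
      simp
    · simp only [h, if_neg hτ]
      rw [hs1 _ hx1]
      simp only [b, hx1, inv_one, one_smul]
  · rw [hG x hx]
    have : ‖x‖ ≤ 1 - ((0 : unitInterval) : ℝ) / 2 := by
      simpa using hX ⟨x, hx⟩
    simp only [h, if_pos this, a]
    simp
  · rw [hG x hx]
    by_cases hτ : ‖x‖ ≤ 1 - (τ : ℝ) / 2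
    · exact Or.inl ⟨_, ha (⟨x, hx⟩, τ) hτ, if_pos hτ⟩
    · exact Or.inr ⟨_, hb (⟨x, hx⟩, τ) (not_le.1 hτ).le, _, if_neg hτ⟩

end

namespace CWRetraction

open RelCWComplex

variable {A : Type u} [TopologicalSpace A] [T2Space A] [CWComplex (Set.univ : Set A)]

/-- A continuous function on the closed ball lying over the characteristic map of a cell is
continuous on the closed cell. -/
lemma continuousOn_closedCell {W : Type*} [TopologicalSpace W] {n : ℕ}
    (e : cell (Set.univ : Set A) n) {F : A → W}
    (h : ContinuousOn (F ∘ map n e) (Metric.closedBall 0 1)) : ContinuousOn F (closedCell n e) := by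
  let q : Metric.closedBall (0 : Fin n → ℝ) 1 → closedCell n e := fun x =>
    ⟨map n e x.1, Set.mem_image_of_mem _ x.2⟩
  have hq : Continuous q :=
    (continuousOn_iff_continuous_domRestrict.1 (continuousOn n e)).subtype_mk _
  have hs : Function.Surjective q := by
    rintro ⟨_, x, hx, rfl⟩
    exact ⟨⟨x, hx⟩, rfl⟩
  have : CompactSpace (Metric.closedBall (0 : Fin n → ℝ) 1) :=
    isCompact_iff_compactSpace.1 (isCompact_closedBall _ _)
  have hQ : IsQuotientMap q := hq.isClosedMap.isQuotientMap hq hs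
  rw [continuousOn_iff_continuous_domRestrict, hQ.continuous_iff]
  exact continuousOn_iff_continuous_domRestrict.1 h

/-- Closure finiteness: the frontier lies in finitely many closed cells of lower dimension, and
continuity on finitely many closed sets passes to their union. -/
lemma continuousOn_cellFrontier {W : Type*} [TopologicalSpace W] {n : ℕ}
    (e : cell (Set.univ : Set A) n) {F : A → W}
    (h : ∀ m < n, ∀ j : cell (Set.univ : Set A) m, ContinuousOn F (closedCell m j)) :
    ContinuousOn F (cellFrontier n e) := by
  obtain ⟨I, hI⟩ := CWComplex.cellFrontier_subset_finite_closedCell n e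
  have key := (locallyFinite_of_finite
    (fun i : Σ m : Fin n, I m => closedCell i.1.1 i.2.1)).continuousOn_iUnion (g := F)
    (fun i => isClosed_closedCell) fun i => h _ i.1.2 _
  refine key.mono fun a ha => ?_
  obtain ⟨m, hm, j, hj, haj⟩ : ∃ m, ∃ (_ : m < n), ∃ j, ∃ (_ : j ∈ I m), a ∈ closedCell m j := by
    simpa using hI ha
  exact Set.mem_iUnion.2 ⟨⟨⟨m, hm⟩, j, hj⟩, haj⟩

/-- The weak topology: a set is closed when its trace on every closed cell is closed. -/
lemma continuous_of_closedCell {W : Type*} [TopologicalSpace W] {F : A → W}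
    (h : ∀ m, ∀ j : cell (Set.univ : Set A) m, ContinuousOn F (closedCell m j)) :
    Continuous F := by
  refine continuous_iff_isClosed.2 fun K hK => ?_
  rw [CWComplex.closed Set.univ _ (Set.subset_univ _)]
  intro m j
  rw [Set.inter_comm]
  exact (h m j).preimage_isClosed_of_isClosed isClosed_closedCell hK

/-- Extension of a function over the `n`-cells of a complex. -/
lemma exists_extend_cells {W : Type*} [TopologicalSpace W] {n : ℕ} (F : A → W)
    (G : cell (Set.univ : Set A) n → (Fin n → ℝ) → W)
    (hG : ∀ e, ContinuousOn (G e) (Metric.closedBall 0 1))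
    (hGF : ∀ e, ∀ x ∈ Metric.sphere (0 : Fin n → ℝ) 1, G e x = F (map n e x)) :
    ∃ F' : A → W, (∀ a ∈ skeletonLT (Set.univ : Set A) n, F' a = F a) ∧
      (∀ e : cell (Set.univ : Set A) n, ContinuousOn F' (closedCell n e)) ∧
      ∀ a, F' a = F a ∨ ∃ e : cell (Set.univ : Set A) n, ∃ x ∈ Metric.closedBall (0 : Fin n → ℝ) 1, a = map n e x ∧ F' a = G e x := by
  classical
  let F' : A → W := fun a => if h : ∃ e : cell (Set.univ : Set A) n, a ∈ openCell n e then G h.choose ((map n h.choose).symm a)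
    else F a
  have h1 : ∀ a ∈ skeletonLT (Set.univ : Set A) n, F' a = F a := fun a ha => by
    refine dif_neg ?_
    rintro ⟨e, he⟩
    exact Set.disjoint_left.1 (disjoint_skeletonLT_openCell le_rfl) ha he
  have h2 : ∀ e, ∀ x ∈ Metric.ball (0 : Fin n → ℝ) 1, F' (map n e x) = G e x := fun e x hx => by
    have hm : map n e x ∈ openCell n e := Set.mem_image_of_mem _ hx
    have h : ∃ e' : cell (Set.univ : Set A) n, map n e x ∈ openCell n e' := ⟨e, hm⟩
    have he : h.choose = e := by
      by_contra hne
      refine Set.disjoint_left.1 (disjoint_openCell_of_ne (i := h.choose) (j := e) ?_)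
        h.choose_spec hm
      intro h'
      exact hne (by simpa using h')
    simp only [F', dif_pos h, he]
    rw [(map n e).left_inv (by rwa [source_eq])]
  have h3 : ∀ e, ∀ x ∈ Metric.closedBall (0 : Fin n → ℝ) 1, F' (map n e x) = G e x := by
    intro e x hx
    rcases (mem_closedBall_zero_iff.1 hx).lt_or_eq with h | h
    · exact h2 e x (mem_ball_zero_iff.2 h)
    · have hx' := mem_sphere_zero_iff_norm.2 h
      rw [hGF e x hx', h1]
      exact cellFrontier_subset_skeletonLT n e (Set.mem_image_of_mem _ hx')
  refine ⟨F', h1, fun e => continuousOn_closedCell e ((hG e).congr fun x hx => h3 e x hx),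
    fun a => ?_⟩
  by_cases h : ∃ e : cell (Set.univ : Set A) n, a ∈ openCell n e
  · obtain ⟨e, x, hx, rfl⟩ := h
    exact Or.inr ⟨e, x, Metric.ball_subset_closedBall hx, rfl, h2 e x hx⟩
  · exact Or.inl (dif_neg h)

lemma mem_skeletonLT_of_isVertex {a₀ : A} (ha₀ : Samelson.IsVertex a₀) {n : ℕ} (hn : n ≠ 0) :
    a₀ ∈ skeletonLT (Set.univ : Set A) n := by
  obtain ⟨v, hv⟩ := ha₀
  have h := openCell_subset_skeletonLT 0 v hv
  exact skeletonLT_mono (n := (n : ℕ∞)) (m := ((0 : ℕ) : ℕ∞) + 1)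
    (by exact_mod_cast Nat.one_le_iff_ne_zero.2 hn) h

/-- Homotopy extension one skeleton at a time. The retraction of the cylinder onto its bottom and
the line over `a₀` is written as a map into `C(unitInterval, A × unitInterval)`, so that continuity
concerns closed cells of `A` alone. At stage `n` cells of higher dimension may still be
discontinuous; the pointwise conditions hold everywhere, and they persist because an extension over
a ball takes only values already present. -/
lemma exists_skeletal_retraction {a₀ : A} (ha₀ : Samelson.IsVertex a₀) (n : ℕ) :
    ∃ F : A → C(unitInterval, A × unitInterval),
      (∀ m ≤ n, ∀ j : cell (Set.univ : Set A) m, ContinuousOn F (closedCell m j)) ∧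
      (∀ a, F a 0 = (a, 0)) ∧ (∀ τ, F a₀ τ = (a₀, τ)) ∧
      ∀ a τ, (F a τ).1 = a₀ ∨ (F a τ).2 = 0 := by
  classical
  induction n with
  | zero =>
    refine ⟨fun a => if a = a₀ then ⟨fun τ => (a₀, τ), by fun_prop⟩ else ContinuousMap.const _ (a, 0),
      fun m hm j => ?_, fun a => ?_, fun τ => by simp, fun a τ => ?_⟩
    · obtain rfl := Nat.le_zero.1 hm
      rw [closedCell_zero_eq_singleton]
      exact continuousOn_singleton _ _
    · by_cases h : a = a₀ <;> simp [h]
    · by_cases h : a = a₀ <;> simp [h]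
  | succ n ih =>
    obtain ⟨F, hc, h0, hb, hr⟩ := ih
    have hF : ∀ e : cell (Set.univ : Set A) (n + 1), ContinuousOn F (cellFrontier (n + 1) e) :=
      fun e => continuousOn_cellFrontier e fun m hm j => hc m (by omega) j
    choose G hG1 hG2 hG3 hG4 using fun e : cell (Set.univ : Set A) (n + 1) =>
      exists_extend_closedBall (fun x => (map (n + 1) e x, (0 : unitInterval)))
        ((continuousOn (n + 1) e).prodMk continuousOn_const) (fun x => F (map (n + 1) e x))
        ((hF e).comp ((continuousOn (n + 1) e).mono Metric.sphere_subset_closedBall)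
          (Set.mapsTo_image _ _)) (fun x _ => h0 _)
    obtain ⟨F', h1, h2, h3⟩ := exists_extend_cells F G hG1 hG2
    refine ⟨F', fun m hm j => ?_, fun a => ?_, fun τ => ?_, fun a τ => ?_⟩
    · rcases Nat.le_succ_iff_eq_or_le.1 hm with rfl | hm'
      · exact h2 j
      · refine (hc m hm' j).congr fun a ha => h1 a ?_
        exact skeletonLT_mono (n := ((n + 1 : ℕ) : ℕ∞)) (m := (m : ℕ∞) + 1)
          (by exact_mod_cast Nat.succ_le_succ hm') (closedCell_subset_skeletonLT m j ha)
    · rcases h3 a with h | ⟨e, x, hx, rfl, h⟩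
      · rw [h, h0]
      · rw [h, hG3 e x hx]
    · rw [h1 _ (mem_skeletonLT_of_isVertex ha₀ (Nat.succ_ne_zero n)), hb]
    · rcases h3 a with h | ⟨e, x, hx, rfl, h⟩
      · rw [h]
        exact hr a τ
      · rw [h]
        rcases hG4 e x hx τ with ⟨y, _, hy⟩ | ⟨y, _, σ, hy⟩
        · rw [hy]
          exact Or.inr rfl
        · rw [hy]
          exact hr _ _

end CWRetraction

/-- The neighbourhood deformation structure obtained from a retraction onto the cylinder's end and
a line. -/
lemma exists_ndr_of_retraction {A : Type u} [TopologicalSpace A] [T2Space A] {a₀ : A}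
    (R : C(A × unitInterval, A × unitInterval)) (h0 : ∀ a, R (a, 0) = (a, 0))
    (hb : ∀ τ, R (a₀, τ) = (a₀, τ)) (hr : ∀ q, (R q).1 = a₀ ∨ (R q).2 = 0) :
    Nonempty (NDR ({a₀} : Set A)) := by
  -- Strøm's construction: `u` is the largest loss of height `τ - pr₂ R(a, τ)`, and the deformation
  -- is `pr₁ R`.
  let f : A → unitInterval → ℝ := fun a τ => τ - (R (a, τ)).2
  let v : A → ℝ := fun a => sSup (f a '' Set.univ)
  have hv : Continuous v := isCompact_univ.continuous_sSup (by
    change Continuous fun q : A × unitInterval => (q.2 : ℝ) - (R q).2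
    fun_prop)
  have hbd : ∀ a, BddAbove (f a '' Set.univ) := fun a => ⟨1, by
    rintro _ ⟨τ, _, rfl⟩
    have := τ.2.2
    have := (R (a, τ)).2.2.1
    simp only [f]
    linarith⟩
  have hle : ∀ a τ, f a τ ≤ v a := fun a τ => le_csSup (hbd a) ⟨τ, trivial, rfl⟩
  have hv0 : ∀ a, 0 ≤ v a := fun a => by
    have := hle a 0
    simp only [f, h0] at this
    simpa using this
  have hv1 : ∀ a, v a ≤ 1 := fun a => csSup_le ⟨_, 0, trivial, rfl⟩ (by
    rintro _ ⟨τ, _, rfl⟩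
    have := τ.2.2
    have := (R (a, τ)).2.2.1
    simp only [f]
    linarith)
  refine ⟨{
    u := ⟨fun a => ⟨v a, hv0 a, hv1 a⟩, hv.subtype_mk _⟩
    H := ⟨fun q => (R q).1, by fun_prop⟩
    H_zero := fun a => by
      change (R (a, 0)).1 = a
      rw [h0]
    H_mem := fun a ha τ => by
      obtain rfl := ha
      change (R (_, τ)).1 = _
      rw [hb]
    u_mem := fun a ha => by
      obtain rfl := ha
      refine Subtype.ext (le_antisymm (csSup_le ⟨_, 0, trivial, rfl⟩ ?_) (hv0 _))
      rintro _ ⟨τ, _, rfl⟩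
      simp [f, hb]
    H_end := fun a τ h1 h2 => ?_ }⟩
  change v a ≤ τ at h1
  change v a < 1 at h2
  change (R (a, τ)).1 = a₀
  have key : ∀ σ : unitInterval, v a < σ → (R (a, σ)).1 = a₀ := fun σ hσ => by
    refine (hr (a, σ)).resolve_right fun h => ?_
    have := hle a σ
    simp only [f, h, Set.Icc.coe_zero] at this
    linarith
  -- Beyond time `v a` the height of `R` is positive, so its first coordinate is `a₀`. The case of
  -- equality follows by closure, and `v a < 1` ensures that there are later times.
  have hcl : τ ∈ closure {σ : unitInterval | v a < σ} := by
    rcases h1.lt_or_eq with h | h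
    · exact subset_closure h
    · have hτ : τ < 1 := by
        rw [← Subtype.coe_lt_coe, ← h]
        exact h2
      have hτ' : (Set.Ioi τ).Nonempty := ⟨1, hτ⟩
      have hset : {σ : unitInterval | v a < σ} = Set.Ioi τ := by
        ext σ
        rw [Set.mem_ofPred_eq, h, Set.mem_Ioi, Subtype.coe_lt_coe]
      rw [hset, closure_Ioi' hτ']
      exact Set.self_mem_Ici
  have hclosed : IsClosed {σ : unitInterval | (R (a, σ)).1 = a₀} :=
    isClosed_eq (by fun_prop) continuous_const
  exact closure_minimal key hclosed hcl

/-- A vertex of a finite-dimensional CW complex is a well-placed base point. -/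
theorem Samelson.exists_ndr {A : Type u} [TopologicalSpace A] [T2Space A]
    [CWComplex (Set.univ : Set A)] {a₀ : A} (ha₀ : IsVertex a₀) {n : ℕ} (hA : HasCWDimension A n) :
    Nonempty (NDR ({a₀} : Set A)) := by
  obtain ⟨F, hc, h0, hb, hr⟩ := CWRetraction.exists_skeletal_retraction ha₀ n
  have hF : Continuous F := CWRetraction.continuous_of_closedCell fun m j => by
    -- Finite dimension enters here: stage `n` already covers all cells.
    refine hc m ?_ j
    by_contra h
    exact (hA.2 m (not_le.1 h)).elim j
  exact exists_ndr_of_retraction (ContinuousMap.uncurry ⟨F, hF⟩) h0 hb fun q => hr q.1 q.2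

/-! ### Families of loops up to homotopy -/

namespace LoopMap

open ContinuousMap unitInterval

variable {Q X : Type*} [TopologicalSpace Q] [TopologicalSpace X] {x₀ : X}

/-- The pointwise concatenation of two families of loops. -/
def mul (f g : C(Q, Path x₀ x₀)) : C(Q, Path x₀ x₀) :=
  ⟨fun q => (f q).trans (g q), f.continuous.path_trans g.continuous⟩

/-- The pointwise reversal of a family of loops. -/
def inv (f : C(Q, Path x₀ x₀)) : C(Q, Path x₀ x₀) :=
  ⟨fun q => (f q).symm, Path.continuous_symm.comp f.continuous⟩

/-- The constant family of loops. -/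
abbrev one (Q : Type*) [TopologicalSpace Q] (x₀ : X) : C(Q, Path x₀ x₀) :=
  ContinuousMap.const Q (Path.refl x₀)

lemma mul_congr {f f' g g' : C(Q, Path x₀ x₀)} (hf : f.Homotopic f') (hg : g.Homotopic g') :
    (mul f g).Homotopic (mul f' g') :=
  Homotopic.comp (Homotopic.refl (⟨fun ρ => ρ.1.trans ρ.2, Path.continuous_trans⟩ :
    C(Path x₀ x₀ × Path x₀ x₀, Path x₀ x₀))) (hf.prodMk hg)

lemma one_mul_homotopic (f : C(Q, Path x₀ x₀)) : (mul (one Q x₀) f).Homotopic f :=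
  ⟨{
    toFun := fun p => Path.delayReflLeft p.1 (f p.2)
    continuous_toFun := Path.continuous_delayReflLeft.comp
      (continuous_fst.prodMk (f.continuous.comp continuous_snd))
    map_zero_left := fun _ => Path.delayReflLeft_zero _
    map_one_left := fun _ => Path.delayReflLeft_one _ }⟩

lemma apply_of_end (γ : Path x₀ x₀) {t : unitInterval} (h : t = 0 ∨ t = 1) : γ t = x₀ := by
  rcases h with rfl | rfl
  · exact γ.source
  · exact γ.target

/-- A family of reparametrizations of a family of loops. -/
def reparam (f : C(Q, Path x₀ x₀)) (ρ : C(unitInterval × unitInterval, unitInterval))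
    (h0 : ∀ s, ρ (s, 0) = 0 ∨ ρ (s, 0) = 1) (h1 : ∀ s, ρ (s, 1) = 0 ∨ ρ (s, 1) = 1) :
    C(unitInterval × Q, Path x₀ x₀) where
  toFun p :=
    { toFun := fun t => f p.2 (ρ (p.1, t))
      continuous_toFun := by fun_prop
      source' := apply_of_end _ (h0 p.1)
      target' := apply_of_end _ (h1 p.1) }
  continuous_toFun := by
    refine Path.continuous_uncurry_iff.1 ?_
    have : Continuous fun p : (unitInterval × Q) × unitInterval => (f p.1.2) (ρ (p.1.1, p.2)) := by
      fun_prop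
    exact this

/-- The truncation of a real number to the unit interval. -/
abbrev clamp (r : ℝ) : unitInterval := Set.projIcc 0 1 zero_le_one r

lemma clamp_of_le {r : ℝ} (h : r ≤ 0) : clamp r = 0 := Set.projIcc_of_le_left _ h

lemma clamp_of_ge {r : ℝ} (h : 1 ≤ r) : clamp r = 1 := Set.projIcc_of_right_le _ h

lemma clamp_eq {r : ℝ} {t : unitInterval} (h : r = t) : clamp r = t := by
  rw [h]
  exact Set.projIcc_val _ t

/-- Multiplication with the reverse of `g` and then with `g` is homotopic to the identity. -/
lemma mul_inv_mul_homotopic (f g : C(Q, Path x₀ x₀)) : (mul (mul f (inv g)) g).Homotopic f := by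
  -- The argument of `g` falls from `1` to `0` on `[1/4, 1/2]` and returns to `1` on `[1/2, 1]`.
  -- Cutting it off below at `s` removes the excursion as `s` grows to `1`.
  let a : unitInterval → ℝ → unitInterval := fun s t => clamp (max (max (2 - 4 * t) (2 * t - 1)) s)
  let F : unitInterval × Q → unitInterval → X := fun p t =>
    if (t : ℝ) ≤ 1 / 4 then f p.2 (clamp (4 * (t : ℝ))) else g p.2 (a p.1 t)
  have hF : Continuous (Function.uncurry F) := by
    refine Continuous.if_le (by fun_prop) (by fun_prop) (by fun_prop) (by fun_prop) ?_
    rintro ⟨p, t⟩ ht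
    have h : (t : ℝ) = 1 / 4 := ht
    have e1 : clamp (4 * (t : ℝ)) = 1 := clamp_of_ge (by rw [h]; norm_num)
    have e2 : a p.1 t = 1 := clamp_of_ge (le_max_of_le_left (le_max_of_le_left (by
      rw [h]; norm_num)))
    change f p.2 (clamp (4 * (t : ℝ))) = g p.2 (a p.1 t)
    rw [e1, e2, Path.target, Path.target]
  -- What remains is `f` run at speed four and then at rest; `ρ` interpolates between this
  -- parametrization and the identity.
  let ρ : C(unitInterval × unitInterval, unitInterval) :=
    ⟨fun p => clamp ((1 - (p.1 : ℝ)) * (4 * p.2) + p.1 * p.2), by fun_prop⟩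
  have hρ0 : ∀ s, ρ (s, 0) = 0 := fun s => clamp_of_le (by simp)
  have hρ1 : ∀ s, ρ (s, 1) = 1 := fun s => clamp_of_ge (by
    have := s.2.2
    simp only [Set.Icc.coe_one]
    linarith)
  have s1 : (mul (mul f (inv g)) g).Homotopic
      ((reparam f ρ (fun s => Or.inl (hρ0 s)) (fun s => Or.inr (hρ1 s))).comp
        ((ContinuousMap.const Q 0).prodMk (ContinuousMap.id Q))) := by
    refine ⟨{
      toFun := fun p =>
        { toFun := F p
          continuous_toFun := hF.comp (Continuous.prodMk_right p)
          source' := ?_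
          target' := ?_ }
      continuous_toFun := Path.continuous_uncurry_iff.1 hF
      map_zero_left := fun q => ?_
      map_one_left := fun q => ?_ }⟩
    · simp only [F]
      rw [if_pos (by simp), clamp_of_le (by simp), Path.source]
    · simp only [F, a]
      rw [if_neg (by simp; norm_num), clamp_of_ge (le_max_of_le_left (le_max_of_le_right (by
        simp; norm_num))), Path.target]
    · ext t
      have h0 := t.2.1
      have h1 := t.2.2
      change F (0, q) t = (((f q).trans (g q).symm).trans (g q)) t
      simp only [F, Path.trans_apply, Path.symm_apply]
      split_ifs with c1 c2 c3 c4 c5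
      · exact congrArg (f q) (clamp_eq (by simp; ring))
      · exfalso; linarith
      · exfalso; linarith
      · exfalso; linarith
      · refine congrArg (g q) (clamp_eq ?_)
        have e : max (max (2 - 4 * (t : ℝ)) (2 * t - 1)) ((0 : unitInterval) : ℝ) = 2 - 4 * t := by
          rw [max_eq_left (a := 2 - 4 * (t : ℝ)) (by linarith), Set.Icc.coe_zero,
            max_eq_left (by linarith)]
        rw [e]
        simp
        ring
      · refine congrArg (g q) (clamp_eq ?_)
        have e : max (max (2 - 4 * (t : ℝ)) (2 * t - 1)) ((0 : unitInterval) : ℝ) = 2 * t - 1 := by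
          rw [max_eq_right (a := 2 - 4 * (t : ℝ)) (by linarith), Set.Icc.coe_zero,
            max_eq_left (by linarith)]
        exact e
    · ext t
      change F (1, q) t = f q (ρ (0, t))
      have e : ρ (0, t) = clamp (4 * (t : ℝ)) := congrArg clamp (by simp)
      rw [e]
      by_cases h : (t : ℝ) ≤ 1 / 4
      · exact if_pos h
      · refine (if_neg h).trans ?_
        have e1 : clamp (4 * (t : ℝ)) = 1 := clamp_of_ge (by linarith)
        have e2 : a 1 t = 1 := clamp_of_ge (le_max_right _ _)
        rw [e1, e2, Path.target, Path.target]
  refine s1.trans ⟨{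
    toContinuousMap := reparam f ρ (fun s => Or.inl (hρ0 s)) (fun s => Or.inr (hρ1 s))
    map_zero_left := fun q => rfl
    map_one_left := fun q => ?_ }⟩
  ext t
  exact congrArg (f q) (clamp_eq (by simp))

/-- Two families of loops with null-homotopic commutator commute up to homotopy. -/
lemma mul_comm_homotopic {f g : C(Q, Path x₀ x₀)}
    (h : (mul (mul (mul f g) (inv f)) (inv g)).Homotopic (one Q x₀)) :
    (mul f g).Homotopic (mul g f) := by
  have h1 : (mul (mul f g) (inv f)).Homotopic g :=
    ((mul_inv_mul_homotopic _ g).symm.trans (mul_congr h (Homotopic.refl g))).trans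
      (one_mul_homotopic g)
  exact (mul_inv_mul_homotopic (mul f g) f).symm.trans (mul_congr h1 (Homotopic.refl f))

end LoopMap

/-! ### Existence of representatives, and commuting loop families -/

namespace Samelson

open ContinuousMap LoopMap

variable {A B X : Type u} [TopologicalSpace A] [TopologicalSpace B] [TopologicalSpace X]
  {a₀ : A} {b₀ : B} {x₀ : X}

/-- The commutator map is pointed homotopic to a map which is constant on the axes. -/
lemma exists_isSamelsonProduct (N : NDR ({a₀} : Set A)) (M : NDR ({b₀} : Set B))
    (α : C(A, Loops x₀)) (β : C(B, Loops x₀)) (hα : α a₀ = Path.refl x₀)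
    (hβ : β b₀ = Path.refl x₀) :
    ∃ γ : C(Smash a₀ b₀, Loops x₀), IsSamelsonProduct α β γ := by
  -- The commutator spends `[0, 1/8]`, `[1/8, 1/4]`, `[1/4, 1/2]`, `[1/2, 1]` on its four factors.
  -- On the axis `b = b₀` it is `α` run to the argument `min (8t) (2 - 4t)`, on the other axis `β`
  -- run to `min (8t - 1) (2 - 2t)`. Scaling these arguments to zero contracts both, and
  -- `wedge_extend` spreads the contractions over `A × B`.
  let ρ : C(unitInterval × unitInterval, unitInterval) :=
    ⟨fun p => unitInterval.symm p.1 * clamp (min (8 * (p.2 : ℝ)) (2 - 4 * p.2)), by fun_prop⟩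
  let σ : C(unitInterval × unitInterval, unitInterval) :=
    ⟨fun p => unitInterval.symm p.1 * clamp (min (8 * (p.2 : ℝ) - 1) (2 - 2 * p.2)), by fun_prop⟩
  have hρ0 : ∀ s, ρ (s, 0) = 0 := fun s => by
    change _ * clamp _ = _
    rw [clamp_of_le (min_le_of_left_le (by simp)), mul_zero]
  have hρ1 : ∀ s, ρ (s, 1) = 0 := fun s => by
    change _ * clamp _ = _
    rw [clamp_of_le (min_le_of_right_le (by simp; norm_num)), mul_zero]
  have hσ0 : ∀ s, σ (s, 0) = 0 := fun s => by
    change _ * clamp _ = _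
    rw [clamp_of_le (min_le_of_left_le (by simp)), mul_zero]
  have hσ1 : ∀ s, σ (s, 1) = 0 := fun s => by
    change _ * clamp _ = _
    rw [clamp_of_le (min_le_of_right_le (by simp)), mul_zero]
  let K := (reparam α ρ (fun s => Or.inl (hρ0 s)) (fun s => Or.inl (hρ1 s))).comp
    (ContinuousMap.prodSwap : C(A × unitInterval, unitInterval × A))
  let L := (reparam β σ (fun s => Or.inl (hσ0 s)) (fun s => Or.inl (hσ1 s))).comp
    (ContinuousMap.prodSwap : C(B × unitInterval, unitInterval × B))
  have hK : ∀ a τ t, K (a, τ) t = α a (ρ (τ, t)) := fun _ _ _ => rfl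
  have hL : ∀ b τ t, L (b, τ) t = β b (σ (τ, t)) := fun _ _ _ => rfl
  have hK1 : ∀ a, K (a, 1) = Path.refl x₀ := fun a => by
    ext t
    rw [hK]
    have : ρ (1, t) = 0 := by
      change unitInterval.symm 1 * _ = _
      rw [unitInterval.symm_one, zero_mul]
    rw [this, Path.source, Path.refl_apply]
  have hL1 : ∀ b, L (b, 1) = Path.refl x₀ := fun b => by
    ext t
    rw [hL]
    have : σ (1, t) = 0 := by
      change unitInterval.symm 1 * _ = _
      rw [unitInterval.symm_one, zero_mul]
    rw [this, Path.source, Path.refl_apply]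
  have hKb : ∀ τ, K (a₀, τ) = Path.refl x₀ := fun τ => by
    ext t
    rw [hK, hα]
    rfl
  have hLb : ∀ τ, L (b₀, τ) = Path.refl x₀ := fun τ => by
    ext t
    rw [hL, hβ]
    rfl
  obtain ⟨E, hE0, hEK, hEL⟩ := NDR.wedge_extend N M (commutatorMap α β) K L (fun a => by
      ext t
      have h0 := t.2.1
      have h1 := t.2.2
      have e : ρ (0, t) = clamp (min (8 * (t : ℝ)) (2 - 4 * t)) := by
        change unitInterval.symm 0 * _ = _
        rw [unitInterval.symm_zero, one_mul]
      rw [hK, e]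
      change _ = ((((α a).trans (β b₀)).trans (α a).symm).trans (β b₀).symm) t
      rw [hβ]
      simp only [Path.trans_apply, Path.symm_apply, Path.refl_apply]
      split_ifs with c1 c2 c3
      · refine congrArg (α a) (clamp_eq ?_)
        rw [min_eq_left (by linarith)]
        simp
        ring
      · refine apply_of_end _ (Or.inr (clamp_of_ge (le_min ?_ ?_))) <;> linarith
      · refine congrArg (α a) (clamp_eq ?_)
        rw [min_eq_right (by linarith)]
        simp
        ring
      · exact apply_of_end _ (Or.inl (clamp_of_le (min_le_of_right_le (by linarith)))))
    (fun b => by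
      ext t
      have h0 := t.2.1
      have h1 := t.2.2
      have e : σ (0, t) = clamp (min (8 * (t : ℝ) - 1) (2 - 2 * t)) := by
        change unitInterval.symm 0 * _ = _
        rw [unitInterval.symm_zero, one_mul]
      rw [hL, e]
      change _ = ((((α a₀).trans (β b)).trans (α a₀).symm).trans (β b).symm) t
      rw [hα]
      simp only [Path.trans_apply, Path.symm_apply, Path.refl_apply]
      split_ifs with c1 c2 c3
      · exact apply_of_end _ (Or.inl (clamp_of_le (min_le_of_left_le (by linarith))))
      · refine congrArg (β b) (clamp_eq ?_)
        rw [min_eq_left (by linarith)]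
        simp
        ring
      · refine apply_of_end _ (Or.inr (clamp_of_ge (le_min ?_ ?_))) <;> linarith
      · refine congrArg (β b) (clamp_eq ?_)
        rw [min_eq_right (by linarith)]
        simp
        ring)
    (fun τ => by rw [hKb, hLb])
  have hE1 : ∀ q : A × B, q.1 = a₀ ∨ q.2 = b₀ → E (q, 1) = Path.refl x₀ := by
    rintro ⟨a, b⟩ (rfl | rfl)
    · rw [hEL, hL1]
    · rw [hEK, hK1]
  refine ⟨⟨Quotient.lift (fun q => E (q, 1)) fun q r h => ?_, ?_⟩, ?_, ?_⟩
  · rcases h with rfl | ⟨hq, hr⟩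
    · rfl
    · rw [hE1 q hq, hE1 r hr]
  · exact Continuous.quotient_lift (by fun_prop) _
  · exact hE1 (a₀, b₀) (Or.inl rfl)
  · refine HomotopicRel.symm ⟨{
      toFun := fun p => E (p.2, p.1)
      continuous_toFun := by fun_prop
      map_zero_left := fun q => hE0 q
      map_one_left := fun q => rfl
      prop' := ?_ }⟩
    rintro τ _ rfl
    change E ((a₀, b₀), τ) = commutatorMap α β (a₀, b₀)
    rw [hEK, hKb, ← hE0, hEK, hKb]

/-- If the Samelson product is null-homotopic, then the two families commute up to homotopy. -/
lemma mul_comm_of_isSamelsonProduct {α : C(A, Loops x₀)} {β : C(B, Loops x₀)}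
    {γ : C(Smash a₀ b₀, Loops x₀)} (h : IsSamelsonProduct α β γ)
    (h0 : γ.HomotopicRel (ContinuousMap.const _ (Path.refl x₀)) {Smash.base a₀ b₀}) :
    (mul (α.comp ContinuousMap.fst) (β.comp ContinuousMap.snd) : C(A × B, Loops x₀)).Homotopic
      (mul (β.comp ContinuousMap.snd) (α.comp ContinuousMap.fst)) := by
  refine mul_comm_homotopic (h.2.homotopic.symm.trans ?_)
  exact Homotopic.comp h0.homotopic (Homotopic.refl (Smash.proj a₀ b₀))

end Samelson

/-! ### From commuting adjoints to a map on the product of suspensions -/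

namespace Samelson

open ContinuousMap LoopMap

section

variable {A : Type u} [TopologicalSpace A] {a₀ : A}

lemma mk_isQuotientMap (a₀ : A) :
    Topology.IsQuotientMap fun x : A × unitInterval => Susp.mk a₀ x.1 x.2 :=
  collapse_isQuotientMap _

lemma Susp.induction {P : Susp a₀ → Prop} (h : ∀ a t, P (Susp.mk a₀ a t)) (s : Susp a₀) : P s :=
  Quotient.inductionOn s fun q => h q.1 q.2

lemma out_mk (a : A) (t : unitInterval) : (Susp.mk a₀ a t).out = (a, t) ∨
    ((Susp.mk a₀ a t).out ∈ {q : A × unitInterval | q.1 = a₀ ∨ q.2 = 0 ∨ q.2 = 1} ∧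
      (a, t) ∈ {q : A × unitInterval | q.1 = a₀ ∨ q.2 = 0 ∨ q.2 = 1}) :=
  Quotient.exact (Quotient.out_eq (Susp.mk a₀ a t))

/-- Off the base point the quotient map is injective and restricts to a quotient map over an open
set, so the chosen representative is its continuous inverse there. -/
lemma continuousOn_out (h : IsClosed {Susp.base a₀}) :
    ContinuousOn (fun s : Susp a₀ => s.out) {Susp.base a₀}ᶜ := by
  have hq := (mk_isQuotientMap a₀).restrictPreimage_isOpen h.isOpen_compl
  rw [continuousOn_iff_continuous_domRestrict, hq.continuous_iff]
  refine Continuous.congr continuous_subtype_val fun x => ?_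
  rcases out_mk (a₀ := a₀) x.1.1 x.1.2 with h | h
  · exact h.symm
  · exact absurd (Susp.mk_eq_base h.2) x.2

variable {X Z : Type*} [TopologicalSpace X] [TopologicalSpace Z]

/-- The first half of the path which runs forth and back. -/
def ramp : C(unitInterval, unitInterval) := ⟨fun t => clamp (8 * (t : ℝ) - 1), by fun_prop⟩

/-- A family of maps `A × [0, 1] → X` with prescribed common value on `A × {0, 1}` gives a family
of maps `ΣA → X`, by dividing by its restriction to the base point of `A`. -/
lemma exists_doubling (N : NDR ({a₀} : Set A)) (n : C(Z × (A × unitInterval), X)) (c : C(Z, X))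
    (h0 : ∀ z a, n (z, (a, 0)) = c z) (h1 : ∀ z a, n (z, (a, 1)) = c z) :
    ∃ n' : C(Z × Susp a₀, X), (∀ z, n' (z, Susp.base a₀) = c z) ∧
      ∀ z, (∀ t, n (z, (a₀, t)) = c z) →
        ∀ a t, n' (z, Susp.mk a₀ a t) = n (z, (N.H (a, 1), ramp t)) := by
  let w : C(A, unitInterval) := ⟨fun a => clamp (2 * (N.u a : ℝ) - 1), by fun_prop⟩
  let lam : C(unitInterval, unitInterval) :=
    ⟨fun t => clamp (min (8 * (t : ℝ) - 1) (7 - 8 * t)), by fun_prop⟩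
  let m : C(A × unitInterval, unitInterval) := ⟨fun x => min (lam x.2) (w x.1), by fun_prop⟩
  -- The first half follows `n` over `a` out, the second half follows `n` over `a₀` back. The
  -- excursion is cut off at height `w a`, which is `0` near `a₀`; where `w a < 1` the two halves
  -- lie over the same point `a₀`, so they match at `t = 1/2`.
  let k : Z × (A × unitInterval) → X := fun x =>
    if (x.2.2 : ℝ) ≤ 1 / 2 then n (x.1, (N.H (x.2.1, 1), m x.2)) else n (x.1, (a₀, m x.2))
  have hw : ∀ a, w a = 1 ∨ N.H (a, 1) = a₀ := fun a => by
    rcases lt_or_ge (N.u a) 1 with h | h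
    · exact Or.inr (N.H_end a 1 unitInterval.le_one' h)
    · refine Or.inl (clamp_of_ge ?_)
      have : (1 : ℝ) ≤ N.u a := h
      linarith
  have hk : Continuous k := by
    refine Continuous.if_le (by fun_prop) (by fun_prop) (by fun_prop) (by fun_prop) ?_
    rintro ⟨z, a, t⟩ ht
    have ht : (t : ℝ) = 1 / 2 := ht
    change n (z, (N.H (a, 1), m (a, t))) = n (z, (a₀, m (a, t)))
    rcases hw a with h | h
    · have hl : lam t = 1 := clamp_of_ge (by rw [ht]; norm_num)
      have : m (a, t) = 1 := by
        change min (lam t) (w a) = 1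
        rw [hl, h, min_self]
      rw [this, h1, h1]
    · rw [h]
  have hk0 : ∀ z x, m x = 0 → k (z, x) = c z := fun z x hx => by
    simp only [k, hx, h0, ite_self]
  have hm1 : ∀ x : A × unitInterval, (x.2 : ℝ) ≤ 1 / 8 → m x = 0 := fun x hx => by
    have : lam x.2 = 0 := clamp_of_le (min_le_of_left_le (by linarith))
    change min (lam x.2) (w x.1) = 0
    rw [this, min_eq_left unitInterval.nonneg']
  have hm2 : ∀ x : A × unitInterval, (7 : ℝ) / 8 ≤ x.2 → m x = 0 := fun x hx => by
    have : lam x.2 = 0 := clamp_of_le (min_le_of_right_le (by linarith))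
    change min (lam x.2) (w x.1) = 0
    rw [this, min_eq_left unitInterval.nonneg']
  have hm3 : ∀ x : A × unitInterval, (N.u x.1 : ℝ) ≤ 1 / 2 → m x = 0 := fun x hx => by
    have : w x.1 = 0 := clamp_of_le (by linarith)
    change min (lam x.2) (w x.1) = 0
    rw [this, min_eq_right unitInterval.nonneg']
  let O : Set (A × unitInterval) :=
    {x | (N.u x.1 : ℝ) < 1 / 2} ∪ ({x | (x.2 : ℝ) < 1 / 8} ∪ {x | (7 : ℝ) / 8 < x.2})
  have hO : IsOpen O := (isOpen_lt (by fun_prop) (by fun_prop)).union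
    ((isOpen_lt (by fun_prop) (by fun_prop)).union (isOpen_lt (by fun_prop) (by fun_prop)))
  have hmO : ∀ x ∈ O, m x = 0 := fun x hx => by
    rcases hx with h | h | h
    · exact hm3 x h.le
    · exact hm1 x h.le
    · exact hm2 x h.le
  have hPO : ∀ x : A × unitInterval, (x.1 = a₀ ∨ x.2 = 0 ∨ x.2 = 1) → x ∈ O := by
    rintro ⟨a, t⟩ (h | h | h)
    · refine Or.inl ?_
      have h' : a = a₀ := h
      change (N.u a : ℝ) < 1 / 2
      rw [N.u_mem a h']
      norm_num
    · refine Or.inr (Or.inl ?_)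
      obtain rfl : t = 0 := h
      change ((0 : unitInterval) : ℝ) < 1 / 8
      simp
    · refine Or.inr (Or.inr ?_)
      obtain rfl : t = 1 := h
      change (7 : ℝ) / 8 < ((1 : unitInterval) : ℝ)
      rw [Set.Icc.coe_one]
      norm_num
  have hkmk : ∀ z a t, k (z, (Susp.mk a₀ a t).out) = k (z, (a, t)) := fun z a t => by
    rcases out_mk (a₀ := a₀) a t with h | ⟨h, h'⟩
    · rw [h]
    · rw [hk0 z _ (hmO _ (hPO _ h)), hk0 z _ (hmO _ (hPO _ h'))]
  -- Since the map equals `c z` on a whole neighbourhood of the base point, continuity on `Z × Susp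
  -- a₀` is local and requires no compactness of `Z`.
  let V : Set (Susp a₀) := {s | s.out ∈ O}
  have hV : IsOpen V := by
    rw [← (mk_isQuotientMap a₀).isOpen_preimage]
    refine (congrArg IsOpen (Set.ext fun x => ?_)).mpr hO
    rcases out_mk (a₀ := a₀) x.1 x.2 with h | ⟨h, h'⟩
    · exact iff_of_eq (congrArg (· ∈ O) h)
    · exact iff_of_true (hPO _ h) (hPO _ h')
  have hbase : IsClosed {Susp.base a₀} := (ndrSusp N).isClosed
  have hc : Continuous fun x : Z × Susp a₀ => k (x.1, x.2.out) := by
    rw [← continuousOn_univ]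
    have c1 : ContinuousOn (fun x : Z × Susp a₀ => k (x.1, x.2.out))
        (Prod.snd ⁻¹' {Susp.base a₀}ᶜ) :=
      hk.comp_continuousOn (continuousOn_fst.prodMk
        ((continuousOn_out hbase).comp continuousOn_snd (Set.mapsTo_preimage _ _)))
    have c2 : ContinuousOn (fun x : Z × Susp a₀ => k (x.1, x.2.out)) (Prod.snd ⁻¹' V) :=
      (show Continuous fun x : Z × Susp a₀ => c x.1 by fun_prop).continuousOn.congr
        fun x hx => hk0 _ _ (hmO _ hx)
    refine (c1.union_of_isOpen c2 (hbase.isOpen_compl.preimage continuous_snd)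
      (hV.preimage continuous_snd)).mono fun x _ => ?_
    by_cases h : x.2 = Susp.base a₀
    · refine Or.inr ?_
      change x.2.out ∈ O
      rw [h]
      rcases out_mk (a₀ := a₀) a₀ 0 with h | ⟨h, _⟩
      · rw [Susp.base, h]
        exact hPO _ (Or.inl rfl)
      · exact hPO _ h
    · exact Or.inl h
  refine ⟨⟨_, hc⟩, fun z => ?_, fun z hz a t => ?_⟩
  · exact (hkmk z a₀ 0).trans (hk0 z _ (hmO _ (hPO _ (Or.inl rfl))))
  · refine (hkmk z a t).trans ?_
    by_cases ht : (t : ℝ) ≤ 1 / 2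
    · refine (if_pos ht).trans ?_
      rcases hw a with h | h
      · have hl : lam t = ramp t := by
          change clamp (min (8 * (t : ℝ) - 1) (7 - 8 * t)) = clamp (8 * (t : ℝ) - 1)
          rw [min_eq_left (by linarith)]
        have : m (a, t) = ramp t := by
          change min (lam t) (w a) = ramp t
          rw [h, min_eq_left unitInterval.le_one', hl]
        simp only [this]
      · simp only [h, hz]
    · refine (if_neg ht).trans ?_
      have : ramp t = 1 := clamp_of_ge (by linarith)
      rw [hz, this, h1]

end

section

variable {A B X : Type u} [TopologicalSpace A] [TopologicalSpace B] [TopologicalSpace X]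
  {a₀ : A} {b₀ : B} {x₀ : X}

/-- A surjection of the unit interval which is constant near the end points. -/
def plateau : C(unitInterval, unitInterval) := ⟨fun t => clamp (2 * (t : ℝ) - 1 / 2), by fun_prop⟩

lemma plateau_zero : plateau 0 = 0 := clamp_of_le (by simp)

lemma plateau_one : plateau 1 = 1 := clamp_of_ge (by simp; norm_num)

/-- A homotopy between `α β` and `β α` gives a map of the square with the values of `α` on two
opposite edges and the values of `β` on the other two. -/
lemma exists_square {Q : Type*} [TopologicalSpace Q] {f g : C(Q, Path x₀ x₀)}
    (h : (mul f g).Homotopic (mul g f)) :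
    ∃ M : C(Q × (unitInterval × unitInterval), X),
      (∀ q u, M (q, (u, 0)) = f q (plateau u)) ∧ (∀ q u, M (q, (u, 1)) = f q (plateau u)) ∧
      (∀ q v, M (q, (0, v)) = g q (plateau v)) ∧ ∀ q v, M (q, (1, v)) = g q (plateau v) := by
  obtain ⟨K⟩ := h
  -- Here `s` is the homotopy parameter and `t` the position on the loop. Below the diagonal the
  -- square follows `f g`, above it `g f`. Near the corners `(0, 0)` and `(1, 1)`, where `s` is
  -- intermediate on the edges, `plateau` forces `t` to be `0` or `1`, and every loop is at `x₀`.
  let s : C(unitInterval × unitInterval, unitInterval) :=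
    ⟨fun x => clamp (1 / 2 + 2 * ((x.2 : ℝ) - x.1)), by fun_prop⟩
  let t : C(unitInterval × unitInterval, unitInterval) :=
    ⟨fun x => clamp (((plateau x.1 : ℝ) + plateau x.2) / 2), by fun_prop⟩
  have hcont : Continuous fun x : Q × (unitInterval × unitInterval) => K (s x.2, x.1) (t x.2) := by
    have hK : Continuous fun x : Q × (unitInterval × unitInterval) => K (s x.2, x.1) := by fun_prop
    have ht : Continuous fun x : Q × (unitInterval × unitInterval) => t x.2 := by fun_prop
    exact hK.eval ht
  have hfg : ∀ (f g : C(Q, Path x₀ x₀)) q (r : unitInterval),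
      (mul f g) q (clamp ((r : ℝ) / 2)) = f q r := fun f g q r => by
    have h0 := r.2.1
    have h1 := r.2.2
    have e : ((clamp ((r : ℝ) / 2) : unitInterval) : ℝ) = r / 2 := by
      rw [clamp, Set.projIcc_of_mem _ ⟨by linarith, by linarith⟩]
    change ((f q).trans (g q)) _ = _
    rw [Path.trans_apply, dif_pos (by rw [e]; linarith)]
    refine congrArg (f q) (Subtype.ext ?_)
    simp only [e]
    ring
  have hfg' : ∀ (f g : C(Q, Path x₀ x₀)) q (r : unitInterval),
      (mul f g) q (clamp ((1 + (r : ℝ)) / 2)) = g q r := fun f g q r => by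
    have h0 := r.2.1
    have h1 := r.2.2
    have e : ((clamp ((1 + (r : ℝ)) / 2) : unitInterval) : ℝ) = (1 + r) / 2 := by
      rw [clamp, Set.projIcc_of_mem _ ⟨by linarith, by linarith⟩]
    change ((f q).trans (g q)) _ = _
    rw [Path.trans_apply]
    split_ifs with h
    · rw [e] at h
      have hr : r = 0 := Subtype.ext (le_antisymm (by rw [Set.Icc.coe_zero]; linarith) h0)
      subst hr
      rw [Path.source]
      refine apply_of_end _ (Or.inr (Subtype.ext ?_))
      simp only [e]
      simp
    · refine congrArg (g q) (Subtype.ext ?_)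
      simp only [e]
      ring
  have t0 : ∀ q x, plateau x.1 = 0 → plateau x.2 = 0 → K (s x, q) (t x) = x₀ :=
    fun q x h1 h2 => apply_of_end _ (Or.inl (clamp_of_le (by rw [h1, h2]; simp)))
  have t1 : ∀ q x, plateau x.1 = 1 → plateau x.2 = 1 → K (s x, q) (t x) = x₀ :=
    fun q x h1 h2 => apply_of_end _ (Or.inr (clamp_of_ge (by rw [h1, h2]; simp)))
  have s0 : ∀ q x, (x.2 : ℝ) ≤ x.1 - 1 / 4 → K (s x, q) = mul f g q := fun q x hx => by
    rw [show s x = 0 from clamp_of_le (by linarith), K.apply_zero]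
  have s1 : ∀ q x, (x.1 : ℝ) ≤ x.2 - 1 / 4 → K (s x, q) = mul g f q := fun q x hx => by
    rw [show s x = 1 from clamp_of_ge (by linarith), K.apply_one]
  have p0 : ∀ u : unitInterval, (u : ℝ) ≤ 1 / 4 → plateau u = 0 := fun u hu =>
    clamp_of_le (by linarith)
  have p1 : ∀ u : unitInterval, (3 : ℝ) / 4 ≤ u → plateau u = 1 := fun u hu =>
    clamp_of_ge (by linarith)
  have tl : ∀ u, t (u, 0) = clamp ((plateau u : ℝ) / 2) := fun u =>
    congrArg clamp (by simp [plateau_zero])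
  have tl' : ∀ v, t (0, v) = clamp ((plateau v : ℝ) / 2) := fun u =>
    congrArg clamp (by simp [plateau_zero])
  have tr : ∀ u, t (u, 1) = clamp ((1 + (plateau u : ℝ)) / 2) := fun u =>
    congrArg clamp (by simp [plateau_one, add_comm])
  have tr' : ∀ v, t (1, v) = clamp ((1 + (plateau v : ℝ)) / 2) := fun u =>
    congrArg clamp (by simp [plateau_one])
  refine ⟨⟨_, hcont⟩, fun q u => ?_, fun q u => ?_, fun q u => ?_, fun q u => ?_⟩
  · change K (s (u, 0), q) (t (u, 0)) = _
    rcases le_total (u : ℝ) (1 / 4) with hu | hu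
    · rw [t0 q _ (p0 u hu) plateau_zero, p0 u hu, Path.source]
    · rw [s0 q _ (by simpa using hu), tl, hfg]
  · change K (s (u, 1), q) (t (u, 1)) = _
    rcases le_total ((3 : ℝ) / 4) u with hu | hu
    · rw [t1 q _ (p1 u hu) plateau_one, p1 u hu, Path.target]
    · rw [s1 q _ (by simp only [Set.Icc.coe_one]; linarith), tr, hfg']
  · change K (s (0, u), q) (t (0, u)) = _
    rcases le_total (u : ℝ) (1 / 4) with hu | hu
    · rw [t0 q _ plateau_zero (p0 u hu), p0 u hu, Path.source]
    · rw [s1 q _ (by simpa using hu), tl', hfg]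
  · change K (s (1, u), q) (t (1, u)) = _
    rcases le_total ((3 : ℝ) / 4) u with hu | hu
    · rw [t1 q _ plateau_one (p1 u hu), p1 u hu, Path.target]
    · rw [s0 q _ (by simp only [Set.Icc.coe_one]; linarith), tr', hfg']

/-- A pointed map of a suspension is homotopic to its reparametrizations. -/
lemma exists_reparam_homotopy (N : NDR ({a₀} : Set A)) (f : C(Susp a₀, X))
    (κ : C(unitInterval, unitInterval)) (h0 : κ 0 = 0) (h1 : κ 1 = 1) :
    ∃ K : C(Susp a₀ × unitInterval, X),
      (∀ a t, K (Susp.mk a₀ a t, 0) = f (Susp.mk a₀ (N.H (a, 1)) (κ t))) ∧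
      (∀ s, K (s, 1) = f s) ∧ ∀ τ, K (Susp.base a₀, τ) = f (Susp.base a₀) := by
  let r : unitInterval → unitInterval → unitInterval := fun τ t =>
    clamp ((1 - (τ : ℝ)) * κ t + τ * t)
  let F : (A × unitInterval) → unitInterval → Susp a₀ := fun x τ =>
    Susp.mk a₀ (N.H (x.1, unitInterval.symm τ)) (r τ x.2)
  have hF : Continuous (Function.uncurry F) :=
    (Susp.continuous_mk a₀).comp (g := fun q : A × unitInterval => Susp.mk a₀ q.1 q.2)
      (f := fun x : (A × unitInterval) × unitInterval =>
        (N.H (x.1.1, unitInterval.symm x.2), r x.2 x.1.2)) (by fun_prop)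
  have hP : ∀ x τ, (x.1 = a₀ ∨ x.2 = 0 ∨ x.2 = 1) → F x τ = Susp.base a₀ := by
    rintro ⟨a, t⟩ τ (h | h | h)
    · exact Susp.mk_eq_base (Or.inl ((N.H_mem a h _).trans h))
    · obtain rfl : t = 0 := h
      exact Susp.mk_eq_base (Or.inr (Or.inl (clamp_of_le (by simp [h0]))))
    · obtain rfl : t = 1 := h
      exact Susp.mk_eq_base (Or.inr (Or.inr (clamp_of_ge (by simp [h1]))))
  let G : Susp a₀ × unitInterval → X := fun x => f (Quotient.lift (fun y => F y x.2)
    (fun y z hyz => by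
      rcases hyz with rfl | ⟨hy, hz⟩
      · rfl
      · rw [hP y _ hy, hP z _ hz]) x.1)
  have hG : ∀ a t τ, G (Susp.mk a₀ a t, τ) = f (F (a, t) τ) := fun _ _ _ => rfl
  have hc : Continuous G := by
    refine (mk_isQuotientMap a₀).continuous_lift_prod_left ?_
    exact f.continuous.comp hF
  refine ⟨⟨G, hc⟩, fun a t => ?_, fun s => ?_, fun τ => ?_⟩
  · change G (Susp.mk a₀ a t, 0) = _
    rw [hG]
    simp only [F, unitInterval.symm_zero]
    rw [show r 0 t = κ t from clamp_eq (by simp)]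
  · induction s using Susp.induction with
    | h a t =>
      change G (Susp.mk a₀ a t, 1) = _
      rw [hG]
      simp only [F, unitInterval.symm_one, N.H_zero]
      rw [show r 1 t = t from clamp_eq (by simp)]
  · exact congrArg f (hP _ _ (Or.inl rfl))

/-- If the adjoints of two pointed maps commute up to homotopy, the maps extend to the product. -/
theorem exists_extension (N : NDR ({a₀} : Set A)) (M : NDR ({b₀} : Set B))
    (f : C(Susp a₀, X)) (hf : f (Susp.base a₀) = x₀) (g : C(Susp b₀, X))
    (hg : g (Susp.base b₀) = x₀)
    (h : (mul ((adjoint f hf).comp ContinuousMap.fst) ((adjoint g hg).comp ContinuousMap.snd) :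
      C(A × B, Loops x₀)).Homotopic
      (mul ((adjoint g hg).comp ContinuousMap.snd) ((adjoint f hf).comp ContinuousMap.fst))) :
    ∃ μ : C(Susp a₀ × Susp b₀, X), (∀ s, μ (s, Susp.base b₀) = f s) ∧
      ∀ t, μ (Susp.base a₀, t) = g t := by
  obtain ⟨S, hS0, hS1, hT0, hT1⟩ := exists_square h
  have eS : ∀ a b t, ((adjoint f hf).comp ContinuousMap.fst : C(A × B, Loops x₀)) (a, b) t =
      f (Susp.mk a₀ a t) := fun _ _ _ => rfl
  have eT : ∀ a b t, ((adjoint g hg).comp ContinuousMap.snd : C(A × B, Loops x₀)) (a, b) t =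
      g (Susp.mk b₀ b t) := fun _ _ _ => rfl
  simp only [Prod.forall, eS, eT] at hS0 hS1 hT0 hT1
  have fb : ∀ {a t}, (a = a₀ ∨ t = 0 ∨ t = 1) → f (Susp.mk a₀ a t) = x₀ := fun h => by
    rw [Susp.mk_eq_base h, hf]
  have gb : ∀ {b t}, (b = b₀ ∨ t = 0 ∨ t = 1) → g (Susp.mk b₀ b t) = x₀ := fun h => by
    rw [Susp.mk_eq_base h, hg]
  -- First the `A`-direction is made into a suspension, with `(b, v)` as parameter. For `v = 0` and
  -- `v = 1` the edge over `a₀` is constant, so there `N₁` is a reparametrization of `f`.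
  obtain ⟨N₁, hN1, hN1'⟩ := exists_doubling N
    (⟨fun x => S ((x.2.1, x.1.1), (x.2.2, x.1.2)), by fun_prop⟩ :
      C((B × unitInterval) × (A × unitInterval), X))
    ⟨fun z => g (Susp.mk b₀ z.1 (plateau z.2)), g.continuous.comp
      ((Susp.continuous_mk b₀).comp (by fun_prop : Continuous
        fun z : B × unitInterval => (z.1, plateau z.2)))⟩
    (fun z a => hT0 a z.1 z.2) (fun z a => hT1 a z.1 z.2)
  simp only [ContinuousMap.coe_mk] at hN1 hN1'
  have hN0 : ∀ b a t, N₁ ((b, 0), Susp.mk a₀ a t) =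
      f (Susp.mk a₀ (N.H (a, 1)) (plateau (ramp t))) := fun b a t => by
    rw [hN1' (b, 0) (fun t => ?_), hS0]
    rw [hS0, fb (Or.inl rfl), plateau_zero, gb (Or.inr (Or.inl rfl))]
  have hN2 : ∀ b a t, N₁ ((b, 1), Susp.mk a₀ a t) =
      f (Susp.mk a₀ (N.H (a, 1)) (plateau (ramp t))) := fun b a t => by
    rw [hN1' (b, 1) (fun t => ?_), hS1]
    rw [hS1, fb (Or.inl rfl), plateau_one, gb (Or.inr (Or.inr rfl))]
  -- Then the same is done in the `B`-direction with parameter in `Susp a₀`. On the axes the result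
  -- is `f` and `g` up to reparametrization.
  obtain ⟨N₂, hM1, hM1'⟩ := exists_doubling M
    (⟨fun x => N₁ (x.2, x.1), by fun_prop⟩ : C(Susp a₀ × (B × unitInterval), X))
    ⟨fun s => N₁ ((b₀, 0), s), by fun_prop⟩
    (fun s b => by
      induction s using Susp.induction with
      | h a t => exact (hN0 b a t).trans (hN0 b₀ a t).symm)
    (fun s b => by
      induction s using Susp.induction with
      | h a t => exact (hN2 b a t).trans (hN0 b₀ a t).symm)
  simp only [ContinuousMap.coe_mk] at hM1 hM1'
  have hM2 : ∀ b t, N₂ (Susp.base a₀, Susp.mk b₀ b t) =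
      g (Susp.mk b₀ (M.H (b, 1)) (plateau (ramp t))) := fun b t => by
    rw [hM1' (Susp.base a₀) (fun t => ?_), hN1]
    rw [hN1, hN1, gb (Or.inl rfl), gb (Or.inl rfl)]
  have hκ0 : (plateau.comp ramp) 0 = 0 := by
    rw [ContinuousMap.comp_apply, show ramp 0 = 0 from clamp_of_le (by simp), plateau_zero]
  have hκ1 : (plateau.comp ramp) 1 = 1 := by
    rw [ContinuousMap.comp_apply, show ramp 1 = 1 from clamp_of_ge (by simp; norm_num),
      plateau_one]
  obtain ⟨K, hK0, hK1, hKb⟩ := exists_reparam_homotopy N f (plateau.comp ramp) hκ0 hκ1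
  obtain ⟨L, hL0, hL1, hLb⟩ := exists_reparam_homotopy M g (plateau.comp ramp) hκ0 hκ1
  -- Homotopy extension for the axes removes the reparametrizations, so that the restrictions become
  -- exactly `f` and `g`.
  obtain ⟨E, _, hEK, hEL⟩ := NDR.wedge_extend (ndrSusp N) (ndrSusp M) N₂ K L
    (fun s => by
      induction s using Susp.induction with
      | h a t =>
        rw [hK0, hM1, hN0]
        rfl)
    (fun s => by
      induction s using Susp.induction with
      | h a t =>
        rw [hL0, hM2]
        rfl)
    (fun τ => by rw [hKb, hLb, hf, hg])
  exact ⟨⟨fun q => E (q, 1), by fun_prop⟩, fun s => (hEK s 1).trans (hK1 s),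
    fun t => (hEL t 1).trans (hL1 t)⟩

end

end Samelson

end

/-! ### The criterion -/

theorem lemma4p1 (p : ℕ) [Fact p.Prime] (hp : p ≠ 2)
    -- the simply connected space `X`, with polynomial cohomology on generators `x 0, …, x (n - 1)`
    (X : Type u) [TopologicalSpace X] [SimplyConnectedSpace X] (x₀ : X)
    (n : ℕ) (deg : Fin n → ℕ) (hdeg : StrictMono deg)
    (x : ∀ s : Fin n, Samelson.ModCohomology p X (deg s))
    (φ : MvPolynomial (Fin n) (ZMod p) ≃+* Samelson.CohomologyRing p X)
    (hφ : ∀ s, φ (MvPolynomial.X s) = DirectSum.of (Samelson.ModCohomology p X) (deg s) (x s))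
    -- the pointed CW complexes `A` and `B`
    (A : Type u) [TopologicalSpace A] [T2Space A] [Topology.CWComplex (Set.univ : Set A)]
    (a₀ : A) (ha₀ : Samelson.IsVertex a₀)
    (B : Type u) [TopologicalSpace B] [T2Space B] [Topology.CWComplex (Set.univ : Set B)]
    (b₀ : B) (hb₀ : Samelson.IsVertex b₀)
    -- the pointed maps `ΣA → X` and `ΣB → X`
    (αbar : C(Samelson.Susp a₀, X)) (hα : αbar (Samelson.Susp.base a₀) = x₀)
    (βbar : C(Samelson.Susp b₀, X)) (hβ : βbar (Samelson.Susp.base b₀) = x₀)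
    (i j k : Fin n) (l : ℕ) (θ : Samelson.CohomologyOperation.{u} p (deg k) l)
    -- (1)
    (hαx : Samelson.pullback p αbar (deg i) (x i) ≠ 0)
    (hβx : Samelson.pullback p βbar (deg j) (x j) ≠ 0)
    -- (2)
    (dimA dimB : ℕ) (hA : Samelson.HasCWDimension A dimA) (hB : Samelson.HasCWDimension B dimB)
    (hdimA : dimA + 1 = deg i) (hdimB : dimB + 1 = deg j)
    -- (3)
    (hdec : Samelson.IsDecomposable
      (DirectSum.of (Samelson.ModCohomology p X) l (θ.app X (x k))))
    (c : ZMod p) (hc : c ≠ 0)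
    (hcoeff : MvPolynomial.coeff (Finsupp.single i 1 + Finsupp.single j 1)
      (φ.symm (DirectSum.of (Samelson.ModCohomology p X) l (θ.app X (x k)))) = c)
    -- (4)
    (hext : ∀ μ : C(Samelson.Susp a₀ × Samelson.Susp b₀, X),
      (∀ s, μ (s, Samelson.Susp.base b₀) = αbar s) →
      (∀ t, μ (Samelson.Susp.base a₀, t) = βbar t) →
      θ.app (Samelson.Susp a₀ × Samelson.Susp b₀) (Samelson.pullback p μ (deg k) (x k)) = 0) :
    -- the Samelson product of the adjoints is defined, and is not null-homotopic
    (∃ γ : C(Samelson.Smash a₀ b₀, Samelson.Loops x₀),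
      Samelson.IsSamelsonProduct (Samelson.adjoint αbar hα) (Samelson.adjoint βbar hβ) γ) ∧
    ∀ γ : C(Samelson.Smash a₀ b₀, Samelson.Loops x₀),
      Samelson.IsSamelsonProduct (Samelson.adjoint αbar hα) (Samelson.adjoint βbar hβ) γ →
      ¬ γ.HomotopicRel (ContinuousMap.const _ (Path.refl x₀)) {Samelson.Smash.base a₀ b₀} := by
  obtain ⟨N⟩ := Samelson.exists_ndr ha₀ hA
  obtain ⟨M⟩ := Samelson.exists_ndr hb₀ hB
  refine ⟨Samelson.exists_isSamelsonProduct N M _ _ ?_ ?_, fun γ hγ hnull => ?_⟩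
  · ext t
    exact (congrArg αbar (Samelson.Susp.mk_eq_base (Or.inl rfl))).trans hα
  · ext t
    exact (congrArg βbar (Samelson.Susp.mk_eq_base (Or.inl rfl))).trans hβ
  · obtain ⟨μ, hμA, hμB⟩ := Samelson.exists_extension N M αbar hα βbar hβ
      (Samelson.mul_comm_of_isSamelsonProduct hγ hnull)
    have hA' : SSetCohomology.restrictFst μ (Samelson.Susp.base b₀) = αbar :=
      ContinuousMap.ext hμA
    have hB' : SSetCohomology.restrictSnd μ (Samelson.Susp.base a₀) = βbar :=
      ContinuousMap.ext hμB
    refine Samelson.pullback_ne_zero hp hdeg.injective hφ (Samelson.twoCover_susp N)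
      (Samelson.twoCover_susp M) μ (hA'.symm ▸ hαx) (hB'.symm ▸ hβx) hdec
      (hcoeff.trans_ne hc) ?_
    rw [← θ.naturality]
    exact hext μ hμA hμB
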